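/- Let $\mathcal{B}_1\subset\mathbb{R}^2$ be the open unit disc. For $\varepsilon>0$ and $\Omega\in\mathbb{R}$ consider the Gross–Pitaevskii functional $$\mathcal{E}^{\mathrm{GP}}[\Psi]=\int_{\mathcal{B}_1}\Big\{|\nabla\Psi|^2-\Omega\,\Psi^*L\Psi+\frac{|\Psi|^4}{\varepsilon^2}\Big\}\,d\vec r,\qquad L=-i(x\,\partial_y-y\,\partial_x)=-i\,\frac{\partial}{\partial\vartheta},$$ on the $L^2$-normalized functions $\{\Psi\in H^1(\mathcal{B}_1;\mathbb{C}) : \|\Psi\|_2=1\}$. Let $n\ge 2$ be an integer and let $\Psi_n$ be a minimizer of $\mathcal{E}^{\mathrm{GP}}$ among the $L^2$-normalized $\Psi\in H^1(\mathcal{B}_1;\mathbb{C})$ with angular momentum $n$, i.e. $L\Psi=n\Psi$. If $$\Omega\le\frac{1}{\sqrt{\pi}\,\varepsilon},$$ then $\Psi_n$ is unstable: it is not a local minimizer of $\mathcal{E}^{\mathrm{GP}}$ on $\{\Psi\in H^1(\mathcal{B}_1;\mathbb{C}):\|\Psi\|_2=1\}$ with respect to the $H^1$ topology (every $H^1$-neighbourhood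 of $\Psi_n$ contains a normalized function of strictly smaller energy). -/

import Mathlib

open MeasureTheory
open scoped ContDiff ComplexConjugate

noncomputable section

namespace GrossPitaevskii

/-- The open unit disc of the plane. The plane `ℝ²` is `ℂ` with coordinates `x = z.re`, `y = z.im`
(same Euclidean norm, same Lebesgue measure). -/
abbrev disc : Set ℂ := Metric.ball 0 1

/-- The space `L²` of complex-valued functions on the unit disc. -/
abbrev L2Disc : Type := Lp ℂ 2 ((volume : Measure ℂ).restrict disc)

/-- `g` is the weak (distributional) derivative of `u` on the disc in the direction `v`:
`∫ (∂_v φ) u = - ∫ φ g` for all smooth `φ` with compact support inside the disc. -/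
def IsWeakDeriv (v : ℂ) (u g : L2Disc) : Prop :=
  ∀ φ : ℂ → ℝ, ContDiff ℝ ∞ φ → HasCompactSupport φ → tsupport φ ⊆ disc →
    ∫ z in disc, ((fderiv ℝ φ z v : ℝ) : ℂ) * u z = - ∫ z in disc, ((φ z : ℝ) : ℂ) * g z

/-- Triples of `L²` functions, read as `(Ψ, ∂Ψ/∂x, ∂Ψ/∂y)`. The topology is that of
`L² × L² × L²`, so on `H1Disc` below it is the topology of the `H¹` norm. -/
abbrev Triple : Type := L2Disc × L2Disc × L2Disc

/-- The Sobolev space `H¹` of the disc: each element is an `L²` function together with its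
(unique) weak partial derivatives, which are in `L²`. -/
def H1Disc : Set Triple :=
  {Ψ | IsWeakDeriv 1 Ψ.1 Ψ.2.1 ∧ IsWeakDeriv Complex.I Ψ.1 Ψ.2.2}

/-- The angular momentum `L Ψ = -i (x ∂_y Ψ - y ∂_x Ψ) = -i ∂Ψ/∂ϑ`. -/
def angularMomentum (Ψ : Triple) (z : ℂ) : ℂ :=
  -Complex.I * ((z.re : ℂ) * Ψ.2.2 z - (z.im : ℂ) * Ψ.2.1 z)

/-- The Gross-Pitaevskii functional
`∫ |∇Ψ|² - Ω Ψ* L Ψ + |Ψ|⁴ / ε²` on the unit disc. The real part only discards the imaginary part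
of `Ψ* L Ψ`, whose integral vanishes for every `Ψ` in `H¹`. -/
def energy (ε Ω : ℝ) (Ψ : Triple) : ℝ :=
  ∫ z in disc, (‖Ψ.2.1 z‖ ^ 2 + ‖Ψ.2.2 z‖ ^ 2
    - Ω * (conj (Ψ.1 z) * angularMomentum Ψ z).re + ‖Ψ.1 z‖ ^ 4 / ε ^ 2)

/-- The `L²`-normalized functions in `H¹`. -/
def normalized : Set Triple :=
  {Ψ | Ψ ∈ H1Disc ∧ ‖Ψ.1‖ = 1}

/-- The normalized functions in `H¹` with `L Ψ = n Ψ`. -/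
def normalizedWithAngularMomentum (n : ℕ) : Set Triple :=
  {Ψ | Ψ ∈ normalized ∧
    ∀ᵐ z ∂((volume : Measure ℂ).restrict disc), angularMomentum Ψ z = (n : ℂ) * Ψ.1 z}

end GrossPitaevskii

end

/-! A vortex of degree `n ≥ 2` is unstable because splitting it lowers the energy. Write the
minimizer as `F(r) e^{inθ}` and put `K = r F'`. The destabilizing direction is the derivative of `Ψ`
along the vector field `2/z`, whose flow carries `z²` to `z² + 4t` and so pulls a multiple zero
apart. In polar form it is `(K - nF)/r² e^{i(n+2)θ} + (K + nF)/r² e^{i(n-2)θ}`. Its modes differ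
from `n`, so every first-order term vanishes, and the normalized energy along `Ψ + tW` changes by
the second variation times `t²`, up to higher order (`not_isLocalMinOn_of_second_variation_neg`).

After averaging over angles (`second_variation_eq`) the second variation is a radial integral. The
radial Gross-Pitaevskii equation turns its integrand into an exact derivative plus `4|F|²(|F|²/ε² -
ν + 2nΩ)/r³`, where `ν` is the Lagrange multiplier shifted by `nΩ` (`hasDerivAt_boundaryTerm`). The
boundary term tends to zero at the core because `F` and `K - nF` decay there, and it is nonpositive
at `r = 1` because of the Neumann condition `K(1) = 0`.

The sign of the bulk term comes from three facts. At a maximum point of the density, with value `S`,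
the radial equation forces `ν ≥ n² + 2S/ε²` (`exists_max`). The disc has area `π` and the mass is
one, so `S ≥ 1/π`. If `Ω ≥ 0` then `2nΩ ≤ n² + Ω² ≤ n² + 1/(πε²) ≤ n² + S/ε²`, and the outer
inequality is trivial if `Ω ≤ 0`. Hence the bracket is at most `(|F|² - S)/ε² ≤ 0`, and it is
strictly negative somewhere since `F` vanishes at the core (`bulk_factor_le`,
`integral_bulkTerm_neg`).

The remaining work is regularity, starting from weak derivatives only. Angular momentum `n` is
turned into covariance under rotations and then into a profile (`exists_mode_of_angularMomentum`);
the profile is continuous and bounded (`exists_profile`) and solves the radial equation classically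
(`exists_isVortexProfile`); a bootstrap gives its decay at the core (`F_bound`, `U_bound`).
Conversely, `exists_isMode` shows that explicit functions `η(r) e^{ikθ}` belong to `H¹`. All
energies that are compared belong to essentially bounded functions, so no Sobolev embedding is
needed. -/

noncomputable section

namespace GrossPitaevskii

/-! ### Linear structure of `H¹` and of the angular momentum -/

/-- Lebesgue measure on the disc. -/
abbrev discMeasure : Measure ℂ := (volume : Measure ℂ).restrict disc

instance : IsFiniteMeasure discMeasure :=
  ⟨by simp⟩

theorem test_mul_integrable (φ : ℂ → ℂ) (hφ : Continuous φ) (hc : HasCompactSupport φ)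
    {u : ℂ → ℂ} (hu : Integrable u discMeasure) :
    Integrable (fun z => φ z * u z) discMeasure := by
  obtain ⟨C, hC⟩ := hφ.bounded_above_of_compact_support hc
  exact hu.bdd_mul hφ.aestronglyMeasurable (Filter.Eventually.of_forall hC)

theorem l2_integrable (u : L2Disc) : Integrable (fun z => u z) discMeasure :=
  (Lp.memLp u).integrable (by norm_num)

theorem fderiv_apply_continuous {φ : ℂ → ℝ} (hφ : ContDiff ℝ ∞ φ) (v : ℂ) :
    Continuous fun z => fderiv ℝ φ z v :=
  (hφ.continuous_fderiv (by simp)).clm_apply continuous_const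

theorem IsWeakDeriv.add {v : ℂ} {u g u' g' : L2Disc} (h : IsWeakDeriv v u g)
    (h' : IsWeakDeriv v u' g') : IsWeakDeriv v (u + u') (g + g') := by
  intro φ hφ hc hs
  have c1 : HasCompactSupport fun z => fderiv ℝ φ z v := hc.fderiv_apply ℝ v
  have c2 : Continuous fun z => ((fderiv ℝ φ z v : ℝ) : ℂ) :=
    Complex.continuous_ofReal.comp (fderiv_apply_continuous hφ v)
  have c3 : HasCompactSupport fun z => ((fderiv ℝ φ z v : ℝ) : ℂ) :=
    c1.comp_left (g := fun x : ℝ => (x : ℂ)) (by simp)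
  have c4 : Continuous fun z => ((φ z : ℝ) : ℂ) := Complex.continuous_ofReal.comp hφ.continuous
  have c5 : HasCompactSupport fun z => ((φ z : ℝ) : ℂ) :=
    hc.comp_left (g := fun x : ℝ => (x : ℂ)) (by simp)
  have e1 : ∫ z in disc, ((fderiv ℝ φ z v : ℝ) : ℂ) * (u + u') z
      = ∫ z in disc, (((fderiv ℝ φ z v : ℝ) : ℂ) * u z + ((fderiv ℝ φ z v : ℝ) : ℂ) * u' z) := by
    apply integral_congr_ae
    filter_upwards [Lp.coeFn_add u u'] with z hz
    rw [hz, Pi.add_apply, mul_add]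
  have e2 : ∫ z in disc, ((φ z : ℝ) : ℂ) * (g + g') z
      = ∫ z in disc, (((φ z : ℝ) : ℂ) * g z + ((φ z : ℝ) : ℂ) * g' z) := by
    apply integral_congr_ae
    filter_upwards [Lp.coeFn_add g g'] with z hz
    rw [hz, Pi.add_apply, mul_add]
  rw [e1, e2, integral_add (test_mul_integrable _ c2 c3 (l2_integrable u))
    (test_mul_integrable _ c2 c3 (l2_integrable u')),
    integral_add (test_mul_integrable _ c4 c5 (l2_integrable g))
    (test_mul_integrable _ c4 c5 (l2_integrable g')), h φ hφ hc hs, h' φ hφ hc hs]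
  ring

theorem IsWeakDeriv.smul {v : ℂ} {u g : L2Disc} (h : IsWeakDeriv v u g) (c : ℝ) :
    IsWeakDeriv v (c • u) (c • g) := by
  intro φ hφ hc hs
  have e1 : ∫ z in disc, ((fderiv ℝ φ z v : ℝ) : ℂ) * (c • u) z
      = ∫ z in disc, (c : ℂ) * (((fderiv ℝ φ z v : ℝ) : ℂ) * u z) := by
    apply integral_congr_ae
    filter_upwards [Lp.coeFn_smul c u] with z hz
    rw [hz, Pi.smul_apply, Complex.real_smul]
    ring
  have e2 : ∫ z in disc, ((φ z : ℝ) : ℂ) * (c • g) z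
      = ∫ z in disc, (c : ℂ) * (((φ z : ℝ) : ℂ) * g z) := by
    apply integral_congr_ae
    filter_upwards [Lp.coeFn_smul c g] with z hz
    rw [hz, Pi.smul_apply, Complex.real_smul]
    ring
  rw [e1, e2, integral_const_mul, integral_const_mul, h φ hφ hc hs]
  ring

theorem H1Disc.add {Φ W : Triple} (h : Φ ∈ H1Disc) (h' : W ∈ H1Disc) : Φ + W ∈ H1Disc :=
  ⟨h.1.add h'.1, h.2.add h'.2⟩

theorem H1Disc.smul {Φ : Triple} (h : Φ ∈ H1Disc) (c : ℝ) : c • Φ ∈ H1Disc :=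
  ⟨h.1.smul c, h.2.smul c⟩

theorem coeFn_add_smul (t : ℝ) (u w : L2Disc) :
    ∀ᵐ z ∂discMeasure, (u + t • w) z = u z + t * w z := by
  filter_upwards [Lp.coeFn_add u (t • w), Lp.coeFn_smul t w] with z h1 h2
  rw [h1, Pi.add_apply, h2, Pi.smul_apply, Complex.real_smul]

theorem coeFn_smul' (t : ℝ) (w : L2Disc) :
    ∀ᵐ z ∂discMeasure, (t • w) z = t * w z := by
  filter_upwards [Lp.coeFn_smul t w] with z h2
  rw [h2, Pi.smul_apply, Complex.real_smul]

theorem angularMomentum_add_smul (t : ℝ) (Φ W : Triple) :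
    ∀ᵐ z ∂discMeasure, angularMomentum (Φ + t • W) z
      = angularMomentum Φ z + t * angularMomentum W z := by
  filter_upwards [coeFn_add_smul t Φ.2.1 W.2.1, coeFn_add_smul t Φ.2.2 W.2.2] with z h1 h2
  unfold angularMomentum
  have e1 : (Φ + t • W).2.1 z = Φ.2.1 z + t * W.2.1 z := h1
  have e2 : (Φ + t • W).2.2 z = Φ.2.2 z + t * W.2.2 z := h2
  rw [e1, e2]
  ring

theorem angularMomentum_smul (t : ℝ) (W : Triple) :
    ∀ᵐ z ∂discMeasure, angularMomentum (t • W) z = t * angularMomentum W z := by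
  filter_upwards [coeFn_smul' t W.2.1, coeFn_smul' t W.2.2] with z h1 h2
  unfold angularMomentum
  have e1 : (t • W).2.1 z = t * W.2.1 z := h1
  have e2 : (t • W).2.2 z = t * W.2.2 z := h2
  rw [e1, e2]
  ring

/-! ### Expansion of the energy and of the norm along a line -/

/-- The symmetric bilinear density of the quadratic part of the energy. -/
def crossDensity (Ω : ℝ) (Φ W : Triple) (z : ℂ) : ℝ :=
  (conj (Φ.2.1 z) * W.2.1 z).re + (conj (Φ.2.2 z) * W.2.2 z).re
    - Ω / 2 * (conj (Φ.1 z) * angularMomentum W z + conj (W.1 z) * angularMomentum Φ z).re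

/-- The symmetric bilinear form of the quadratic part of the energy. -/
def crossForm (Ω : ℝ) (Φ W : Triple) : ℝ := ∫ z in disc, crossDensity Ω Φ W z

theorem l2_mul_integrable {u v : ℂ → ℂ} (hu : MemLp u 2 discMeasure) (hv : MemLp v 2 discMeasure) :
    Integrable (fun z => (conj (u z) * v z).re) discMeasure :=
  (MemLp.integrable_mul (p := 2) (q := 2) hu.star hv).re

theorem angularMomentum_memLp (Φ : Triple) : MemLp (angularMomentum Φ) 2 discMeasure := by
  have key : ∀ (c : ℂ → ℂ), Continuous c → (∀ z ∈ disc, ‖c z‖ ≤ 1) → ∀ u : L2Disc,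
      MemLp (fun z => c z * u z) 2 discMeasure := by
    intro c hc hb u
    refine (Lp.memLp u).of_le (hc.aestronglyMeasurable.mul (Lp.aestronglyMeasurable u)) ?_
    filter_upwards [ae_restrict_mem measurableSet_ball] with z hz
    rw [norm_mul]
    exact mul_le_of_le_one_left (norm_nonneg _) (hb z hz)
  have h1 := key (fun z => (z.re : ℂ)) (by fun_prop) (fun z hz => by
    have := Complex.abs_re_le_norm z
    simp only [disc, Metric.mem_ball, dist_zero_right] at hz
    simpa using this.trans hz.le) Φ.2.2
  have h2 := key (fun z => (z.im : ℂ)) (by fun_prop) (fun z hz => by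
    have := Complex.abs_im_le_norm z
    simp only [disc, Metric.mem_ball, dist_zero_right] at hz
    simpa using this.trans hz.le) Φ.2.1
  exact (h1.sub h2).const_mul (-Complex.I)

theorem crossDensity_integrable (Ω : ℝ) (Φ W : Triple) :
    Integrable (crossDensity Ω Φ W) discMeasure := by
  have h1 := l2_mul_integrable (Lp.memLp Φ.2.1) (Lp.memLp W.2.1)
  have h2 := l2_mul_integrable (Lp.memLp Φ.2.2) (Lp.memLp W.2.2)
  have h3 := l2_mul_integrable (Lp.memLp Φ.1) (angularMomentum_memLp W)
  have h4 := l2_mul_integrable (Lp.memLp W.1) (angularMomentum_memLp Φ)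
  refine ((h1.add h2).sub ((h3.add h4).const_mul (Ω / 2))).congr ?_
  filter_upwards with z
  simp [crossDensity]

theorem crossForm_add_smul (Ω : ℝ) (Φ W : Triple) (t : ℝ) :
    crossForm Ω (Φ + t • W) (Φ + t • W)
      = crossForm Ω Φ Φ + 2 * crossForm Ω Φ W * t + crossForm Ω W W * t ^ 2 := by
  have e : crossForm Ω (Φ + t • W) (Φ + t • W) = ∫ z in disc,
      (crossDensity Ω Φ Φ z + 2 * t * crossDensity Ω Φ W z + t ^ 2 * crossDensity Ω W W z) := by
    apply integral_congr_ae
    filter_upwards [coeFn_add_smul t Φ.2.1 W.2.1, coeFn_add_smul t Φ.2.2 W.2.2,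
      coeFn_add_smul t Φ.1 W.1, angularMomentum_add_smul t Φ W] with z h1 h2 h3 h4
    have e1 : (Φ + t • W).2.1 z = Φ.2.1 z + t * W.2.1 z := h1
    have e2 : (Φ + t • W).2.2 z = Φ.2.2 z + t * W.2.2 z := h2
    have e3 : (Φ + t • W).1 z = Φ.1 z + t * W.1 z := h3
    simp only [crossDensity, e1, e2, e3, h4]
    simp only [map_add, map_mul, Complex.conj_ofReal, Complex.add_re, Complex.mul_re,
      Complex.add_im, Complex.mul_im, Complex.conj_re, Complex.conj_im, Complex.ofReal_re,
      Complex.ofReal_im]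
    ring
  rw [e, integral_add (by
      exact (crossDensity_integrable Ω Φ Φ).add ((crossDensity_integrable Ω Φ W).const_mul _))
    ((crossDensity_integrable Ω W W).const_mul _),
    integral_add (crossDensity_integrable Ω Φ Φ) ((crossDensity_integrable Ω Φ W).const_mul _),
    integral_const_mul, integral_const_mul]
  simp only [crossForm]
  ring

theorem crossForm_smul_smul (Ω : ℝ) (Φ : Triple) (c : ℝ) :
    crossForm Ω (c • Φ) (c • Φ) = c ^ 2 * crossForm Ω Φ Φ := by
  unfold crossForm
  rw [← integral_const_mul]
  apply integral_congr_ae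
  filter_upwards [coeFn_smul' c Φ.2.1, coeFn_smul' c Φ.2.2,
    coeFn_smul' c Φ.1, angularMomentum_smul c Φ] with z h1 h2 h3 h4
  have e1 : (c • Φ).2.1 z = c * Φ.2.1 z := h1
  have e2 : (c • Φ).2.2 z = c * Φ.2.2 z := h2
  have e3 : (c • Φ).1 z = c * Φ.1 z := h3
  simp only [crossDensity, e1, e2, e3, h4]
  simp only [map_mul, Complex.conj_ofReal, Complex.add_re, Complex.mul_re,
    Complex.mul_im, Complex.conj_re, Complex.conj_im, Complex.ofReal_re,
    Complex.ofReal_im]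
  ring

/-- Essential boundedness. -/
def EssBounded (u : L2Disc) : Prop := ∃ C : ℝ, ∀ᵐ z ∂discMeasure, ‖u z‖ ≤ C

theorem EssBounded.smul {w : L2Disc} (hw : EssBounded w) (t : ℝ) : EssBounded (t • w) := by
  obtain ⟨D, hD⟩ := hw
  refine ⟨|t| * D, ?_⟩
  filter_upwards [hD, coeFn_smul' t w] with z h2 h3
  rw [h3, norm_mul, Complex.norm_real, Real.norm_eq_abs]
  exact mul_le_mul_of_nonneg_left h2 (abs_nonneg t)

theorem EssBounded.add {u w : L2Disc} (hu : EssBounded u) (hw : EssBounded w) :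
    EssBounded (u + w) := by
  obtain ⟨C, hC⟩ := hu
  obtain ⟨D, hD⟩ := hw
  refine ⟨C + D, ?_⟩
  filter_upwards [hC, hD, Lp.coeFn_add u w] with z h1 h2 h3
  rw [h3]
  exact (norm_add_le _ _).trans (add_le_add h1 h2)

theorem bounded_integrable {f : ℂ → ℝ} (hf : AEStronglyMeasurable f discMeasure) {C : ℝ}
    (h : ∀ᵐ z ∂discMeasure, |f z| ≤ C) : Integrable f discMeasure :=
  Integrable.of_bound hf C (by simpa using h)

/-- The quartic part of the energy, without the factor `ε⁻²`. -/
def quartic (u : L2Disc) : ℝ := ∫ z in disc, ‖u z‖ ^ 4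

/-- Boundedness makes the quartic density integrable, which is what allows the integral to be split;
a non-integrable term would be given the default value zero. -/
theorem energy_eq (ε Ω : ℝ) (Φ : Triple) (hb : EssBounded Φ.1) :
    energy ε Ω Φ = crossForm Ω Φ Φ + quartic Φ.1 / ε ^ 2 := by
  obtain ⟨C, hC⟩ := hb
  have hi : Integrable (fun z => ‖Φ.1 z‖ ^ 4) discMeasure := by
    refine bounded_integrable (C := C ^ 4) ((Lp.aestronglyMeasurable Φ.1).norm.pow 4) ?_
    filter_upwards [hC] with z hz
    rw [abs_of_nonneg (by positivity)]
    gcongr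
  unfold energy crossForm quartic
  rw [← integral_div, ← integral_add (crossDensity_integrable Ω Φ Φ) (hi.div_const _)]
  congr 1
  ext z
  congr 1
  simp only [crossDensity, Complex.sq_norm, Complex.normSq_apply, Complex.add_re, Complex.mul_re,
    Complex.conj_re, Complex.conj_im]
  ring

theorem quartic_smul (u : L2Disc) (c : ℝ) : quartic (c • u) = c ^ 4 * quartic u := by
  unfold quartic
  rw [← integral_const_mul]
  apply integral_congr_ae
  filter_upwards [coeFn_smul' c u] with z h
  rw [h, norm_mul, Complex.norm_real, mul_pow, Real.norm_eq_abs, Even.pow_abs (by decide)]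

theorem quartic_add_smul {u w : L2Disc} (hu : EssBounded u) (hw : EssBounded w) :
    ∃ c₃ c₄ : ℝ, ∀ t : ℝ, quartic (u + t • w) = quartic u
      + (∫ z in disc, 4 * ‖u z‖ ^ 2 * (conj (u z) * w z).re) * t
      + (∫ z in disc, (2 * ‖u z‖ ^ 2 * ‖w z‖ ^ 2 + 4 * (conj (u z) * w z).re ^ 2)) * t ^ 2
      + c₃ * t ^ 3 + c₄ * t ^ 4 := by
  obtain ⟨C, hC⟩ := hu
  obtain ⟨D, hD⟩ := hw
  have mu := Lp.aestronglyMeasurable u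
  have mw := Lp.aestronglyMeasurable w
  have mr : AEStronglyMeasurable (fun z => (conj (u z) * w z).re) discMeasure :=
    (l2_mul_integrable (Lp.memLp u) (Lp.memLp w)).aestronglyMeasurable
  have br : ∀ᵐ z ∂discMeasure, |(conj (u z) * w z).re| ≤ C * D := by
    filter_upwards [hC, hD] with z h1 h2
    refine (Complex.abs_re_le_norm _).trans ?_
    rw [norm_mul, RCLike.norm_conj]
    have := norm_nonneg (u z)
    have := norm_nonneg (w z)
    gcongr
    linarith
  have i0 : Integrable (fun z => ‖u z‖ ^ 4) discMeasure := by
    refine bounded_integrable (C := C ^ 4) (mu.norm.pow 4) ?_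
    filter_upwards [hC] with z hz
    rw [abs_of_nonneg (by positivity)]
    gcongr
  have i4 : Integrable (fun z => ‖w z‖ ^ 4) discMeasure := by
    refine bounded_integrable (C := D ^ 4) (mw.norm.pow 4) ?_
    filter_upwards [hD] with z hz
    rw [abs_of_nonneg (by positivity)]
    gcongr
  have i1 : Integrable (fun z => 4 * ‖u z‖ ^ 2 * (conj (u z) * w z).re) discMeasure := by
    refine bounded_integrable (C := 4 * C ^ 2 * (C * D)) (((mu.norm.pow 2).const_mul 4).mul mr) ?_
    filter_upwards [hC, br] with z h1 h2
    rw [abs_mul, abs_of_nonneg (by positivity : (0:ℝ) ≤ 4 * ‖u z‖ ^ 2)]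
    gcongr
  have i3 : Integrable (fun z => 4 * ‖w z‖ ^ 2 * (conj (u z) * w z).re) discMeasure := by
    refine bounded_integrable (C := 4 * D ^ 2 * (C * D)) (((mw.norm.pow 2).const_mul 4).mul mr) ?_
    filter_upwards [hD, br] with z h1 h2
    rw [abs_mul, abs_of_nonneg (by positivity : (0:ℝ) ≤ 4 * ‖w z‖ ^ 2)]
    gcongr
  have i2 : Integrable (fun z => 2 * ‖u z‖ ^ 2 * ‖w z‖ ^ 2 + 4 * (conj (u z) * w z).re ^ 2)
      discMeasure := by
    refine bounded_integrable (C := 2 * C ^ 2 * D ^ 2 + 4 * (C * D) ^ 2)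
      ((((mu.norm.pow 2).const_mul 2).mul (mw.norm.pow 2)).add ((mr.pow 2).const_mul 4)) ?_
    filter_upwards [hC, hD, br] with z h1 h2 h3
    rw [abs_of_nonneg (by positivity), ← sq_abs (conj (u z) * w z).re]
    gcongr
  refine ⟨∫ z in disc, 4 * ‖w z‖ ^ 2 * (conj (u z) * w z).re, ∫ z in disc, ‖w z‖ ^ 4,
    fun t => ?_⟩
  have e : quartic (u + t • w) = ∫ z in disc, (‖u z‖ ^ 4
      + (4 * ‖u z‖ ^ 2 * (conj (u z) * w z).re) * t
      + (2 * ‖u z‖ ^ 2 * ‖w z‖ ^ 2 + 4 * (conj (u z) * w z).re ^ 2) * t ^ 2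
      + (4 * ‖w z‖ ^ 2 * (conj (u z) * w z).re) * t ^ 3 + ‖w z‖ ^ 4 * t ^ 4) := by
    apply integral_congr_ae
    filter_upwards [coeFn_add_smul t u w] with z hz
    rw [hz]
    have q : ∀ x : ℂ, ‖x‖ ^ 4 = (‖x‖ ^ 2) ^ 2 := fun x => by ring
    simp only [q, Complex.sq_norm, Complex.normSq_apply, Complex.add_re, Complex.mul_re,
      Complex.add_im, Complex.mul_im, Complex.conj_re, Complex.conj_im, Complex.ofReal_re,
      Complex.ofReal_im]
    ring
  rw [e, integral_add (by exact (((i0.add (i1.mul_const _)).add (i2.mul_const _)).add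
      (i3.mul_const _))) (i4.mul_const _),
    integral_add (by exact ((i0.add (i1.mul_const _)).add (i2.mul_const _))) (i3.mul_const _),
    integral_add (by exact (i0.add (i1.mul_const _))) (i2.mul_const _),
    integral_add i0 (i1.mul_const _), integral_mul_const, integral_mul_const, integral_mul_const,
    integral_mul_const]
  rfl

theorem norm_sq_eq_integral (u : L2Disc) : ‖u‖ ^ 2 = ∫ z in disc, ‖u z‖ ^ 2 := by
  have h := inner_self_eq_norm_sq_to_K (𝕜 := ℂ) u
  rw [L2.inner_def] at h
  have h2 : ∀ z, inner ℂ (u z) (u z) = ((‖u z‖ ^ 2 : ℝ) : ℂ) := fun z => by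
    rw [inner_self_eq_norm_sq_to_K]; simp
  simp only [h2] at h
  rw [integral_complex_ofReal] at h
  have h3 := congrArg Complex.re h
  simpa [← Complex.ofReal_pow] using h3.symm

theorem norm_add_smul_sq (u w : L2Disc) (t : ℝ) :
    ‖u + t • w‖ ^ 2 = ‖u‖ ^ 2 + 2 * (∫ z in disc, (conj (u z) * w z).re) * t + ‖w‖ ^ 2 * t ^ 2 := by
  have i0 : ∀ u : L2Disc, Integrable (fun z => ‖u z‖ ^ 2) discMeasure := fun u =>
    (Lp.memLp u).integrable_norm_pow (by norm_num)
  have i1 := l2_mul_integrable (Lp.memLp u) (Lp.memLp w)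
  have e : ‖u + t • w‖ ^ 2 = ∫ z in disc, (‖u z‖ ^ 2 + (conj (u z) * w z).re * (2 * t)
      + ‖w z‖ ^ 2 * t ^ 2) := by
    rw [norm_sq_eq_integral]
    apply integral_congr_ae
    filter_upwards [coeFn_add_smul t u w] with z hz
    rw [hz]
    simp only [Complex.sq_norm, Complex.normSq_apply, Complex.add_re, Complex.mul_re,
      Complex.add_im, Complex.mul_im, Complex.conj_re, Complex.conj_im, Complex.ofReal_re,
      Complex.ofReal_im]
    ring
  rw [e, integral_add (by exact (i0 u).add (i1.mul_const _)) ((i0 w).mul_const _),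
    integral_add (i0 u) (i1.mul_const _), integral_mul_const, integral_mul_const,
    ← norm_sq_eq_integral, ← norm_sq_eq_integral]
  ring

/-! ### First and second variation on the unit sphere of `L²` -/

theorem energy_normalize (ε Ω : ℝ) (Φ : Triple) (hb : EssBounded Φ.1) :
    energy ε Ω (‖Φ.1‖⁻¹ • Φ) = crossForm Ω Φ Φ / ‖Φ.1‖ ^ 2
      + quartic Φ.1 / ε ^ 2 / (‖Φ.1‖ ^ 2) ^ 2 := by
  have e : (‖Φ.1‖⁻¹ • Φ).1 = ‖Φ.1‖⁻¹ • Φ.1 := rfl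
  rw [energy_eq _ _ _ (e ▸ hb.smul _), crossForm_smul_smul, e, quartic_smul, inv_pow, inv_pow,
    ← pow_mul]
  ring

theorem normalize_mem {Φ : Triple} (h : Φ ∈ H1Disc) (h0 : 0 < ‖Φ.1‖ ^ 2) :
    ‖Φ.1‖⁻¹ • Φ ∈ normalized := by
  refine ⟨H1Disc.smul h _, ?_⟩
  have : ‖Φ.1‖ ≠ 0 := fun h => by simp [h] at h0
  change ‖‖Φ.1‖⁻¹ • Φ.1‖ = 1
  rw [norm_smul, norm_inv, norm_norm, inv_mul_cancel₀ this]

theorem angularMomentum_combination {n : ℕ} {Φ W : Triple}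
    (h : ∀ᵐ z ∂discMeasure, angularMomentum Φ z = (n : ℂ) * Φ.1 z)
    (h' : ∀ᵐ z ∂discMeasure, angularMomentum W z = (n : ℂ) * W.1 z) (c t : ℝ) :
    ∀ᵐ z ∂discMeasure, angularMomentum (c • (Φ + t • W)) z = (n : ℂ) * (c • (Φ + t • W)).1 z := by
  filter_upwards [h, h', angularMomentum_add_smul t Φ W, angularMomentum_smul c (Φ + t • W),
    coeFn_smul' c (Φ + t • W).1, coeFn_add_smul t Φ.1 W.1] with z h1 h2 h3 h4 h5 h6
  have e5 : (c • (Φ + t • W)).1 z = c * (Φ + t • W).1 z := h5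
  have e6 : (Φ + t • W).1 z = Φ.1 z + t * W.1 z := h6
  rw [h4, h3, h1, h2, e5, e6]
  ring

theorem div_add_div_sq_mul_sq (a b : ℝ) {N : ℝ} (hN : N ≠ 0) :
    (a / N + b / N ^ 2) * N ^ 2 = a * N + b := by
  field_simp

/-- The Lagrange multiplier of a normalized critical point. -/
def multiplier (ε Ω : ℝ) (Ψ : Triple) : ℝ := crossForm Ω Ψ Ψ + 2 * (quartic Ψ.1 / ε ^ 2)

/-- The competitors are the normalized functions `Ψ + tW`, which keep angular momentum `n`. Along a
ray the energy is `A/N + V/N²`, with `N` the squared norm; differentiating in `N` at `N = 1`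
produces the multiplier `A + 2V`. -/
theorem euler_lagrange {ε Ω : ℝ} {n : ℕ} {Ψ W : Triple}
    (hΨ : Ψ ∈ normalizedWithAngularMomentum n)
    (hmin : IsMinOn (energy ε Ω) (normalizedWithAngularMomentum n) Ψ)
    (hb : EssBounded Ψ.1) (hW : W ∈ H1Disc) (hbW : EssBounded W.1)
    (hn : ∀ᵐ z ∂discMeasure, angularMomentum W z = (n : ℂ) * W.1 z) :
    2 * crossForm Ω Ψ W + (∫ z in disc, 4 * ‖Ψ.1 z‖ ^ 2 * (conj (Ψ.1 z) * W.1 z).re) / ε ^ 2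
      - 2 * multiplier ε Ω Ψ * (∫ z in disc, (conj (Ψ.1 z) * W.1 z).re) = 0 := by
  obtain ⟨c₃, c₄, hq⟩ := quartic_add_smul hb hbW
  set A₀ := crossForm Ω Ψ Ψ with hA₀
  set A₁ := crossForm Ω Ψ W
  set A₂ := crossForm Ω W W
  set V₁ := ∫ z in disc, 4 * ‖Ψ.1 z‖ ^ 2 * (conj (Ψ.1 z) * W.1 z).re
  set V₂ := ∫ z in disc, (2 * ‖Ψ.1 z‖ ^ 2 * ‖W.1 z‖ ^ 2 + 4 * (conj (Ψ.1 z) * W.1 z).re ^ 2)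
  set s := ∫ z in disc, (conj (Ψ.1 z) * W.1 z).re
  set V₀ := quartic Ψ.1 with hV₀
  have h1 : ‖Ψ.1‖ = 1 := hΨ.1.2
  let N : ℝ → ℝ := fun t => 1 + 2 * s * t + ‖W.1‖ ^ 2 * t ^ 2
  -- The energy difference multiplied by `N²`: a polynomial in `t`, nonnegative near zero and zero
  -- at zero, so that minimality reduces to `P'(0) = 0`.
  let P : ℝ → ℝ := fun t => (A₀ + 2 * A₁ * t + A₂ * t ^ 2) * N t
    + (V₀ + V₁ * t + V₂ * t ^ 2 + c₃ * t ^ 3 + c₄ * t ^ 4) / ε ^ 2 - (A₀ + V₀ / ε ^ 2) * N t ^ 2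
  have hN : ∀ t, ‖(Ψ + t • W).1‖ ^ 2 = N t := fun t => by
    have := norm_add_smul_sq Ψ.1 W.1 t
    rw [h1, one_pow] at this
    exact this
  have hN0 : ∀ᶠ t in nhds (0 : ℝ), 0 < N t := by
    have : Continuous N := by fun_prop
    exact this.continuousAt.eventually (lt_mem_nhds (by simp [N]))
  have hP : IsLocalMin P 0 := by
    filter_upwards [hN0] with t ht
    have hP0 : P 0 = 0 := by simp [P, N]
    rw [hP0]
    have hbt : EssBounded (Ψ + t • W).1 := hb.add (hbW.smul t)
    have hmem : ‖(Ψ + t • W).1‖⁻¹ • (Ψ + t • W) ∈ normalizedWithAngularMomentum n :=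
      ⟨normalize_mem (H1Disc.add hΨ.1.1 (H1Disc.smul hW t)) (by rw [hN]; exact ht),
        angularMomentum_combination hΨ.2 hn _ _⟩
    have hle : energy ε Ω Ψ ≤ _ := hmin hmem
    rw [energy_normalize _ _ _ hbt, energy_eq _ _ _ hb, hN, crossForm_add_smul] at hle
    have hq' : quartic (Ψ + t • W).1 = _ := hq t
    rw [hq'] at hle
    have := mul_le_mul_of_nonneg_right hle (sq_nonneg (N t))
    rw [div_add_div_sq_mul_sq _ _ ht.ne'] at this
    simp only [P]
    nlinarith [this]
  have hN' : HasDerivAt N (2 * s) 0 := by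
    have h := (((hasDerivAt_id (0 : ℝ)).const_mul (2 * s)).const_add 1).add
      ((hasDerivAt_pow 2 (0 : ℝ)).const_mul (‖W.1‖ ^ 2))
    exact h.congr_deriv (by simp)
  have hA' : HasDerivAt (fun t : ℝ => A₀ + 2 * A₁ * t + A₂ * t ^ 2) (2 * A₁) 0 := by
    have h := (((hasDerivAt_id (0 : ℝ)).const_mul (2 * A₁)).const_add A₀).add
      ((hasDerivAt_pow 2 (0 : ℝ)).const_mul A₂)
    exact h.congr_deriv (by simp)
  have hV' : HasDerivAt (fun t : ℝ => V₀ + V₁ * t + V₂ * t ^ 2 + c₃ * t ^ 3 + c₄ * t ^ 4) V₁ 0 := by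
    have h := ((((hasDerivAt_id (0 : ℝ)).const_mul V₁).const_add V₀).add
      ((hasDerivAt_pow 2 (0 : ℝ)).const_mul V₂)).add ((hasDerivAt_pow 3 (0 : ℝ)).const_mul c₃)
      |>.add ((hasDerivAt_pow 4 (0 : ℝ)).const_mul c₄)
    exact h.congr_deriv (by simp)
  have hP' := ((hA'.mul hN').add (hV'.div_const (ε ^ 2))).sub ((hN'.pow 2).const_mul
    (A₀ + V₀ / ε ^ 2))
  have h0 := hP.hasDerivAt_eq_zero hP'
  simp only [N, multiplier, ← hA₀, ← hV₀] at h0 ⊢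
  norm_num at h0
  linarith

/-- With the three first-order terms absent, the squared norm of `Ψ + tW` is `1 + Bt²`, and the
energy difference after normalization, multiplied by the square of that norm squared, equals `t²
R(t)` for a polynomial `R`. The value `R(0)` is the second variation. -/
theorem not_isLocalMinOn_of_second_variation_neg {ε Ω : ℝ} {Ψ W : Triple}
    (hΨ : Ψ ∈ normalized) (hb : EssBounded Ψ.1) (hW : W ∈ H1Disc) (hbW : EssBounded W.1)
    (hA₁ : crossForm Ω Ψ W = 0)
    (hV₁ : ∫ z in disc, 4 * ‖Ψ.1 z‖ ^ 2 * (conj (Ψ.1 z) * W.1 z).re = 0)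
    (hs : ∫ z in disc, (conj (Ψ.1 z) * W.1 z).re = 0)
    (hneg : crossForm Ω W W
      + (∫ z in disc, (2 * ‖Ψ.1 z‖ ^ 2 * ‖W.1 z‖ ^ 2 + 4 * (conj (Ψ.1 z) * W.1 z).re ^ 2)) / ε ^ 2
      - multiplier ε Ω Ψ * ‖W.1‖ ^ 2 < 0) :
    ¬ IsLocalMinOn (energy ε Ω) normalized Ψ := by
  intro hloc
  obtain ⟨c₃, c₄, hq⟩ := quartic_add_smul hb hbW
  rw [hV₁] at hq
  set A₀ := crossForm Ω Ψ Ψ with hA₀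
  set A₂ := crossForm Ω W W
  set V₂ := ∫ z in disc, (2 * ‖Ψ.1 z‖ ^ 2 * ‖W.1 z‖ ^ 2 + 4 * (conj (Ψ.1 z) * W.1 z).re ^ 2)
  set V₀ := quartic Ψ.1 with hV₀
  have h1 : ‖Ψ.1‖ = 1 := hΨ.2
  set B := ‖W.1‖ ^ 2 with hB
  have hB0 : 0 ≤ B := sq_nonneg _
  have hN : ∀ t : ℝ, ‖(Ψ + t • W).1‖ ^ 2 = 1 + B * t ^ 2 := fun t => by
    have := norm_add_smul_sq Ψ.1 W.1 t
    rw [h1, one_pow, hs] at this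
    have h2 : ‖(Ψ + t • W).1‖ ^ 2 = _ := this
    rw [h2]; ring
  have hN0 : ∀ t : ℝ, 0 < 1 + B * t ^ 2 := fun t => by positivity
  have hcont : Filter.Tendsto (fun t : ℝ => ‖(Ψ + t • W).1‖⁻¹ • (Ψ + t • W))
      (nhds 0) (nhds Ψ) := by
    have hc : ContinuousAt (fun t : ℝ => ‖(Ψ + t • W).1‖⁻¹ • (Ψ + t • W)) 0 := by
      have c1 : Continuous fun t : ℝ => Ψ + t • W := by fun_prop
      exact ((c1.fst.norm.continuousAt).inv₀ (by simp [h1])).smul c1.continuousAt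
    have := hc.tendsto
    simpa [h1] using this
  have hev : ∀ᶠ t in nhds (0 : ℝ), energy ε Ω Ψ ≤ energy ε Ω (‖(Ψ + t • W).1‖⁻¹ • (Ψ + t • W)) := by
    have h2 : ∀ᶠ x in nhds Ψ, x ∈ normalized → energy ε Ω Ψ ≤ energy ε Ω x :=
      eventually_nhdsWithin_iff.1 hloc
    filter_upwards [hcont.eventually h2] with t ht
    exact ht (normalize_mem (H1Disc.add hΨ.1 (H1Disc.smul hW t)) (by rw [hN]; exact hN0 t))
  let R : ℝ → ℝ := fun t => A₂ + V₂ / ε ^ 2 - (A₀ + 2 * (V₀ / ε ^ 2)) * B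
    + t * (c₃ / ε ^ 2) + t ^ 2 * (A₂ * B + c₄ / ε ^ 2 - (A₀ + V₀ / ε ^ 2) * B ^ 2)
  have hR : ∀ᶠ t in nhds (0 : ℝ), R t < 0 := by
    have : Continuous R := by fun_prop
    refine this.continuousAt.eventually (gt_mem_nhds ?_)
    simpa [R, multiplier, ← hA₀, ← hV₀] using hneg
  -- A nonzero `t` is needed, because `t² R(t)` is strictly negative only then.
  have hpos : ∃ᶠ t in nhds (0 : ℝ), 0 < t :=
    (eventually_mem_nhdsWithin (a := (0:ℝ)) (s := Set.Ioi 0)).frequently.filter_mono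
      nhdsWithin_le_nhds
  obtain ⟨t, ht0, ht1, ht2⟩ := (hpos.and_eventually (hev.and hR)).exists
  have hbt : EssBounded (Ψ + t • W).1 := hb.add (hbW.smul t)
  have hq' : quartic (Ψ + t • W).1 = _ := hq t
  rw [energy_normalize _ _ _ hbt, energy_eq _ _ _ hb, hN, crossForm_add_smul, hA₁, hq'] at ht1
  have := mul_le_mul_of_nonneg_right ht1 (sq_nonneg (1 + B * t ^ 2))
  have hne := (hN0 t).ne'
  rw [div_add_div_sq_mul_sq _ _ hne] at this
  have h3 : 0 ≤ t ^ 2 * R t := by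
    simp only [R]
    simp only [← hA₀, ← hV₀] at this
    ring_nf at this ⊢
    linarith
  have h4 : t ^ 2 * R t < 0 := mul_neg_of_pos_of_neg (by positivity) ht2
  linarith

/-! ### Removability of the origin for weak derivatives -/

/-- The punctured disc. -/
abbrev puncturedDisc : Set ℂ := disc \ {0}

theorem isOpen_puncturedDisc : IsOpen puncturedDisc :=
  Metric.isOpen_ball.sdiff isClosed_singleton

theorem discMeasure_eq_punctured :
    discMeasure = (volume : Measure ℂ).restrict puncturedDisc :=
  Measure.restrict_congr_set (sdiff_null_ae_eq_self (measure_singleton 0)).symm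

theorem ae_mem_puncturedDisc : ∀ᵐ z ∂discMeasure, z ∈ puncturedDisc := by
  rw [discMeasure_eq_punctured]
  exact ae_restrict_mem isOpen_puncturedDisc.measurableSet

theorem aestronglyMeasurable_of_continuousOn {f : ℂ → ℂ} (h : ContinuousOn f puncturedDisc) :
    AEStronglyMeasurable f discMeasure := by
  rw [discMeasure_eq_punctured]
  exact h.aestronglyMeasurable isOpen_puncturedDisc.measurableSet

theorem integrable_inv_norm : Integrable (fun z : ℂ => ‖z‖⁻¹) discMeasure := by
  have h := (integrableOn_fun_norm_addHaar (volume : Measure ℂ) (f := fun y : ℝ => y⁻¹) (r := 1)).2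
    (by
      rw [Complex.finrank_real_complex]
      have : IntegrableOn (fun _ : ℝ => (1 : ℝ)) (Set.Ioo 0 1) := by simp
      refine this.congr_fun (fun y hy => ?_) measurableSet_Ioo
      simp [mul_inv_cancel₀ hy.1.ne'])
  exact h

theorem hasLineDerivAt_cutoff {d : ℝ} (hd : 0 < d) (z v : ℂ) :
    HasLineDerivAt ℝ (fun z : ℂ => ‖z‖ ^ 2 / (‖z‖ ^ 2 + d ^ 2))
      (d ^ 2 * (2 * inner ℝ z v) / (‖z‖ ^ 2 + d ^ 2) ^ 2) z v := by
  unfold HasLineDerivAt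
  have h1 : HasDerivAt (fun t : ℝ => z + t • v) v 0 := by
    simpa using ((hasDerivAt_id (0 : ℝ)).smul_const v).const_add z
  have h2 := h1.norm_sq
  have h3 := h2.div (h2.add_const (d ^ 2)) (by positivity)
  refine h3.congr_deriv ?_
  simp only [zero_smul, add_zero]
  ring

/-- The bound does not depend on the scale `d`, and `1/|z|` is integrable in the plane, so it serves
as a dominating function when `d` tends to zero. -/
theorem abs_cutoff_deriv_le {d : ℝ} (hd : 0 < d) {z : ℂ} (hz : z ≠ 0) (v : ℂ) :
    |d ^ 2 * (2 * inner ℝ z v) / (‖z‖ ^ 2 + d ^ 2) ^ 2| ≤ 2 * ‖v‖ * ‖z‖⁻¹ := by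
  have hz' : 0 < ‖z‖ := norm_pos_iff.2 hz
  have h1 := abs_real_inner_le_norm z v
  rw [abs_div, abs_mul, abs_mul, abs_of_pos (by positivity : 0 < d ^ 2),
    abs_of_pos (by positivity : 0 < (‖z‖ ^ 2 + d ^ 2) ^ 2), abs_two, div_le_iff₀ (by positivity)]
  have h2 : d ^ 2 * (2 * |inner ℝ z v|) ≤ d ^ 2 * (2 * (‖z‖ * ‖v‖)) := by gcongr
  refine h2.trans ?_
  have h3 : d ^ 2 * ‖z‖ ^ 2 ≤ (‖z‖ ^ 2 + d ^ 2) ^ 2 := by nlinarith [sq_nonneg ‖z‖, sq_nonneg d]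
  calc d ^ 2 * (2 * (‖z‖ * ‖v‖)) = 2 * ‖v‖ * ‖z‖⁻¹ * (d ^ 2 * ‖z‖ ^ 2) := by field_simp
    _ ≤ _ := by gcongr

/-- A bounded function, differentiable with bounded derivative off the origin, is weakly
differentiable: the origin is removable. -/
theorem weak_deriv_of_punctured {v : ℂ} {W g : ℂ → ℂ} {C : ℝ}
    (hW : ∀ z ∈ puncturedDisc, HasLineDerivAt ℝ W (g z) z v)
    (hWC : ∀ z ∈ puncturedDisc, ‖W z‖ ≤ C) (hgC : ∀ z ∈ puncturedDisc, ‖g z‖ ≤ C)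
    (mW : AEStronglyMeasurable W discMeasure) (mg : AEStronglyMeasurable g discMeasure)
    {φ : ℂ → ℝ} (hφ : ContDiff ℝ ∞ φ) (hc : HasCompactSupport φ) (hs : tsupport φ ⊆ disc) :
    ∫ z in disc, ((fderiv ℝ φ z v : ℝ) : ℂ) * W z = - ∫ z in disc, ((φ z : ℝ) : ℂ) * g z := by
  have c2 : Continuous fun z => ((fderiv ℝ φ z v : ℝ) : ℂ) :=
    Complex.continuous_ofReal.comp (fderiv_apply_continuous hφ v)
  have c4 : Continuous fun z => ((φ z : ℝ) : ℂ) := Complex.continuous_ofReal.comp hφ.continuous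
  obtain ⟨A, hA⟩ := hφ.continuous.bounded_above_of_compact_support hc
  obtain ⟨B, hB⟩ := (fderiv_apply_continuous hφ v).bounded_above_of_compact_support
    (hc.fderiv_apply ℝ v)
  have hA0 : 0 ≤ A := (norm_nonneg _).trans (hA 0)
  have hB0 : 0 ≤ B := (norm_nonneg _).trans (hB 0)
  have hp : (1 / 2 : ℂ) ∈ puncturedDisc := by
    constructor
    · simp [disc]; norm_num
    · simp
  have hC0 : 0 ≤ C := (norm_nonneg _).trans (hWC _ hp)
  let d : ℕ → ℝ := fun k => 1 / ((k : ℝ) + 1)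
  have hd : ∀ k, 0 < d k := fun k => by positivity
  have hdlim : Filter.Tendsto d Filter.atTop (nhds 0) := tendsto_one_div_add_atTop_nhds_zero_nat
  -- The cutoff vanishes quadratically at the origin and tends to one elsewhere. Integration by
  -- parts is performed for `κW`, and then `k → ∞` by dominated convergence.
  let κ : ℕ → ℂ → ℝ := fun k z => ‖z‖ ^ 2 / (‖z‖ ^ 2 + d k ^ 2)
  let κ' : ℕ → ℂ → ℝ := fun k z => d k ^ 2 * (2 * inner ℝ z v) / (‖z‖ ^ 2 + d k ^ 2) ^ 2
  have hκc : ∀ k, Continuous (κ k) := fun k => by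
    have := hd k
    exact (by fun_prop : Continuous fun z : ℂ => ‖z‖ ^ 2).div (by fun_prop)
      (fun z => by positivity)
  have hκ'c : ∀ k, Continuous (κ' k) := fun k => by
    have := hd k
    exact (by fun_prop : Continuous fun z : ℂ => d k ^ 2 * (2 * inner ℝ z v)).div (by fun_prop)
      (fun z => by positivity)
  have hκ1 : ∀ k z, |κ k z| ≤ 1 := fun k z => by
    have := hd k
    rw [abs_of_nonneg (by positivity), div_le_one (by positivity)]
    nlinarith
  let H : ℕ → ℂ → ℂ := fun k z => (κ k z : ℂ) * W z
  let H' : ℕ → ℂ → ℂ := fun k z => (κ' k z : ℂ) * W z + (κ k z : ℂ) * g z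
  have mH : ∀ k, AEStronglyMeasurable (H k) discMeasure := fun k =>
    (Complex.continuous_ofReal.comp (hκc k)).aestronglyMeasurable.mul mW
  have mH' : ∀ k, AEStronglyMeasurable (H' k) discMeasure := fun k =>
    ((Complex.continuous_ofReal.comp (hκ'c k)).aestronglyMeasurable.mul mW).add
      ((Complex.continuous_ofReal.comp (hκc k)).aestronglyMeasurable.mul mg)
  have hH : ∀ k, ∀ z ∈ disc, ‖H k z‖ ≤ C := by
    intro k z hz
    by_cases h0 : z = 0
    · simp [H, κ, h0, hC0]
    · have h1 := hWC z ⟨hz, h0⟩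
      simp only [H, norm_mul, Complex.norm_real, Real.norm_eq_abs]
      calc |κ k z| * ‖W z‖ ≤ 1 * C := by gcongr; exact hκ1 k z
        _ = C := one_mul C
  have hH' : ∀ k, ∀ z ∈ puncturedDisc, ‖H' k z‖ ≤ 2 * ‖v‖ * ‖z‖⁻¹ * C + 1 * C := by
    intro k z hz
    simp only [H']
    refine (norm_add_le _ _).trans ?_
    rw [norm_mul, norm_mul, Complex.norm_real, Complex.norm_real, Real.norm_eq_abs,
      Real.norm_eq_abs]
    have h1 := hWC z hz
    have h2 := hgC z hz
    have h3 := hκ1 k z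
    have h4 : |κ' k z| ≤ 2 * ‖v‖ * ‖z‖⁻¹ := abs_cutoff_deriv_le (hd k) hz.2 v
    gcongr
  have hline : ∀ k, ∀ z ∈ disc, HasLineDerivAt ℝ (H k) (if z = 0 then 0 else H' k z) z v := by
    intro k z hz
    by_cases h0 : z = 0
    · subst h0
      -- Since `W` is bounded, `κW = O(|z|²)`: the product is differentiable at the origin with
      -- derivative zero, whatever `W` does there. This is why the candidate derivative is
      -- overwritten by zero at `z = 0`.
      have hO : (H k) =O[nhds 0] fun z => ‖z - 0‖ ^ 2 := by
        refine Asymptotics.IsBigO.of_bound (C / d k ^ 2) ?_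
        filter_upwards [Metric.isOpen_ball.mem_nhds hz] with y hy
        by_cases hy0 : y = 0
        · simp [H, κ, hy0]
        · have h1 := hWC y ⟨hy, hy0⟩
          have h2 := hd k
          simp only [H, norm_mul, Complex.norm_real, Real.norm_eq_abs, sub_zero, norm_pow,
            abs_norm]
          have h3 : |κ k y| ≤ ‖y‖ ^ 2 / d k ^ 2 := by
            rw [abs_of_nonneg (by positivity)]
            simp only [κ]
            gcongr
            nlinarith [sq_nonneg ‖y‖]
          calc |κ k y| * ‖W y‖ ≤ ‖y‖ ^ 2 / d k ^ 2 * C := by gcongr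
            _ = _ := by ring
      have h5 := (hO.hasFDerivAt (𝕜 := ℝ) (by norm_num)).hasLineDerivAt v
      simpa using h5
    · simp only [h0, if_false]
      have h1 := hW z ⟨hz, h0⟩
      have h2 : HasLineDerivAt ℝ (κ k) (κ' k z) z v := hasLineDerivAt_cutoff (hd k) z v
      unfold HasLineDerivAt at h1 h2 ⊢
      exact ((h2.ofReal_comp).mul h1).congr_deriv (by simp [H'])
  have e0 : ∀ᵐ z : ℂ, z ≠ 0 := by simp [ae_iff]
  have e0' : ∀ᵐ z ∂discMeasure, z ≠ 0 := ae_mem_puncturedDisc.mono fun z hz => hz.2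
  have hφ0 : ∀ z, z ∉ disc → φ z = 0 := fun z hz =>
    image_eq_zero_of_notMem_tsupport fun h => hz (hs h)
  have hφ0' : ∀ z, z ∉ disc → fderiv ℝ φ z v = 0 := fun z hz => by
    have : z ∉ tsupport (fderiv ℝ φ) := fun h => hz (hs (tsupport_fderiv_subset ℝ h))
    rw [image_eq_zero_of_notMem_tsupport this]; rfl
  have supp : ∀ {a b : ℂ → ℂ}, (∀ z, z ∉ disc → a z = 0) →
      Function.support (fun z => a z * b z) ⊆ disc := by
    intro a b h z hz
    by_contra hd
    exact hz (by simp [h z hd])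
  have i1 : ∀ k, Integrable (fun z => ((fderiv ℝ φ z v : ℝ) : ℂ) * H k z) discMeasure := by
    intro k
    refine Integrable.of_bound (c2.aestronglyMeasurable.mul (mH k)) (B * C) ?_
    filter_upwards [ae_restrict_mem measurableSet_ball] with z hz
    rw [norm_mul, Complex.norm_real]
    have := hB z
    have := hH k z hz
    gcongr
  have bnd : Integrable (fun z : ℂ => A * (2 * ‖v‖ * ‖z‖⁻¹ * C + 1 * C)) discMeasure :=
    ((((integrable_inv_norm.const_mul _).mul_const C).add (integrable_const _)).const_mul A)
  have bnd' : ∀ k, ∀ᵐ z ∂discMeasure, ‖((φ z : ℝ) : ℂ) * H' k z‖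
      ≤ A * (2 * ‖v‖ * ‖z‖⁻¹ * C + 1 * C) := by
    intro k
    filter_upwards [ae_mem_puncturedDisc] with z hz
    rw [norm_mul, Complex.norm_real]
    have := hA z
    have := hH' k z hz
    gcongr
  have i2 : ∀ k, Integrable (fun z => ((φ z : ℝ) : ℂ) * H' k z) discMeasure := fun k =>
    bnd.mono' (c4.aestronglyMeasurable.mul (mH' k)) (bnd' k)
  have i3 : ∀ k, Integrable (fun z => ((φ z : ℝ) : ℂ) * H k z) discMeasure := by
    intro k
    refine Integrable.of_bound (c4.aestronglyMeasurable.mul (mH k)) (A * C) ?_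
    filter_upwards [ae_restrict_mem measurableSet_ball] with z hz
    rw [norm_mul, Complex.norm_real]
    have := hA z
    have := hH k z hz
    gcongr
  have hφ0C : ∀ z, z ∉ disc → ((φ z : ℝ) : ℂ) = 0 := fun z hz => by simp [hφ0 z hz]
  have hφ0C' : ∀ z, z ∉ disc → ((fderiv ℝ φ z v : ℝ) : ℂ) = 0 := fun z hz => by
    simp [hφ0' z hz]
  have ibp : ∀ k, ∫ z in disc, ((φ z : ℝ) : ℂ) * H' k z
      = - ∫ z in disc, ((fderiv ℝ φ z v : ℝ) : ℂ) * H k z := by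
    intro k
    have j2 : Integrable (fun z => ((φ z : ℝ) : ℂ) * (if z = 0 then 0 else H' k z)) volume := by
      refine (integrableOn_iff_integrable_of_support_subset (supp hφ0C)).1 ((i2 k).congr ?_)
      filter_upwards [e0'] with z hz
      simp [hz]
    have h := integral_bilinear_hasLineDerivAt_right_eq_neg_left_of_integrable
      (μ := (volume : Measure ℂ)) (v := v) (B := ContinuousLinearMap.mul ℝ ℂ)
      (f := fun z => ((φ z : ℝ) : ℂ)) (f' := fun z => ((fderiv ℝ φ z v : ℝ) : ℂ))
      (g := H k) (g' := fun z => if z = 0 then 0 else H' k z)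
      ((integrableOn_iff_integrable_of_support_subset (supp hφ0C')).1 (i1 k)) j2
      ((integrableOn_iff_integrable_of_support_subset (supp hφ0C)).1 (i3 k))
      (fun z _ => by
        have := ((hφ.differentiable (by simp) z).hasFDerivAt.hasLineDerivAt v)
        unfold HasLineDerivAt at this ⊢
        exact this.ofReal_comp)
      (fun z hz => hline k z (hs (closure_mono (fun y hy => by
        simpa using hy) hz)))
    simp only [ContinuousLinearMap.mul_apply'] at h
    have r1 : ∫ z in disc, ((φ z : ℝ) : ℂ) * (if z = 0 then 0 else H' k z)
        = ∫ z : ℂ, ((φ z : ℝ) : ℂ) * (if z = 0 then 0 else H' k z) :=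
      setIntegral_eq_integral_of_forall_compl_eq_zero fun z hz => by rw [hφ0C z hz, zero_mul]
    have r2 : ∫ z in disc, ((fderiv ℝ φ z v : ℝ) : ℂ) * H k z
        = ∫ z : ℂ, ((fderiv ℝ φ z v : ℝ) : ℂ) * H k z :=
      setIntegral_eq_integral_of_forall_compl_eq_zero fun z hz => by rw [hφ0C' z hz, zero_mul]
    rw [r2, ← h, ← r1]
    apply integral_congr_ae
    filter_upwards [e0'] with z hz
    simp [hz]
  have hκlim : ∀ z : ℂ, z ≠ 0 → Filter.Tendsto (fun k => κ k z) Filter.atTop (nhds 1) := by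
    intro z hz
    have hz' : 0 < ‖z‖ := norm_pos_iff.2 hz
    have h1 := (tendsto_const_nhds (x := ‖z‖ ^ 2)).div
      ((tendsto_const_nhds (x := ‖z‖ ^ 2)).add (hdlim.pow 2)) (by simp [hz])
    rw [zero_pow two_ne_zero, add_zero, div_self (pow_ne_zero 2 hz'.ne')] at h1
    exact h1
  have hκ'lim : ∀ z : ℂ, z ≠ 0 → Filter.Tendsto (fun k => κ' k z) Filter.atTop (nhds 0) := by
    intro z hz
    have hz' : 0 < ‖z‖ := norm_pos_iff.2 hz
    have h1 := ((hdlim.pow 2).mul_const (2 * inner ℝ z v)).div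
      (((tendsto_const_nhds (x := ‖z‖ ^ 2)).add (hdlim.pow 2)).pow 2) (by simp [hz])
    rw [zero_pow two_ne_zero, zero_mul, zero_div] at h1
    exact h1
  have l1 : Filter.Tendsto (fun k => ∫ z in disc, ((φ z : ℝ) : ℂ) * H' k z) Filter.atTop
      (nhds (∫ z in disc, ((φ z : ℝ) : ℂ) * g z)) := by
    refine tendsto_integral_of_dominated_convergence _ (fun k => (i2 k).aestronglyMeasurable)
      bnd bnd' ?_
    filter_upwards [e0'] with z hz
    have h1 := (Complex.continuous_ofReal.tendsto _).comp (hκlim z hz)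
    have h2 := (Complex.continuous_ofReal.tendsto _).comp (hκ'lim z hz)
    have h3 := ((h2.mul_const (W z)).add (h1.mul_const (g z))).const_mul ((φ z : ℝ) : ℂ)
    simpa [H'] using h3
  have l2 : Filter.Tendsto (fun k => ∫ z in disc, ((fderiv ℝ φ z v : ℝ) : ℂ) * H k z) Filter.atTop
      (nhds (∫ z in disc, ((fderiv ℝ φ z v : ℝ) : ℂ) * W z)) := by
    refine tendsto_integral_of_dominated_convergence (fun _ => B * C)
      (fun k => (i1 k).aestronglyMeasurable) (integrable_const _) (fun k => ?_) ?_
    · filter_upwards [ae_restrict_mem measurableSet_ball] with z hz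
      rw [norm_mul, Complex.norm_real]
      have := hB z
      have := hH k z hz
      gcongr
    · filter_upwards [e0'] with z hz
      have h1 := (Complex.continuous_ofReal.tendsto _).comp (hκlim z hz)
      have h3 := (h1.mul_const (W z)).const_mul ((fderiv ℝ φ z v : ℝ) : ℂ)
      simpa [H] using h3
  simp only [ibp] at l1
  have := tendsto_nhds_unique l1 l2.neg
  rw [this, neg_neg]

/-! ### Functions `η(r) e^{ikθ}` as elements of `H¹`, and polar coordinates -/

/-- The function `η(r) e^{ikθ}`. -/
def mode (k : ℤ) (η : ℝ → ℂ) (z : ℂ) : ℂ := η ‖z‖ * (z / ‖z‖) ^ k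

/-- The directional derivative of `η(r) e^{ikθ}` in the direction `v`, where `η'` is the derivative
of `η`. -/
def modeDeriv (k : ℤ) (η η' : ℝ → ℂ) (v z : ℂ) : ℂ :=
  (η' ‖z‖ * ((inner ℝ z v / ‖z‖ : ℝ) : ℂ)
    + k * Complex.I * η ‖z‖ * ((inner ℝ (Complex.I * z) v / ‖z‖ ^ 2 : ℝ) : ℂ)) * (z / ‖z‖) ^ k

theorem hasLineDerivAt_norm {z : ℂ} (hz : z ≠ 0) (v : ℂ) :
    HasLineDerivAt ℝ (fun z : ℂ => ‖z‖) (inner ℝ z v / ‖z‖) z v := by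
  unfold HasLineDerivAt
  have h1 : HasDerivAt (fun t : ℝ => z + t • v) v 0 := by
    simpa using ((hasDerivAt_id (0 : ℝ)).smul_const v).const_add z
  have h2 := h1.norm_sq.sqrt (by simp [hz])
  have e : (fun t : ℝ => √(‖z + t • v‖ ^ 2)) = fun t : ℝ => ‖z + t • v‖ := by
    ext t; rw [Real.sqrt_sq (norm_nonneg _)]
  rw [e] at h2
  refine h2.congr_deriv ?_
  simp only [zero_smul, add_zero, Real.sqrt_sq (norm_nonneg z)]
  rw [mul_div_mul_left _ _ two_ne_zero]

theorem hasLineDerivAt_direction {z : ℂ} (hz : z ≠ 0) (v : ℂ) (k : ℤ) :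
    HasLineDerivAt ℝ (fun z : ℂ => (z / ‖z‖) ^ k)
      (k * Complex.I * ((inner ℝ (Complex.I * z) v / ‖z‖ ^ 2 : ℝ) : ℂ) * (z / ‖z‖) ^ k) z v := by
  have hn : (‖z‖ : ℂ) ≠ 0 := by simpa using hz
  have h1 : HasDerivAt (fun t : ℝ => z + t • v) v 0 := by
    simpa using ((hasDerivAt_id (0 : ℝ)).smul_const v).const_add z
  have h2 := hasLineDerivAt_norm hz v
  unfold HasLineDerivAt at h2 ⊢
  have h3 := h1.div h2.ofReal_comp (by simpa using hz)
  have hz0 : z / (‖z‖ : ℂ) ≠ 0 := div_ne_zero hz hn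
  have h4 := (hasDerivAt_zpow k (z / (‖z‖ : ℂ)) (Or.inl hz0))
  have h5 := HasDerivAt.comp_of_eq (0 : ℝ) h4 h3 (by simp)
  refine h5.congr_deriv ?_
  simp only [zero_smul, add_zero]
  rw [zpow_sub_one₀ hz0]
  -- Decomposition of `v` in the orthogonal frame `z`, `iz`: only the tangential component rotates
  -- the direction `z/|z|`.
  have key : v * (‖z‖ : ℂ) ^ 2 - z * ((inner ℝ z v : ℝ) : ℂ)
      = Complex.I * ((inner ℝ (Complex.I * z) v : ℝ) : ℂ) * z := by
    rw [← Complex.ofReal_pow, Complex.sq_norm, Complex.normSq_apply]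
    apply Complex.ext <;> simp [Complex.inner] <;> ring_nf
  have key2 : v * (‖z‖ : ℂ) ^ 2
      = z * ((inner ℝ z v : ℝ) : ℂ) + Complex.I * ((inner ℝ (Complex.I * z) v : ℝ) : ℂ) * z := by
    linear_combination key
  push_cast
  field_simp
  rw [show (‖z‖ : ℂ) ^ 2 * v = v * (‖z‖ : ℂ) ^ 2 by ring, key2]
  ring_nf

theorem hasLineDerivAt_mode {k : ℤ} {η η' : ℝ → ℂ} {z : ℂ} (hz : z ≠ 0)
    (h : HasDerivAt η (η' ‖z‖) ‖z‖) (v : ℂ) :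
    HasLineDerivAt ℝ (mode k η) (modeDeriv k η η' v z) z v := by
  have h1 := hasLineDerivAt_norm hz v
  have h2 := hasLineDerivAt_direction hz v k
  unfold HasLineDerivAt at h1 h2 ⊢
  have h3 := HasDerivAt.scomp_of_eq (0 : ℝ) h h1 (by simp)
  refine (h3.mul h2).congr_deriv ?_
  simp [modeDeriv]
  ring

theorem norm_direction_zpow {z : ℂ} (hz : z ≠ 0) (k : ℤ) : ‖(z / ‖z‖) ^ k‖ = 1 := by
  rw [norm_zpow, norm_div, Complex.norm_real, norm_norm, div_self (norm_ne_zero_iff.2 hz), one_zpow]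

theorem norm_mode {z : ℂ} (hz : z ≠ 0) (k : ℤ) (η : ℝ → ℂ) : ‖mode k η z‖ = ‖η ‖z‖‖ := by
  rw [mode, norm_mul, norm_direction_zpow hz, mul_one]

theorem continuousOn_mode {k : ℤ} {η : ℝ → ℂ} (h : ContinuousOn η (Set.Ioo 0 1)) :
    ContinuousOn (mode k η) puncturedDisc := by
  refine ContinuousOn.mul (h.comp continuous_norm.continuousOn fun z hz => ?_) ?_
  · exact ⟨norm_pos_iff.2 hz.2, by simpa [disc] using hz.1⟩
  · refine ContinuousOn.zpow₀ ?_ k fun z hz => Or.inl ?_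
    · exact continuousOn_id.div (by fun_prop) fun z hz => by simpa using hz.2
    · have : z ≠ 0 := hz.2
      simp [this]

theorem continuousOn_modeDeriv {k : ℤ} {η η' : ℝ → ℂ} (h : ContinuousOn η (Set.Ioo 0 1))
    (h' : ContinuousOn η' (Set.Ioo 0 1)) (v : ℂ) :
    ContinuousOn (modeDeriv k η η' v) puncturedDisc := by
  have maps : Set.MapsTo (fun z : ℂ => ‖z‖) puncturedDisc (Set.Ioo 0 1) := fun z hz =>
    ⟨norm_pos_iff.2 hz.2, by simpa [disc] using hz.1⟩
  have hne : ∀ z ∈ puncturedDisc, ‖z‖ ≠ 0 := fun z hz => (maps hz).1.ne'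
  have c1 := h.comp continuous_norm.continuousOn maps
  have c2 := h'.comp continuous_norm.continuousOn maps
  have c3 := continuousOn_mode (k := k) (η := fun _ => 1) continuousOn_const
  have c4 : ContinuousOn (fun z : ℂ => (inner ℝ z v / ‖z‖ : ℝ)) puncturedDisc :=
    ContinuousOn.div (by fun_prop) (by fun_prop) hne
  have c5 : ContinuousOn (fun z : ℂ => (inner ℝ (Complex.I * z) v / ‖z‖ ^ 2 : ℝ)) puncturedDisc :=
    ContinuousOn.div (by fun_prop) (by fun_prop) fun z hz => pow_ne_zero 2 (hne z hz)
  have := (((c2.mul (Complex.continuous_ofReal.comp_continuousOn c4)).add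
    ((c1.const_smul (k * Complex.I)).mul (Complex.continuous_ofReal.comp_continuousOn c5))).mul c3)
  refine this.congr fun z _ => ?_
  simp [modeDeriv, mode, mul_assoc]

/-- The angular part of the gradient has size `|k| |η| / r`. The hypothesis `|k| |η| ≤ C r` bounds
it, and costs nothing when `k = 0`; this matters for the mode `n - 2` when `n = 2`. -/
theorem norm_modeDeriv_le {k : ℤ} {η η' : ℝ → ℂ} {C : ℝ} {z v : ℂ} (hz : z ≠ 0) (hv : ‖v‖ = 1)
    (h' : ‖η' ‖z‖‖ ≤ C) (hk : |(k : ℝ)| * ‖η ‖z‖‖ ≤ C * ‖z‖) :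
    ‖modeDeriv k η η' v z‖ ≤ 2 * C := by
  have hz' : 0 < ‖z‖ := norm_pos_iff.2 hz
  have i1 : |inner ℝ z v| ≤ ‖z‖ := by simpa [hv] using abs_real_inner_le_norm z v
  have i2 : |inner ℝ (Complex.I * z) v| ≤ ‖z‖ := by
    simpa [hv] using abs_real_inner_le_norm (Complex.I * z) v
  rw [modeDeriv, norm_mul, norm_direction_zpow hz, mul_one]
  refine (norm_add_le _ _).trans ?_
  rw [norm_mul, norm_mul, norm_mul, norm_mul, Complex.norm_I, mul_one, Complex.norm_real,
    Complex.norm_real, Complex.norm_intCast, Real.norm_eq_abs, Real.norm_eq_abs, abs_div, abs_div,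
    abs_of_pos hz', abs_of_pos (pow_pos hz' 2)]
  have j1 : |inner ℝ z v| / ‖z‖ ≤ 1 := (div_le_one hz').2 i1
  have hC : 0 ≤ C := (norm_nonneg _).trans h'
  have e1 : ‖η' ‖z‖‖ * (|inner ℝ z v| / ‖z‖) ≤ C * 1 := by gcongr
  have e2 : |(k : ℝ)| * ‖η ‖z‖‖ * (|inner ℝ (Complex.I * z) v| / ‖z‖ ^ 2)
      ≤ C * ‖z‖ * (‖z‖ / ‖z‖ ^ 2) := by gcongr
  have e3 : C * ‖z‖ * (‖z‖ / ‖z‖ ^ 2) = C := by field_simp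
  linarith

/-- `Φ` is the triple of `η(r) e^{ikθ}`, where `η'` is the derivative of `η`. -/
def IsMode (k : ℤ) (η η' : ℝ → ℂ) (Φ : Triple) : Prop :=
  (∀ᵐ z ∂discMeasure, Φ.1 z = mode k η z) ∧
  (∀ᵐ z ∂discMeasure, Φ.2.1 z = modeDeriv k η η' 1 z) ∧
  (∀ᵐ z ∂discMeasure, Φ.2.2 z = modeDeriv k η η' Complex.I z)

theorem exists_isMode (k : ℤ) {η η' : ℝ → ℂ} {C : ℝ}
    (h : ∀ r ∈ Set.Ioo (0 : ℝ) 1, HasDerivAt η (η' r) r) (h' : ContinuousOn η' (Set.Ioo 0 1))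
    (hη : ∀ r ∈ Set.Ioo (0 : ℝ) 1, ‖η r‖ ≤ C) (hη' : ∀ r ∈ Set.Ioo (0 : ℝ) 1, ‖η' r‖ ≤ C)
    (hk : ∀ r ∈ Set.Ioo (0 : ℝ) 1, |(k : ℝ)| * ‖η r‖ ≤ C * r) :
    ∃ Φ ∈ H1Disc, IsMode k η η' Φ ∧ EssBounded Φ.1 := by
  have hc : ContinuousOn η (Set.Ioo 0 1) := fun r hr => (h r hr).continuousAt.continuousWithinAt
  have maps : ∀ z ∈ puncturedDisc, ‖z‖ ∈ Set.Ioo (0 : ℝ) 1 := fun z hz =>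
    ⟨norm_pos_iff.2 hz.2, by simpa [disc] using hz.1⟩
  have m0 := aestronglyMeasurable_of_continuousOn (continuousOn_mode (k := k) hc)
  have m1 := fun v => aestronglyMeasurable_of_continuousOn (continuousOn_modeDeriv (k := k) hc h' v)
  have b0 : ∀ z ∈ puncturedDisc, ‖mode k η z‖ ≤ C := fun z hz => by
    rw [norm_mode hz.2]; exact hη _ (maps z hz)
  have b1 : ∀ v, ‖v‖ = 1 → ∀ z ∈ puncturedDisc, ‖modeDeriv k η η' v z‖ ≤ 2 * C :=
    fun v hv z hz => norm_modeDeriv_le hz.2 hv (hη' _ (maps z hz)) (hk _ (maps z hz))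
  have hC : 0 ≤ C := (norm_nonneg _).trans (hη (1 / 2) (by norm_num))
  have L0 : MemLp (mode k η) 2 discMeasure := MemLp.of_bound m0 C (ae_mem_puncturedDisc.mono b0)
  have L1 : ∀ v, ‖v‖ = 1 → MemLp (modeDeriv k η η' v) 2 discMeasure := fun v hv =>
    MemLp.of_bound (m1 v) (2 * C) (ae_mem_puncturedDisc.mono (b1 v hv))
  have wd : ∀ v (hv : ‖v‖ = 1), IsWeakDeriv v (L0.toLp _) ((L1 v hv).toLp _) := by
    intro v hv φ hφ hcs hs
    have := weak_deriv_of_punctured (v := v) (W := mode k η) (g := modeDeriv k η η' v) (C := 2 * C)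
      (fun z hz => hasLineDerivAt_mode hz.2 (h _ (maps z hz)) v)
      (fun z hz => (b0 z hz).trans (by linarith)) (b1 v hv) m0 (m1 v) hφ hcs hs
    have e1 : ∫ z in disc, ((fderiv ℝ φ z v : ℝ) : ℂ) * L0.toLp _ z
        = ∫ z in disc, ((fderiv ℝ φ z v : ℝ) : ℂ) * mode k η z :=
      integral_congr_ae (by filter_upwards [L0.coeFn_toLp] with z hz; rw [hz])
    have e2 : ∫ z in disc, ((φ z : ℝ) : ℂ) * (L1 v hv).toLp _ z
        = ∫ z in disc, ((φ z : ℝ) : ℂ) * modeDeriv k η η' v z :=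
      integral_congr_ae (by filter_upwards [(L1 v hv).coeFn_toLp] with z hz; rw [hz])
    rw [e1, e2, this]
  refine ⟨(L0.toLp _, (L1 1 (by simp)).toLp _, (L1 Complex.I (by simp)).toLp _),
    ⟨wd 1 (by simp), wd Complex.I (by simp)⟩, ⟨L0.coeFn_toLp, (L1 1 norm_one).coeFn_toLp,
      (L1 Complex.I Complex.norm_I).coeFn_toLp⟩, C, ?_⟩
  filter_upwards [L0.coeFn_toLp, ae_mem_puncturedDisc] with z hz hp
  rw [hz]
  exact b0 z hp

theorem IsMode.angularMomentum_eq {k : ℤ} {η η' : ℝ → ℂ} {Φ : Triple} (h : IsMode k η η' Φ) :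
    ∀ᵐ z ∂discMeasure, angularMomentum Φ z = k * mode k η z := by
  filter_upwards [h.2.1, h.2.2, ae_mem_puncturedDisc] with z h1 h2 hz
  have hn : (‖z‖ : ℂ) ≠ 0 := by simpa using hz.2
  have hq : (‖z‖ : ℂ) ^ 2 = z.re ^ 2 + z.im ^ 2 := by
    rw [← Complex.ofReal_pow, Complex.sq_norm, Complex.normSq_apply]; push_cast; ring
  rw [angularMomentum, h1, h2]
  simp only [modeDeriv, mode, Complex.inner]
  simp only [Complex.mul_re, Complex.mul_im, Complex.conj_re, Complex.conj_im, Complex.one_re,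
    Complex.one_im, Complex.I_re, Complex.I_im]
  push_cast
  generalize (z / (‖z‖ : ℂ)) ^ k = e
  field_simp
  ring_nf
  simp only [Complex.I_sq]
  rw [hq]
  ring

/-- The radial derivative of a triple. -/
def radialDeriv (Φ : Triple) (z : ℂ) : ℂ :=
  ((z.re : ℂ) * Φ.2.1 z + (z.im : ℂ) * Φ.2.2 z) / ‖z‖

theorem IsMode.radialDeriv_eq {k : ℤ} {η η' : ℝ → ℂ} {Φ : Triple} (h : IsMode k η η' Φ) :
    ∀ᵐ z ∂discMeasure, radialDeriv Φ z = mode k η' z := by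
  filter_upwards [h.2.1, h.2.2, ae_mem_puncturedDisc] with z h1 h2 hz
  have hn : (‖z‖ : ℂ) ≠ 0 := by simpa using hz.2
  have hq : (‖z‖ : ℂ) ^ 2 = z.re ^ 2 + z.im ^ 2 := by
    rw [← Complex.ofReal_pow, Complex.sq_norm, Complex.normSq_apply]; push_cast; ring
  rw [radialDeriv, h1, h2]
  simp only [modeDeriv, mode, Complex.inner]
  simp only [Complex.mul_re, Complex.mul_im, Complex.conj_re, Complex.conj_im, Complex.one_re,
    Complex.one_im, Complex.I_re, Complex.I_im]
  push_cast
  generalize (z / (‖z‖ : ℂ)) ^ k = e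
  field_simp
  ring_nf
  linear_combination (-(e * η' ‖z‖ * ‖z‖)) * hq

/-- The gradient splits orthogonally into the radial derivative and the angular derivative divided
by `r`. -/
theorem crossDensity_eq_polar (Ω : ℝ) (Φ W : Triple) {z : ℂ} (hz : z ≠ 0) :
    crossDensity Ω Φ W z = (conj (radialDeriv Φ z) * radialDeriv W z).re
      + (conj (angularMomentum Φ z) * angularMomentum W z).re / ‖z‖ ^ 2
      - Ω / 2 * (conj (Φ.1 z) * angularMomentum W z + conj (W.1 z) * angularMomentum Φ z).re := by
  have hn : (‖z‖ : ℝ) ≠ 0 := by simpa using hz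
  have hq : ‖z‖ ^ 2 = z.re ^ 2 + z.im ^ 2 := by
    rw [Complex.sq_norm, Complex.normSq_apply]; ring
  unfold crossDensity
  congr 1
  have e1 : (conj (radialDeriv Φ z) * radialDeriv W z).re
      = (conj ((z.re : ℂ) * Φ.2.1 z + (z.im : ℂ) * Φ.2.2 z)
        * ((z.re : ℂ) * W.2.1 z + (z.im : ℂ) * W.2.2 z)).re / ‖z‖ ^ 2 := by
    rw [← Complex.div_ofReal_re, radialDeriv, radialDeriv, map_div₀, Complex.conj_ofReal]
    congr 1
    push_cast
    rw [div_mul_div_comm, pow_two]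
  rw [e1, ← add_div, eq_div_iff (pow_ne_zero 2 hn), hq]
  simp only [angularMomentum, map_add, map_sub, map_mul, Complex.conj_ofReal, Complex.add_re,
    Complex.mul_re, Complex.sub_re, Complex.sub_im, Complex.neg_re, Complex.neg_im, map_neg,
    Complex.add_im, Complex.mul_im, Complex.conj_re, Complex.conj_im, Complex.ofReal_re,
    Complex.ofReal_im, Complex.I_re, Complex.I_im]
  ring

/-! ### From angular momentum to covariance under rotations -/

/-- Complex-valued test functions on the disc. -/
structure IsTest (φ : ℂ → ℂ) : Prop where
  smooth : ContDiff ℝ ∞ φ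
  compact : HasCompactSupport φ
  support : tsupport φ ⊆ disc

theorem IsTest.integrable {φ : ℂ → ℂ} (h : IsTest φ) {u : ℂ → ℂ} (hu : Integrable u discMeasure) :
    Integrable (fun z => φ z * u z) discMeasure :=
  test_mul_integrable φ h.smooth.continuous h.compact hu

theorem IsTest.mul_left {φ c : ℂ → ℂ} (h : IsTest φ) (hc : ContDiff ℝ ∞ c) :
    IsTest fun z => c z * φ z :=
  ⟨hc.mul h.smooth, h.compact.mul_left, (tsupport_mul_subset_right).trans h.support⟩

theorem IsTest.fderiv_apply {φ : ℂ → ℂ} (h : IsTest φ) {V : ℂ → ℂ} (hV : ContDiff ℝ ∞ V) :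
    IsTest fun z => fderiv ℝ φ z (V z) := by
  have hs : Function.support (fun z => fderiv ℝ φ z (V z)) ⊆ tsupport φ := fun z hz => by
    refine support_fderiv_subset ℝ ?_
    intro h0
    exact hz (by simp [h0])
  refine ⟨(h.smooth.fderiv_right (m := ∞) (by simp)).clm_apply hV, ?_, ?_⟩
  · exact HasCompactSupport.of_support_subset_isCompact h.compact hs
  · exact (closure_minimal hs (isClosed_tsupport φ)).trans h.support

theorem IsTest.add {φ ψ : ℂ → ℂ} (h : IsTest φ) (h' : IsTest ψ) : IsTest fun z => φ z + ψ z :=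
  ⟨h.smooth.add h'.smooth, h.compact.add h'.compact,
    (tsupport_add φ ψ).trans (Set.union_subset h.support h'.support)⟩

theorem IsTest.weakDeriv {v : ℂ} {u g : L2Disc} (hw : IsWeakDeriv v u g) {φ : ℂ → ℂ}
    (h : IsTest φ) :
    ∫ z in disc, fderiv ℝ φ z v * u z = - ∫ z in disc, φ z * g z := by
  have key : ∀ (ℓ : ℂ →L[ℝ] ℝ), ∫ z in disc, ((ℓ (fderiv ℝ φ z v) : ℝ) : ℂ) * u z
      = - ∫ z in disc, ((ℓ (φ z) : ℝ) : ℂ) * g z := by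
    intro ℓ
    have h1 := hw (fun z => ℓ (φ z)) (ℓ.contDiff.comp h.smooth)
      (h.compact.comp_left (g := ℓ) (map_zero ℓ))
      ((tsupport_comp_subset (g := ℓ) (map_zero ℓ) φ).trans h.support)
    have h2 : ∀ z, fderiv ℝ (fun z => ℓ (φ z)) z v = ℓ (fderiv ℝ φ z v) := fun z => by
      have := (ℓ.hasFDerivAt.comp z (h.smooth.differentiable (by simp) z).hasFDerivAt).fderiv
      rw [show (fun z => ℓ (φ z)) = ℓ ∘ φ from rfl, this]
      rfl
    simpa only [h2] using h1
  have hd : IsTest fun z => fderiv ℝ φ z v := h.fderiv_apply contDiff_const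
  have int : ∀ {ψ : ℂ → ℂ}, IsTest ψ → ∀ u : L2Disc,
      ∫ z in disc, ψ z * u z = (∫ z in disc, ((Complex.reCLM (ψ z) : ℝ) : ℂ) * u z)
        + Complex.I * ∫ z in disc, ((Complex.imCLM (ψ z) : ℝ) : ℂ) * u z := by
    intro ψ hψ u
    have c1 : ∀ ℓ : ℂ →L[ℝ] ℝ,
        Integrable (fun z => ((ℓ (ψ z) : ℝ) : ℂ) * u z) discMeasure := fun ℓ =>
      test_mul_integrable _ (by have := hψ.smooth.continuous; fun_prop)
        (hψ.compact.comp_left (g := fun x => ((ℓ x : ℝ) : ℂ)) (by simp)) (l2_integrable u)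
    rw [← integral_const_mul, ← integral_add (c1 _) ((c1 _).const_mul _)]
    congr 1
    ext z
    conv_lhs => rw [← Complex.re_add_im (ψ z)]
    simp only [Complex.reCLM_apply, Complex.imCLM_apply]
    ring
  rw [int hd, int h, key, key]
  ring

theorem IsTest.rotate {φ : ℂ → ℂ} (h : IsTest φ) {c : ℂ} (hc : ‖c‖ = 1) :
    IsTest fun z => φ (c * z) := by
  have hc0 : c ≠ 0 := fun h0 => by simp [h0] at hc
  let e : ℂ ≃ₜ ℂ := Homeomorph.mulLeft₀ c hc0
  have h1 : tsupport (fun z => φ (c * z)) = e ⁻¹' tsupport φ := by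
    exact tsupport_comp_eq_preimage φ e
  refine ⟨h.smooth.comp (contDiff_const.mul contDiff_id), h.compact.comp_homeomorph e, ?_⟩
  rw [h1]
  intro z hz
  have := h.support hz
  simpa [disc, e, hc] using this

theorem fderiv_rotate {φ : ℂ → ℂ} (hφ : Differentiable ℝ φ) (c z v : ℂ) :
    fderiv ℝ (fun z => φ (c * z)) z v = fderiv ℝ φ (c * z) (c * v) := by
  have h1 : HasFDerivAt (fun z : ℂ => c * z) (ContinuousLinearMap.mul ℝ ℂ c) z :=
    (ContinuousLinearMap.mul ℝ ℂ c).hasFDerivAt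
  have := ((hφ (c * z)).hasFDerivAt.comp z h1).fderiv
  rw [show (fun z => φ (c * z)) = φ ∘ fun z => c * z from rfl, this]
  rfl

theorem fderiv_mul_test {φ c : ℂ → ℂ} (hφ : Differentiable ℝ φ) (hc : Differentiable ℝ c)
    (z v : ℂ) : fderiv ℝ (fun z => c z * φ z) z v = c z * fderiv ℝ φ z v + fderiv ℝ c z v * φ z := by
  have := ((hc z).hasFDerivAt.mul (hφ z).hasFDerivAt).fderiv
  rw [show (fun z => c z * φ z) = c * φ from rfl, this]
  simp [mul_comm]

theorem fderiv_re_im (z v : ℂ) : fderiv ℝ (fun z : ℂ => (z.re : ℂ)) z v = v.re ∧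
    fderiv ℝ (fun z : ℂ => (z.im : ℂ)) z v = v.im := by
  constructor
  · have := (Complex.ofRealCLM.comp Complex.reCLM).hasFDerivAt (x := z) |>.fderiv
    rw [show (fun z : ℂ => (z.re : ℂ)) = Complex.ofRealCLM.comp Complex.reCLM from rfl, this]
    rfl
  · have := (Complex.ofRealCLM.comp Complex.imCLM).hasFDerivAt (x := z) |>.fderiv
    rw [show (fun z : ℂ => (z.im : ℂ)) = Complex.ofRealCLM.comp Complex.imCLM from rfl, this]
    rfl

theorem contDiff_ofReal_re : ContDiff ℝ ∞ fun z : ℂ => (z.re : ℂ) :=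
  (Complex.ofRealCLM.comp Complex.reCLM).contDiff

theorem contDiff_ofReal_im : ContDiff ℝ ∞ fun z : ℂ => (z.im : ℂ) :=
  (Complex.ofRealCLM.comp Complex.imCLM).contDiff

theorem fderiv_decompose (φ : ℂ → ℂ) (z v : ℂ) :
    fderiv ℝ φ z v = v.re * fderiv ℝ φ z 1 + v.im * fderiv ℝ φ z Complex.I := by
  have e : v = v.re • (1 : ℂ) + v.im • Complex.I := by
    simp [Complex.re_add_im]
  conv_lhs => rw [e, map_add, map_smul, map_smul]
  simp

/-- The rotation field `iz` is divergence free, so no zeroth-order term appears. The weak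
derivatives are tested against `xφ` and `yφ`. -/
theorem test_angular {Ψ : Triple} (hΨ : Ψ ∈ H1Disc) {φ : ℂ → ℂ} (h : IsTest φ) :
    ∫ z in disc, fderiv ℝ φ z (Complex.I * z) * Ψ.1 z
      = - ∫ z in disc, φ z * (Complex.I * angularMomentum Ψ z) := by
  have hd := h.smooth.differentiable (by simp)
  have hre := contDiff_ofReal_re.differentiable (by simp)
  have him := contDiff_ofReal_im.differentiable (by simp)
  have t1 := h.mul_left contDiff_ofReal_re
  have t2 := h.mul_left contDiff_ofReal_im
  have e1 := t1.weakDeriv hΨ.2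
  have e2 := t2.weakDeriv hΨ.1
  have u := l2_integrable Ψ.1
  have i1 := (t1.fderiv_apply (V := fun _ => Complex.I) contDiff_const).integrable u
  have i2 := (t2.fderiv_apply (V := fun _ => 1) contDiff_const).integrable u
  have j1 := t1.integrable (l2_integrable Ψ.2.2)
  have j2 := t2.integrable (l2_integrable Ψ.2.1)
  have e3 := congrArg₂ (· - ·) e1 e2
  rw [← integral_sub i1 i2, ← neg_sub_neg, neg_neg, neg_neg, ← integral_sub j2 j1] at e3
  rw [← integral_neg] 
  convert e3 using 1
  · congr 1
    ext z
    rw [fderiv_mul_test hd hre, fderiv_mul_test hd him, (fderiv_re_im z _).1, (fderiv_re_im z _).2,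
      fderiv_decompose φ z (Complex.I * z)]
    simp
    ring
  · congr 1
    ext z
    simp only [angularMomentum]
    linear_combination (φ z * (z.re * Ψ.2.2 z - z.im * Ψ.2.1 z)) * Complex.I_sq

/-- The Euler derivative `r ∂_r Ψ`. -/
def eulerDeriv (Ψ : Triple) (z : ℂ) : ℂ := (z.re : ℂ) * Ψ.2.1 z + (z.im : ℂ) * Ψ.2.2 z

/-- The Euler field `z` has divergence two in the plane, which accounts for the term `2φ`. -/
theorem test_euler {Ψ : Triple} (hΨ : Ψ ∈ H1Disc) {φ : ℂ → ℂ} (h : IsTest φ) :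
    ∫ z in disc, (2 * φ z + fderiv ℝ φ z z) * Ψ.1 z
      = - ∫ z in disc, φ z * eulerDeriv Ψ z := by
  have hd := h.smooth.differentiable (by simp)
  have hre := contDiff_ofReal_re.differentiable (by simp)
  have him := contDiff_ofReal_im.differentiable (by simp)
  have t1 := h.mul_left contDiff_ofReal_re
  have t2 := h.mul_left contDiff_ofReal_im
  have e1 := t1.weakDeriv hΨ.1
  have e2 := t2.weakDeriv hΨ.2
  have u := l2_integrable Ψ.1
  have i1 := (t1.fderiv_apply (V := fun _ => 1) contDiff_const).integrable u
  have i2 := (t2.fderiv_apply (V := fun _ => Complex.I) contDiff_const).integrable u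
  have j1 := t1.integrable (l2_integrable Ψ.2.1)
  have j2 := t2.integrable (l2_integrable Ψ.2.2)
  have e3 := congrArg₂ (· + ·) e1 e2
  rw [← integral_add i1 i2, ← neg_add, ← integral_add j1 j2] at e3
  convert e3 using 1
  · congr 1
    ext z
    rw [fderiv_mul_test hd hre, fderiv_mul_test hd him, (fderiv_re_im z _).1, (fderiv_re_im z _).2,
      fderiv_decompose φ z z]
    simp
    ring
  · congr 2
    ext z
    simp only [eulerDeriv]
    ring

/-- The rotation by the angle `α`. -/
def rot (α : ℝ) : ℂ := Complex.exp (α * Complex.I)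

theorem norm_rot (α : ℝ) : ‖rot α‖ = 1 := Complex.norm_exp_ofReal_mul_I α

/-- Differentiating in `α` lets the angular derivative fall on the test function; integrating by
parts with `test_angular` gives the linear equation `J' = -inJ` for the left-hand side `J`. -/
theorem test_rotate_of_angularMomentum {n : ℕ} {Ψ : Triple} (hΨ : Ψ ∈ H1Disc)
    (hn : ∀ᵐ z ∂discMeasure, angularMomentum Ψ z = (n : ℂ) * Ψ.1 z) {φ : ℂ → ℂ} (h : IsTest φ)
    (α : ℝ) :
    ∫ z in disc, φ (rot α * z) * Ψ.1 z = rot (-(n * α)) * ∫ z in disc, φ z * Ψ.1 z := by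
  let J : ℝ → ℂ := fun α => ∫ z in disc, φ (rot α * z) * Ψ.1 z
  have hd := h.smooth.differentiable (by simp)
  have hψ : IsTest fun z => fderiv ℝ φ z (Complex.I * z) :=
    h.fderiv_apply (contDiff_const.mul contDiff_id)
  obtain ⟨C, hC⟩ := hψ.smooth.continuous.bounded_above_of_compact_support hψ.compact
  have hrot : ∀ α, HasDerivAt rot (Complex.I * rot α) α := by
    intro α
    have h1 : HasDerivAt (fun α : ℝ => (α : ℂ) * Complex.I) Complex.I α := by
      simpa using (Complex.ofRealCLM.hasDerivAt (x := α)).mul_const Complex.I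
    have := h1.cexp
    rw [mul_comm] at this
    exact this
  have hJ : ∀ α, HasDerivAt J (-(n * Complex.I) * J α) α := by
    intro α
    have hder := (hasDerivAt_integral_of_dominated_loc_of_deriv_le (μ := discMeasure)
      (F := fun α z => φ (rot α * z) * Ψ.1 z)
      (F' := fun α z => fderiv ℝ φ (rot α * z) (Complex.I * (rot α * z)) * Ψ.1 z)
      (x₀ := α) (s := Set.univ) (bound := fun z => C * ‖Ψ.1 z‖) Filter.univ_mem
      (Filter.Eventually.of_forall fun β =>
        ((h.rotate (norm_rot β)).integrable (l2_integrable Ψ.1)).aestronglyMeasurable)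
      ((h.rotate (norm_rot α)).integrable (l2_integrable Ψ.1))
      ((hψ.rotate (norm_rot α)).integrable (l2_integrable Ψ.1)).aestronglyMeasurable
      (Filter.Eventually.of_forall fun z β _ => by
        rw [norm_mul]
        gcongr
        exact hC (rot β * z))
      ((l2_integrable Ψ.1).norm.const_mul C)
      (Filter.Eventually.of_forall fun z β _ => by
        have h1 := (hrot β).mul_const z
        have h2 := ((hd (rot β * z)).hasFDerivAt.comp_hasDerivAt β h1).mul_const (Ψ.1 z)
        refine h2.congr_deriv ?_
        rw [mul_assoc])).2
    refine hder.congr_deriv ?_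
    have e := test_angular hΨ (h.rotate (norm_rot α))
    simp only [fderiv_rotate hd] at e
    have e2 : ∀ z : ℂ, rot α * (Complex.I * z) = Complex.I * (rot α * z) := fun z => by ring
    simp only [e2] at e
    rw [e, neg_mul, ← integral_const_mul]
    congr 1
    apply integral_congr_ae
    filter_upwards [hn] with z hz
    rw [hz]
    ring
  -- Integrating factor: this product has derivative zero, hence keeps its value at `α = 0`.
  let P : ℝ → ℂ := fun α => rot (n * α) * J α
  have hP : ∀ α, HasDerivAt P 0 α := by
    intro α
    have h1 : HasDerivAt (fun α : ℝ => (n : ℝ) * α) n α := by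
      simpa using (hasDerivAt_id α).const_mul (n : ℝ)
    have h2 := HasDerivAt.scomp α (hrot (n * α)) h1
    refine (h2.mul (hJ α)).congr_deriv ?_
    simp only [Function.comp, Complex.real_smul]
    push_cast
    ring
  have hc := is_const_of_deriv_eq_zero (fun α => (hP α).differentiableAt) (fun α => (hP α).deriv)
    α 0
  have r0 : rot 0 = 1 := by simp [rot]
  simp only [P, J, mul_zero, r0, one_mul] at hc
  rw [← hc, ← mul_assoc]
  have : rot (-(n * α)) * rot (n * α) = 1 := by
    rw [rot, rot, ← Complex.exp_add]; simp
  rw [this, one_mul]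

theorem integral_disc_rotate (f : ℂ → ℂ) {c : ℂ} (hc : ‖c‖ = 1) :
    ∫ z in disc, f (c * z) = ∫ z in disc, f z := by
  let e : ℂ ≃ₗᵢ[ℝ] ℂ := rotation ⟨c, by simpa [Submonoid.unitSphere] using hc⟩
  have h := e.measurePreserving.setIntegral_preimage_emb e.toHomeomorph.measurableEmbedding f disc
  have hp : (e : ℂ → ℂ) ⁻¹' disc = disc := by
    ext z; simp [disc]
  rw [hp] at h
  exact h

theorem quasiMeasurePreserving_rotate {c : ℂ} (hc : ‖c‖ = 1) :
    MeasurePreserving (fun z => c * z) discMeasure discMeasure := by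
  let e : ℂ ≃ₗᵢ[ℝ] ℂ := rotation ⟨c, by simpa [Submonoid.unitSphere] using hc⟩
  have h := e.measurePreserving.restrict_preimage_emb e.toHomeomorph.measurableEmbedding disc
  have hp : (e : ℂ → ℂ) ⁻¹' disc = disc := by
    ext z; simp [disc]
  rw [hp] at h
  exact h

/-- Covariance under rotations, tested against smooth functions, holds pointwise. -/
theorem ae_rotate_of_test {n : ℕ} {u : ℂ → ℂ} (hu : Integrable u discMeasure)
    (h : ∀ φ, IsTest φ → ∀ α : ℝ,
      ∫ z in disc, φ (rot α * z) * u z = rot (-(n * α)) * ∫ z in disc, φ z * u z) (α : ℝ) :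
    ∀ᵐ z ∂discMeasure, u (rot α * z) = rot (n * α) * u z := by
  have hu' : Integrable (fun z => u (rot α * z)) discMeasure :=
    (quasiMeasurePreserving_rotate (norm_rot α)).integrable_comp_of_integrable hu
  have hint : Integrable (fun z => u (rot α * z) - rot (n * α) * u z) discMeasure :=
    hu'.sub (hu.const_mul _)
  have hzero := IsOpen.ae_eq_zero_of_integral_contDiff_smul_eq_zero (μ := (volume : Measure ℂ))
    (U := disc) Metric.isOpen_ball (f := fun z => u (rot α * z) - rot (n * α) * u z)
    (IntegrableOn.locallyIntegrableOn hint) (by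
      intro g hg hgc hgs
      have hφ : IsTest fun z => ((g z : ℝ) : ℂ) :=
        ⟨Complex.ofRealCLM.contDiff.comp hg, hgc.comp_left (g := fun x : ℝ => (x : ℂ)) (by simp),
          (tsupport_comp_subset (g := fun x : ℝ => (x : ℂ)) (by simp) g).trans hgs⟩
      have hc : rot (-α) * rot α = 1 := by rw [rot, rot, ← Complex.exp_add]; simp
      have e1 := integral_disc_rotate (fun z => ((g (rot (-α) * z) : ℝ) : ℂ) * u z) (norm_rot α)
      simp only [← mul_assoc, hc, one_mul] at e1
      have e2 := h _ hφ (-α)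
      have e0 : ∫ z : ℂ, g z • (u (rot α * z) - rot (n * α) * u z)
          = ∫ z in disc, g z • (u (rot α * z) - rot (n * α) * u z) :=
        (setIntegral_eq_integral_of_forall_compl_eq_zero fun z hz => by
          rw [image_eq_zero_of_notMem_tsupport fun h => hz (hgs h), zero_smul]).symm
      rw [e0]
      have e3 : ∀ z, g z • (u (rot α * z) - rot (n * α) * u z)
          = ((g z : ℝ) : ℂ) * u (rot α * z) - rot (n * α) * (((g z : ℝ) : ℂ) * u z) := fun z => by
        rw [Complex.real_smul]; ring
      simp only [e3]
      rw [integral_sub (hφ.integrable hu') ((hφ.integrable hu).const_mul _), integral_const_mul,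
        e1, e2]
      simp)
  filter_upwards [(ae_restrict_iff' measurableSet_ball).2 hzero] with z hz
  exact sub_eq_zero.1 hz

theorem rot_add (α β : ℝ) : rot (α + β) = rot α * rot β := by
  rw [rot, rot, rot, ← Complex.exp_add]; push_cast; ring_nf

/-- The exceptional null set in the hypothesis depends on `α`. Averaging `e^{-inα} u(e^{iα}z)` over
a full turn gives a function that is covariant at every point and agrees with `u` almost everywhere;
its restriction to the positive axis is the profile. -/
theorem exists_mode_of_rotate {n : ℕ} {u : ℂ → ℂ} (hm : StronglyMeasurable u)
    (h : ∀ α : ℝ, ∀ᵐ z ∂discMeasure, u (rot α * z) = rot (n * α) * u z) :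
    ∃ F : ℝ → ℂ, ∀ᵐ z ∂discMeasure, u z = mode n F z := by
  let M : ℂ → ℂ := fun z => (2 * Real.pi)⁻¹ •
    ∫ α in (0 : ℝ)..(2 * Real.pi), rot (-(n * α)) * u (rot α * z)
  have hrotc : Continuous rot := by unfold rot; fun_prop
  have hmz : Measurable fun p : ℂ × ℝ => u (rot p.2 * p.1) :=
    hm.measurable.comp ((hrotc.measurable.comp measurable_snd).mul measurable_fst)
  have hset : MeasurableSet {p : ℝ × ℂ | u (rot p.1 * p.2) = rot (n * p.1) * u p.2} := by
    refine measurableSet_eq_fun (hmz.comp measurable_swap) ?_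
    exact (hrotc.measurable.comp (measurable_fst.const_mul _)).mul
      (hm.measurable.comp measurable_snd)
  -- Fubini exchanges the quantifiers; joint measurability is the reason for asking that `u` be
  -- strongly measurable.
  have hae : ∀ᵐ z ∂discMeasure, ∀ᵐ α ∂(volume : Measure ℝ),
      u (rot α * z) = rot (n * α) * u z :=
    (Measure.ae_ae_comm hset).1 (Filter.Eventually.of_forall h)
  have inv : ∀ β : ℝ, rot (-β) * rot β = 1 := fun β => by
    rw [← rot_add]; simp [rot]
  have hM : ∀ᵐ z ∂discMeasure, u z = M z := by
    filter_upwards [hae] with z hz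
    have e : ∫ α in (0 : ℝ)..(2 * Real.pi), rot (-(n * α)) * u (rot α * z)
        = ∫ α in (0 : ℝ)..(2 * Real.pi), u z := by
      apply intervalIntegral.integral_congr_ae
      filter_upwards [hz] with α hα _
      rw [hα, ← mul_assoc, inv, one_mul]
    have hpi : (2 * Real.pi) ≠ 0 := by positivity
    simp only [M, e, intervalIntegral.integral_const, sub_zero, smul_smul,
      inv_mul_cancel₀ hpi, one_smul]
  have h2pi : ∀ k : ℕ, rot (k * (2 * Real.pi)) = 1 := fun k => by
    have := Complex.exp_nat_mul_two_pi_mul_I k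
    rw [rot, ← this]
    congr 1
    push_cast
    ring
  have hMrot : ∀ (β r : ℝ), M (rot β * r) = rot (n * β) * M r := by
    intro β r
    let f : ℝ → ℂ := fun α => rot (-(n * α)) * u (rot α * r)
    have hper : Function.Periodic f (2 * Real.pi) := by
      intro α
      simp only [f]
      have e1 : rot (-(n * (α + 2 * Real.pi))) = rot (-(n * α)) := by
        have := inv (n * (2 * Real.pi))
        rw [h2pi, mul_one] at this
        rw [mul_add, neg_add, rot_add, this, mul_one]
      have e2 : rot (α + 2 * Real.pi) = rot α := by
        have := h2pi 1
        rw [rot_add]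
        simp only [Nat.cast_one, one_mul] at this
        rw [this, mul_one]
      rw [e1, e2]
    have e : ∀ α : ℝ, rot (-(n * α)) * u (rot α * (rot β * r)) = rot (n * β) * f (α + β) := by
      intro α
      simp only [f]
      rw [← mul_assoc (rot α), ← rot_add, ← mul_assoc, ← rot_add]
      congr 2
      ring
    simp only [M]
    simp only [e]
    rw [intervalIntegral.integral_const_mul, intervalIntegral.integral_comp_add_right, zero_add,
      add_comm (2 * Real.pi) β, hper.intervalIntegral_add_eq β 0, zero_add, mul_smul_comm]
  refine ⟨fun r => M r, ?_⟩
  filter_upwards [hM, ae_mem_puncturedDisc] with z hz hp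
  have hn : (‖z‖ : ℂ) ≠ 0 := by simpa using hp.2
  have e : rot (Complex.arg z) = z / ‖z‖ := by
    rw [eq_div_iff hn, mul_comm]
    exact Complex.norm_mul_exp_arg_mul_I z
  have e1 : z = rot (Complex.arg z) * ((‖z‖ : ℝ) : ℂ) := by
    rw [e, div_mul_cancel₀ _ hn]
  have e2 : rot (n * Complex.arg z) = (z / ‖z‖) ^ (n : ℤ) := by
    rw [← e, rot, rot, zpow_natCast, ← Complex.exp_nat_mul]
    congr 1
    push_cast
    ring
  rw [hz, mode, ← e2]
  conv_lhs => rw [e1, hMrot]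
  rw [mul_comm]

theorem stronglyMeasurable_eulerDeriv (Ψ : Triple) : StronglyMeasurable (eulerDeriv Ψ) := by
  have h1 := (Lp.stronglyMeasurable Ψ.2.1)
  have h2 := (Lp.stronglyMeasurable Ψ.2.2)
  exact ((contDiff_ofReal_re.continuous.stronglyMeasurable).mul h1).add
    ((contDiff_ofReal_im.continuous.stronglyMeasurable).mul h2)

theorem norm_eulerDeriv_le (Ψ : Triple) (z : ℂ) :
    ‖eulerDeriv Ψ z‖ ≤ ‖z‖ * (‖Ψ.2.1 z‖ + ‖Ψ.2.2 z‖) := by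
  refine (norm_add_le _ _).trans ?_
  rw [norm_mul, norm_mul, Complex.norm_real, Complex.norm_real, Real.norm_eq_abs, Real.norm_eq_abs,
    mul_add]
  gcongr
  · exact Complex.abs_re_le_norm z
  · exact Complex.abs_im_le_norm z

theorem eulerDeriv_integrable (Ψ : Triple) : Integrable (eulerDeriv Ψ) discMeasure := by
  refine Integrable.mono' ((l2_integrable Ψ.2.1).norm.add (l2_integrable Ψ.2.2).norm)
    (stronglyMeasurable_eulerDeriv Ψ).aestronglyMeasurable ?_
  filter_upwards [ae_restrict_mem measurableSet_ball] with z hz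
  refine (norm_eulerDeriv_le Ψ z).trans (mul_le_of_le_one_left (by positivity) ?_)
  simp only [disc, Metric.mem_ball, dist_zero_right] at hz
  exact hz.le

/-- A function of angular momentum `n`, and its Euler derivative, are of the form
`f(r) e^{inθ}`. -/
theorem exists_mode_of_angularMomentum {n : ℕ} {Ψ : Triple} (hΨ : Ψ ∈ H1Disc)
    (hn : ∀ᵐ z ∂discMeasure, angularMomentum Ψ z = (n : ℂ) * Ψ.1 z) :
    ∃ F D : ℝ → ℂ, (∀ᵐ z ∂discMeasure, Ψ.1 z = mode n F z) ∧
      ∀ᵐ z ∂discMeasure, eulerDeriv Ψ z = mode n D z := by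
  have h1 : ∀ φ, IsTest φ → ∀ α : ℝ, _ := fun φ hφ α =>
    test_rotate_of_angularMomentum hΨ hn hφ α
  obtain ⟨F, hF⟩ := exists_mode_of_rotate (Lp.stronglyMeasurable Ψ.1)
    (ae_rotate_of_test (l2_integrable Ψ.1) h1)
  obtain ⟨D, hD⟩ := exists_mode_of_rotate (n := n) (stronglyMeasurable_eulerDeriv Ψ)
    (ae_rotate_of_test (eulerDeriv_integrable Ψ) (fun φ hφ α => by
      have hd := hφ.smooth.differentiable (by simp)
      -- The Euler field commutes with rotations, so covariance of `Ψ` tested against this function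
      -- is covariance of the Euler derivative tested against `φ`.
      have ht : IsTest fun z => 2 * φ z + fderiv ℝ φ z z :=
        (hφ.mul_left contDiff_const).add (hφ.fderiv_apply contDiff_id)
      have e1 := test_euler hΨ (hφ.rotate (norm_rot α))
      have e2 := test_euler hΨ hφ
      have e3 := h1 _ ht α
      simp only [fderiv_rotate hd] at e1
      rw [e1, e2, mul_neg] at e3
      exact neg_injective e3))
  exact ⟨F, D, hF, hD⟩

/-! ### Radial integration and distributions on the unit interval -/

/-- Lebesgue measure on the unit interval. -/
abbrev unitMeasure : Measure ℝ := (volume : Measure ℝ).restrict (Set.Ioo 0 1)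

theorem integral_disc_radial {E : Type*} [NormedAddCommGroup E] [NormedSpace ℝ E] (f : ℝ → E) :
    ∫ z in disc, f ‖z‖ = (2 * Real.pi) • ∫ r in Set.Ioo (0 : ℝ) 1, r • f r := by
  have h := integral_fun_norm_addHaar (volume : Measure ℂ) ((Set.Iio (1 : ℝ)).indicator f)
  have e1 : ∫ z in disc, f ‖z‖ = ∫ z : ℂ, (Set.Iio (1 : ℝ)).indicator f ‖z‖ := by
    rw [← integral_indicator measurableSet_ball]
    congr 1
    ext z
    simp [Set.indicator]
  have e2 : ∫ r in Set.Ioo (0 : ℝ) 1, r • f r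
      = ∫ y in Set.Ioi (0 : ℝ), y ^ (Module.finrank ℝ ℂ - 1) • (Set.Iio (1 : ℝ)).indicator f y := by
    rw [← integral_indicator measurableSet_Ioo, ← integral_indicator measurableSet_Ioi]
    congr 1
    ext y
    by_cases h0 : 0 < y <;> by_cases h1 : y < 1 <;> simp [Set.indicator, h0, h1]
  have e3 : (volume : Measure ℂ).real (Metric.ball 0 1) = Real.pi := by
    simp [Measure.real]
  rw [e1, h, ← e2, e3, Complex.finrank_real_complex, ← Nat.cast_smul_eq_nsmul ℝ, smul_smul]
  norm_num

theorem integrable_disc_radial {E : Type*} [NormedAddCommGroup E] [NormedSpace ℝ E] (f : ℝ → E) :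
    Integrable (fun z => f ‖z‖) discMeasure ↔ Integrable (fun r => r • f r) unitMeasure := by
  have h := integrableOn_fun_norm_addHaar (volume : Measure ℂ) (f := f) (r := 1)
  rw [Complex.finrank_real_complex] at h
  simp only [Nat.add_one_sub_one, pow_one] at h
  exact h

/-- The indicator of a measurable null set of radii has integral zero over the disc, by integration
in polar coordinates. -/
theorem ae_norm_of_ae {p : ℝ → Prop} (h : ∀ᵐ r ∂unitMeasure, p r) :
    ∀ᵐ z ∂discMeasure, p ‖z‖ := by
  obtain ⟨N, hN, hNm, hN0⟩ := exists_measurable_superset_of_null (ae_iff.1 h)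
  let f : ℝ → ℝ := N.indicator 1
  have h0 : ∀ᵐ r ∂unitMeasure, f r = 0 := by
    filter_upwards [measure_eq_zero_iff_ae_notMem.1 hN0] with r hr
    simp [f, hr]
  have h1 : Integrable (fun z => f ‖z‖) discMeasure := by
    rw [integrable_disc_radial]
    refine (integrable_zero ℝ ℝ unitMeasure).congr ?_
    filter_upwards [h0] with r hr
    simp [hr]
  have h2 : ∫ z in disc, f ‖z‖ = 0 := by
    rw [integral_disc_radial, integral_congr_ae (g := fun _ => 0)]
    · simp
    · filter_upwards [h0] with r hr
      simp [hr]
  have h3 := (integral_eq_zero_iff_of_nonneg (fun z => Set.indicator_nonneg (by simp) _) h1).1 h2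
  filter_upwards [h3] with z hz
  by_contra hc
  have : ‖z‖ ∈ N := hN hc
  simp [this] at hz

/-- Real test functions on the unit interval. -/
structure IsTest1 (A : ℝ → ℝ) : Prop where
  smooth : ContDiff ℝ ∞ A
  compact : HasCompactSupport A
  support : tsupport A ⊆ Set.Ioo 0 1

theorem IsTest1.deriv_isTest1 {A : ℝ → ℝ} (h : IsTest1 A) : IsTest1 (deriv A) :=
  ⟨((contDiff_infty_iff_deriv (𝕜 := ℝ)).1 h.smooth).2, h.compact.deriv,
    (tsupport_deriv_subset).trans h.support⟩

theorem IsTest1.eq_zero {A : ℝ → ℝ} (h : IsTest1 A) {r : ℝ} (hr : r ∉ Set.Ioo (0 : ℝ) 1) :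
    A r = 0 := image_eq_zero_of_notMem_tsupport fun h' => hr (h.support h')

theorem IsTest1.exists_zero_near {A : ℝ → ℝ} (h : IsTest1 A) :
    ∃ a b : ℝ, 0 < a ∧ a < b ∧ b < 1 ∧ ∀ r, r ∉ Set.Icc a b → A r = 0 := by
  obtain ⟨a, b, hab, h1⟩ : ∃ a b : ℝ, (0 < a ∧ a < b ∧ b < 1) ∧ tsupport A ⊆ Set.Icc a b := by
    by_cases hne : (tsupport A).Nonempty
    · obtain ⟨x, hx, hx'⟩ := h.compact.isCompact.exists_isLeast hne
      obtain ⟨y, hy, hy'⟩ := h.compact.isCompact.exists_isGreatest hne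
      have h1 := h.support hx
      have h2 := h.support hy
      have h3 := hx' hy
      refine ⟨x / 2, (1 + y) / 2, ⟨by linarith [h1.1], by linarith [h1.1, h2.2],
        by linarith [h2.2]⟩, fun r hr => ⟨?_, ?_⟩⟩
      · have := hx' hr
        linarith [h1.1]
      · have := hy' hr
        linarith [h2.2]
    · rw [Set.not_nonempty_iff_eq_empty] at hne
      exact ⟨1 / 3, 1 / 2, by norm_num, by simp [hne]⟩
  exact ⟨a, b, hab.1, hab.2.1, hab.2.2, fun r hr =>
    image_eq_zero_of_notMem_tsupport fun h' => hr (h1 h')⟩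

theorem isTest1_of_zero {A : ℝ → ℝ} (hA : ContDiff ℝ ∞ A) {a b : ℝ} (ha : 0 < a) (hb : b < 1)
    (h : ∀ r, r ∉ Set.Icc a b → A r = 0) : IsTest1 A := by
  have h1 : tsupport A ⊆ Set.Icc a b :=
    closure_minimal (fun r hr => by by_contra hc; exact hr (h r hc)) isClosed_Icc
  exact ⟨hA, HasCompactSupport.intro isCompact_Icc fun r hr => h r hr,
    h1.trans (Set.Icc_subset_Ioo ha hb)⟩

theorem IsTest1.mul_integrable {A : ℝ → ℝ} (h : IsTest1 A) {u : ℝ → ℂ}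
    (hu : LocallyIntegrableOn u (Set.Ioo 0 1)) :
    Integrable (fun r => ((A r : ℝ) : ℂ) * u r) unitMeasure := by
  have h1 : IntegrableOn u (tsupport A) := hu.integrableOn_compact_subset h.support h.compact
  obtain ⟨C, hC⟩ := h.smooth.continuous.bounded_above_of_compact_support h.compact
  have h2 : IntegrableOn (fun r => ((A r : ℝ) : ℂ) * u r) (tsupport A) :=
    Integrable.bdd_mul (c := C) h1
      (Complex.continuous_ofReal.comp h.smooth.continuous).aestronglyMeasurable
      (Filter.Eventually.of_forall fun r => by simpa using hC r)
  have h3 : Integrable (fun r => ((A r : ℝ) : ℂ) * u r) volume := by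
    rwa [integrableOn_iff_integrable_of_support_subset] at h2
    intro r hr
    by_contra hc
    exact hr (by simp [image_eq_zero_of_notMem_tsupport hc])
  exact h3.integrableOn

theorem IsTest1.sub_smul {A B : ℝ → ℝ} (hA : IsTest1 A) (hB : IsTest1 B) (c : ℝ) :
    IsTest1 fun r => A r - c * B r := by
  obtain ⟨a, b, ha, hab, hb, h1⟩ := hA.exists_zero_near
  obtain ⟨a', b', ha', hab', hb', h1'⟩ := hB.exists_zero_near
  refine isTest1_of_zero (hA.smooth.sub (contDiff_const.mul hB.smooth))
    (lt_min ha ha') (max_lt hb hb') fun r hr => ?_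
  have e1 : r ∉ Set.Icc a b := fun h => hr ⟨min_le_of_left_le h.1, le_max_of_le_left h.2⟩
  have e2 : r ∉ Set.Icc a' b' := fun h => hr ⟨min_le_of_right_le h.1, le_max_of_le_right h.2⟩
  rw [h1 r e1, h1' r e2]
  ring

/-- The primitive of a test function vanishing at `0`. -/
theorem IsTest1.primitive {B : ℝ → ℝ} (hB : IsTest1 B) :
    ContDiff ℝ ∞ (fun r => ∫ s in (0 : ℝ)..r, B s) ∧
    (∀ r, HasDerivAt (fun r => ∫ s in (0 : ℝ)..r, B s) (B r) r) := by
  have hc := hB.smooth.continuous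
  have h1 : ∀ r, HasDerivAt (fun r => ∫ s in (0 : ℝ)..r, B s) (B r) r := fun r =>
    (hc.integral_hasStrictDerivAt 0 r).hasDerivAt
  refine ⟨contDiff_infty_iff_deriv.2 ⟨fun r => (h1 r).differentiableAt, ?_⟩, h1⟩
  rw [show deriv (fun r => ∫ s in (0 : ℝ)..r, B s) = B from funext fun r => (h1 r).deriv]
  exact hB.smooth

theorem integral_unit_eq_interval (f : ℝ → ℂ) :
    ∫ r in Set.Ioo (0 : ℝ) 1, f r = ∫ r in (0 : ℝ)..1, f r := by
  rw [intervalIntegral.integral_of_le zero_le_one, integral_Ioc_eq_integral_Ioo]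

theorem exists_isTest1_integral_one : ∃ χ : ℝ → ℝ, IsTest1 χ ∧ ∫ s in (0 : ℝ)..1, χ s = 1 := by
  let f : ContDiffBump (1 / 2 : ℝ) := ⟨1 / 8, 1 / 4, by norm_num, by norm_num⟩
  refine ⟨f.normed volume, ?_, ?_⟩
  · refine isTest1_of_zero (a := 1 / 4) (b := 3 / 4) f.contDiff_normed (by norm_num) (by norm_num)
      fun r hr => ?_
    have : r ∉ Function.support (f.normed volume) := by
      rw [f.support_normed_eq]
      intro h
      rw [Metric.mem_ball, Real.dist_eq, abs_lt] at h
      exact hr ⟨by linarith [h.1], by linarith [h.2]⟩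
    simpa using this
  · have h1 := f.integral_normed (μ := (volume : Measure ℝ))
    refine Eq.trans ?_ h1
    rw [intervalIntegral.integral_of_le zero_le_one]
    apply setIntegral_eq_integral_of_forall_compl_eq_zero
    intro r hr
    have : r ∉ Function.support (f.normed volume) := by
      rw [f.support_normed_eq]
      intro h
      rw [Metric.mem_ball, Real.dist_eq, abs_lt] at h
      exact hr ⟨by linarith [h.1], by linarith [h.2]⟩
    simpa using this

theorem ae_eq_zero_of_isTest1 {h : ℝ → ℂ} (hh : LocallyIntegrableOn h (Set.Ioo 0 1))
    (hz : ∀ B, IsTest1 B → ∫ r in Set.Ioo (0 : ℝ) 1, ((B r : ℝ) : ℂ) * h r = 0) :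
    ∀ᵐ r ∂unitMeasure, h r = 0 := by
  have := IsOpen.ae_eq_zero_of_integral_contDiff_smul_eq_zero (μ := (volume : Measure ℝ))
    isOpen_Ioo hh (fun g hg hgc hgs => by
      have hB : IsTest1 g := ⟨hg, hgc, hgs⟩
      rw [← hz g hB]
      rw [setIntegral_eq_integral_of_forall_compl_eq_zero fun r hr => by
        rw [hB.eq_zero hr]; simp]
      simp)
  exact (ae_restrict_iff' measurableSet_Ioo).2 this

/-- The lemma of du Bois-Reymond. -/
theorem ae_const_of_weak_deriv_zero {h : ℝ → ℂ} (hh : LocallyIntegrableOn h (Set.Ioo 0 1))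
    (hz : ∀ A, IsTest1 A → ∫ r in Set.Ioo (0 : ℝ) 1, ((deriv A r : ℝ) : ℂ) * h r = 0) :
    ∃ c : ℂ, ∀ᵐ r ∂unitMeasure, h r = c := by
  obtain ⟨χ, hχ, hχ1⟩ := exists_isTest1_integral_one
  set c := ∫ r in Set.Ioo (0 : ℝ) 1, ((χ r : ℝ) : ℂ) * h r with hc
  refine ⟨c, ?_⟩
  have hl : LocallyIntegrableOn (fun r => h r - c) (Set.Ioo 0 1) :=
    hh.sub ((locallyIntegrable_const c).locallyIntegrableOn _)
  have := ae_eq_zero_of_isTest1 hl (fun B hB => by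
    -- Subtracting `mχ` leaves a function of mean zero, whose primitive is again compactly supported
    -- in the open interval and hence admissible in `hz`.
    set m := ∫ s in (0 : ℝ)..1, B s with hm
    have hD := hB.sub_smul hχ m
    obtain ⟨hs, hd⟩ := hD.primitive
    obtain ⟨a, b, ha, hab, hb, h1⟩ := hD.exists_zero_near
    have hcont := hD.smooth.continuous
    have hint : ∀ x y : ℝ, IntervalIntegrable (fun r => B r - m * χ r) volume x y := fun x y =>
      hcont.intervalIntegrable x y
    have htot : ∫ s in (0 : ℝ)..1, (B s - m * χ s) = 0 := by
      rw [intervalIntegral.integral_sub (hB.smooth.continuous.intervalIntegrable _ _)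
        ((hχ.smooth.continuous.const_mul m).intervalIntegrable _ _),
        intervalIntegral.integral_const_mul, hχ1, ← hm]
      ring
    have hA : IsTest1 fun r => ∫ s in (0 : ℝ)..r, (B s - m * χ s) := by
      refine isTest1_of_zero hs ha hb fun r hr => ?_
      by_cases hra : r < a
      · rw [intervalIntegral.integral_congr (g := fun _ => 0), intervalIntegral.integral_zero]
        intro s hs
        refine h1 s fun h => ?_
        have : s ≤ max 0 r := hs.2
        have : max 0 r < a := max_lt ha hra
        linarith [h.1]
      · have hbr : b < r := by
          by_contra hc
          exact hr ⟨not_lt.1 hra, not_lt.1 hc⟩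
        rw [← intervalIntegral.integral_add_adjacent_intervals (hint 0 1) (hint 1 r), htot,
          zero_add, intervalIntegral.integral_congr (g := fun _ => 0),
          intervalIntegral.integral_zero]
        intro s hs
        refine h1 s fun h => ?_
        have : min 1 r ≤ s := hs.1
        have : b < min 1 r := lt_min hb hbr
        linarith [h.2]
    have h2 := hz _ hA
    have e : deriv (fun r => ∫ s in (0 : ℝ)..r, (B s - m * χ s)) = fun r => B r - m * χ r :=
      funext fun r => (hd r).deriv
    rw [e] at h2
    have i1 := hB.mul_integrable hh
    have i2 := hχ.mul_integrable hh
    have e2 : ∀ r, (((B r - m * χ r : ℝ)) : ℂ) * h r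
        = ((B r : ℝ) : ℂ) * h r - m * (((χ r : ℝ) : ℂ) * h r) := fun r => by push_cast; ring
    simp only [e2] at h2
    rw [integral_sub i1 (i2.const_mul _), integral_const_mul, ← hc] at h2
    have e3 : ∀ r, ((B r : ℝ) : ℂ) * (h r - c) = ((B r : ℝ) : ℂ) * h r - ((B r : ℝ) : ℂ) * c :=
      fun r => by ring
    simp only [e3]
    have i3 : Integrable (fun r => ((B r : ℝ) : ℂ) * c) unitMeasure :=
      hB.mul_integrable ((locallyIntegrable_const c).locallyIntegrableOn _)
    rw [integral_sub i1 i3, integral_mul_const]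
    have e4 : ∫ r in Set.Ioo (0 : ℝ) 1, ((B r : ℝ) : ℂ) = m := by
      rw [integral_unit_eq_interval, intervalIntegral.integral_ofReal]
    rw [e4]
    exact h2)
  filter_upwards [this] with r hr
  exact sub_eq_zero.1 hr

/-- Integration by parts against the primitive of a locally integrable function. -/
theorem integral_deriv_mul_primitive {g : ℝ → ℂ}
    (hg : ∀ a : ℝ, 0 < a → a < 1 → IntervalIntegrable g volume a 1) {A : ℝ → ℝ} (hA : IsTest1 A) :
    ∫ r in Set.Ioo (0 : ℝ) 1, ((deriv A r : ℝ) : ℂ) * (∫ s in r..1, g s)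
      = ∫ r in Set.Ioo (0 : ℝ) 1, ((A r : ℝ) : ℂ) * g r := by
  obtain ⟨a, b, ha, hab, hb, h1⟩ := hA.exists_zero_near
  have h2 : ∀ r, r ∉ Set.Icc a b → deriv A r = 0 := by
    intro r hr
    have : A =ᶠ[nhds r] fun _ => 0 := by
      filter_upwards [isClosed_Icc.isOpen_compl.mem_nhds hr] with s hs
      exact h1 s hs
    rw [this.deriv_eq]
    simp
  set a' := a / 2 with ha'
  have ha'0 : 0 < a' := by positivity
  have ha'1 : a' < 1 := by linarith
  let ν : Measure ℝ := (volume : Measure ℝ).restrict (Set.Ioc a' 1)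
  have hgi : Integrable g ν := (intervalIntegrable_iff_integrableOn_Ioc_of_le ha'1.le).1 (hg a' ha'0 ha'1)
  have hdi : Integrable (fun r => ((deriv A r : ℝ) : ℂ)) ν :=
    ((Complex.continuous_ofReal.comp hA.deriv_isTest1.smooth.continuous).integrable_of_hasCompactSupport
      (hA.deriv_isTest1.compact.comp_left (g := fun x : ℝ => (x : ℂ)) (by simp))).integrableOn
  have hprod : Integrable (fun p : ℝ × ℝ => ((deriv A p.1 : ℝ) : ℂ) * g p.2) (ν.prod ν) :=
    hdi.mul_prod hgi
  have hset : MeasurableSet {p : ℝ × ℝ | p.1 < p.2} := measurableSet_lt measurable_fst measurable_snd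
  have hind := hprod.indicator hset
  have swap := integral_integral_swap (μ := ν) (ν := ν) (f := fun r s =>
    ({p : ℝ × ℝ | p.1 < p.2}.indicator (fun p : ℝ × ℝ => ((deriv A p.1 : ℝ) : ℂ) * g p.2)) (r, s))
    hind
  have toν : ∀ f : ℝ → ℂ, (∀ r, r ∉ Set.Icc a b → f r = 0) →
      ∫ r in Set.Ioo (0 : ℝ) 1, f r = ∫ r, f r ∂ν := by
    intro f hf
    rw [setIntegral_eq_integral_of_forall_compl_eq_zero (s := Set.Ioo 0 1) fun r hr =>
      hf r fun h => hr ⟨ha.trans_le h.1, h.2.trans_lt hb⟩]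
    exact (setIntegral_eq_integral_of_forall_compl_eq_zero (s := Set.Ioc a' 1) fun r hr =>
      hf r fun h => hr ⟨by linarith [h.1], h.2.trans hb.le⟩).symm
  rw [toν _ (fun r hr => by rw [h2 r hr]; simp), toν _ (fun r hr => by rw [h1 r hr]; simp)]
  have lhs : ∫ r, ((deriv A r : ℝ) : ℂ) * (∫ s in r..1, g s) ∂ν = ∫ r, ∫ s,
      ({p : ℝ × ℝ | p.1 < p.2}.indicator (fun p : ℝ × ℝ => ((deriv A p.1 : ℝ) : ℂ) * g p.2)) (r, s)
      ∂ν ∂ν := by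
    apply integral_congr_ae
    filter_upwards [ae_restrict_mem measurableSet_Ioc] with r hr
    have e : ∀ s, ({p : ℝ × ℝ | p.1 < p.2}.indicator
        (fun p : ℝ × ℝ => ((deriv A p.1 : ℝ) : ℂ) * g p.2)) (r, s)
        = ((deriv A r : ℝ) : ℂ) * (Set.Ioi r).indicator g s := fun s => by
      by_cases h : r < s <;> simp [Set.indicator, h]
    simp only [e]
    rw [integral_const_mul, intervalIntegral.integral_of_le hr.2]
    congr 1
    rw [integral_indicator measurableSet_Ioi, Measure.restrict_restrict measurableSet_Ioi]
    congr 2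
    ext s
    simp only [Set.mem_inter_iff, Set.mem_Ioi, Set.mem_Ioc]
    constructor
    · exact fun h => ⟨h.1, hr.1.trans h.1, h.2⟩
    · exact fun h => ⟨h.1, h.2.2⟩
  rw [lhs, swap]
  apply integral_congr_ae
  filter_upwards [ae_restrict_mem measurableSet_Ioc] with s hs
  have e : ∀ r, ({p : ℝ × ℝ | p.1 < p.2}.indicator
      (fun p : ℝ × ℝ => ((deriv A p.1 : ℝ) : ℂ) * g p.2)) (r, s)
      = (Set.Iio s).indicator (fun r => ((deriv A r : ℝ) : ℂ)) r * g s := fun r => by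
    by_cases h : r < s <;> simp [Set.indicator, h]
  simp only [e]
  rw [integral_mul_const]
  congr 1
  rw [integral_indicator measurableSet_Iio, Measure.restrict_restrict measurableSet_Iio]
  have e2 : Set.Iio s ∩ Set.Ioc a' 1 = Set.Ioo a' s := by
    ext r
    simp only [Set.mem_inter_iff, Set.mem_Iio, Set.mem_Ioo, Set.mem_Ioc]
    constructor
    · exact fun h => ⟨h.2.1, h.1⟩
    · exact fun h => ⟨h.2, h.1, h.2.le.trans hs.2⟩
  rw [e2, ← integral_Ioc_eq_integral_Ioo, ← intervalIntegral.integral_of_le hs.1.le,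
    intervalIntegral.integral_ofReal, intervalIntegral.integral_deriv_eq_sub
      (fun r _ => hA.smooth.differentiable (by simp) r)
      (hA.deriv_isTest1.smooth.continuous.intervalIntegrable _ _), h1 a' (fun h => by linarith [h.1]),
    sub_zero]

/-! ### Regularity of the profile -/

theorem mode_neg_mul_mode {z : ℂ} (hz : z ≠ 0) (k : ℤ) (A F : ℝ → ℂ) :
    mode (-k) A z * mode k F z = A ‖z‖ * F ‖z‖ := by
  have h0 : (z / (‖z‖ : ℂ)) ≠ 0 := div_ne_zero hz (by simpa using hz)
  rw [mode, mode, zpow_neg]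
  field_simp

theorem contDiffAt_mode {k : ℤ} {η : ℝ → ℂ} {z : ℂ} (hz : z ≠ 0)
    (h : ContDiffAt ℝ ∞ η ‖z‖) : ContDiffAt ℝ ∞ (mode k η) z := by
  have h1 : ContDiffAt ℝ ∞ (fun z : ℂ => ‖z‖) z := contDiffAt_norm ℝ hz
  have h2 : ContDiffAt ℝ ∞ (fun z : ℂ => z / (‖z‖ : ℂ)) z :=
    contDiffAt_id.mul ((Complex.ofRealCLM.contDiff.contDiffAt.comp z h1).inv
      (show ((‖z‖ : ℝ) : ℂ) ≠ 0 by simpa using hz))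
  have h0 : (z / (‖z‖ : ℂ)) ≠ 0 := div_ne_zero hz (by simpa using hz)
  refine ContDiffAt.mul (ContDiffAt.comp z h h1) ?_
  cases k with
  | ofNat m => simpa using h2.pow m
  | negSucc m =>
    simp only [zpow_negSucc]
    exact (h2.pow (m + 1)).inv (pow_ne_zero _ h0)

/-- The support lies in a closed annulus, away from the origin, where `e^{ikθ}` and the norm are not
smooth. -/
theorem isTest_mode {k : ℤ} {η : ℝ → ℂ} {a b : ℝ} (ha : 0 < a) (hb : b < 1)
    (hη : ∀ r, 0 < r → ContDiffAt ℝ ∞ η r) (h : ∀ r, r ∉ Set.Icc a b → η r = 0) :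
    IsTest (mode k η) := by
  have hz : ∀ z : ℂ, ‖z‖ ∉ Set.Icc a b → mode k η z = 0 := fun z hz => by
    rw [mode, h _ hz, zero_mul]
  have hK : IsClosed {z : ℂ | ‖z‖ ∈ Set.Icc a b} := isClosed_Icc.preimage continuous_norm
  have hs : tsupport (mode k η) ⊆ {z : ℂ | ‖z‖ ∈ Set.Icc a b} :=
    closure_minimal (fun z hz' => by by_contra hc; exact hz' (hz z hc)) hK
  have hKb : {z : ℂ | ‖z‖ ∈ Set.Icc a b} ⊆ Metric.closedBall 0 b := fun z hz => by
    simpa using hz.2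
  refine ⟨contDiff_iff_contDiffAt.2 fun z => ?_, ?_, ?_⟩
  · by_cases h0 : z = 0
    · have : mode k η =ᶠ[nhds z] fun _ => 0 := by
        filter_upwards [hK.isOpen_compl.mem_nhds (show z ∈ {z : ℂ | ‖z‖ ∈ Set.Icc a b}ᶜ by
          simp [h0, ha])] with y hy
        exact hz y hy
      exact contDiffAt_const.congr_of_eventuallyEq this
    · exact contDiffAt_mode h0 (hη _ (norm_pos_iff.2 h0))
  · exact HasCompactSupport.of_support_subset_isCompact
      ((isCompact_closedBall (0 : ℂ) b).of_isClosed_subset hK hKb)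
      ((subset_tsupport _).trans hs)
  · refine hs.trans fun z hz => ?_
    simpa [disc] using hz.2.trans_lt hb

theorem fderiv_mode_radial {k : ℤ} {η : ℝ → ℂ} {η' z : ℂ} (hz : z ≠ 0)
    (hd : DifferentiableAt ℝ (mode k η) z) (h : HasDerivAt η η' ‖z‖) :
    fderiv ℝ (mode k η) z z = mode k (fun r => r * η') z := by
  have h1 := hasLineDerivAt_mode (k := k) (η' := fun _ => η') hz h z
  rw [(hd.hasFDerivAt.hasLineDerivAt z).unique h1]
  have hn : ‖z‖ ≠ 0 := norm_ne_zero_iff.2 hz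
  have e1 : (inner ℝ z z : ℝ) / ‖z‖ = ‖z‖ := by
    rw [real_inner_self_eq_norm_sq]; field_simp
  have e2 : (inner ℝ (Complex.I * z) z : ℝ) = 0 := by
    simp [Complex.inner, mul_comm]
  simp only [modeDeriv, mode, e1, e2, zero_div, Complex.ofReal_zero, mul_zero, add_zero]
  ring

/-- The weak radial derivative of a profile. -/
theorem weak_deriv_profile {n : ℕ} {Ψ : Triple} (hΨ : Ψ ∈ H1Disc) {F D : ℝ → ℂ}
    (hF : ∀ᵐ z ∂discMeasure, Ψ.1 z = mode n F z)
    (hD : ∀ᵐ z ∂discMeasure, eulerDeriv Ψ z = mode n D z) {A : ℝ → ℝ} (hA : IsTest1 A) :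
    ∫ r in Set.Ioo (0 : ℝ) 1, ((deriv A r : ℝ) : ℂ) * F r
      = - ∫ r in Set.Ioo (0 : ℝ) 1, ((A r : ℝ) : ℂ) * (D r / r) := by
  obtain ⟨a, b, ha, hab, hb, h1⟩ := hA.exists_zero_near
  -- The factor `r⁻²` is chosen so that `r (2η + rη') = A'`: it absorbs the polar Jacobian and the
  -- divergence of the Euler field. The phase `e^{-inθ}` cancels that of `Ψ`.
  let η : ℝ → ℂ := fun r => ((A r : ℝ) : ℂ) / (r : ℂ) ^ 2
  let η' : ℝ → ℂ := fun r => ((deriv A r : ℝ) : ℂ) / (r : ℂ) ^ 2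
    - 2 * ((A r : ℝ) : ℂ) / (r : ℂ) ^ 3
  have hη : ∀ r : ℝ, 0 < r → HasDerivAt η (η' r) r := by
    intro r hr
    have hr0 : (r : ℂ) ≠ 0 := by exact_mod_cast hr.ne'
    have d1 := (hA.smooth.differentiable (by simp) r).hasDerivAt.ofReal_comp
    have d2 := ((hasDerivAt_id r).ofReal_comp).pow 2
    refine (d1.div d2 (by simpa using hr.ne')).congr_deriv ?_
    simp [η']
    field_simp
  have hηs : ∀ r : ℝ, 0 < r → ContDiffAt ℝ ∞ η r := by
    intro r hr
    have c1 : ContDiffAt ℝ ∞ (fun r => ((A r : ℝ) : ℂ)) r :=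
      (Complex.ofRealCLM.contDiff.comp hA.smooth).contDiffAt
    have c2 : ContDiffAt ℝ ∞ (fun r : ℝ => (r : ℂ) ^ 2) r :=
      (Complex.ofRealCLM.contDiff.pow 2).contDiffAt
    exact c1.mul (c2.inv (show (r : ℂ) ^ 2 ≠ 0 by simpa using hr.ne'))
  have ht : IsTest (mode (-(n : ℤ)) η) := isTest_mode ha hb hηs fun r hr => by
    simp [η, h1 r hr]
  have hd := ht.smooth.differentiable (by simp)
  have e := test_euler hΨ ht
  have e1 : ∫ z in disc, (2 * mode (-(n : ℤ)) η z + fderiv ℝ (mode (-(n : ℤ)) η) z z) * Ψ.1 z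
      = ∫ z in disc, (fun r : ℝ => (2 * η r + r * η' r) * F r) ‖z‖ := by
    apply integral_congr_ae
    filter_upwards [hF, ae_mem_puncturedDisc] with z hz hp
    have hp0 : z ≠ 0 := hp.2
    rw [hz, fderiv_mode_radial hp0 (hd z) (hη _ (norm_pos_iff.2 hp0)), add_mul, mul_assoc,
      mode_neg_mul_mode hp0, mode_neg_mul_mode hp0]
    ring
  have e2 : ∫ z in disc, mode (-(n : ℤ)) η z * eulerDeriv Ψ z
      = ∫ z in disc, (fun r : ℝ => η r * D r) ‖z‖ := by
    apply integral_congr_ae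
    filter_upwards [hD, ae_mem_puncturedDisc] with z hz hp
    rw [hz, mode_neg_mul_mode hp.2]
  rw [e1, e2, integral_disc_radial (fun r : ℝ => (2 * η r + r * η' r) * F r),
    integral_disc_radial (fun r : ℝ => η r * D r), ← smul_neg] at e
  have e3 := smul_right_injective ℂ (by positivity : (2 * Real.pi) ≠ 0) e
  have e4 : ∫ r in Set.Ioo (0 : ℝ) 1, ((deriv A r : ℝ) : ℂ) * F r
      = ∫ r in Set.Ioo (0 : ℝ) 1, r • ((2 * η r + r * η' r) * F r) := by
    refine setIntegral_congr_fun measurableSet_Ioo fun r hr => ?_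
    have hr0 : (r : ℂ) ≠ 0 := by exact_mod_cast hr.1.ne'
    simp only [η, η', Complex.real_smul]
    field_simp
    ring
  have e5 : ∫ r in Set.Ioo (0 : ℝ) 1, ((A r : ℝ) : ℂ) * (D r / r)
      = ∫ r in Set.Ioo (0 : ℝ) 1, r • (η r * D r) := by
    refine setIntegral_congr_fun measurableSet_Ioo fun r hr => ?_
    have hr0 : (r : ℂ) ≠ 0 := by exact_mod_cast hr.1.ne'
    simp only [η, Complex.real_smul]
    field_simp
  rw [e4, e5]
  exact e3

/-- From `2|g| ≤ r|g|² + 1/r`, where `1/r` is bounded away from the origin. -/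
theorem integrable_of_sq {g : ℝ → ℂ} (hm : AEStronglyMeasurable g unitMeasure)
    (h2 : Integrable (fun r => r * ‖g r‖ ^ 2) unitMeasure) {a : ℝ} (ha : 0 < a) (ha1 : a < 1) :
    IntervalIntegrable g volume a 1 := by
  rw [intervalIntegrable_iff_integrableOn_Ioo_of_le ha1.le]
  have hsub : Set.Ioo a 1 ⊆ Set.Ioo 0 1 := Set.Ioo_subset_Ioo_left ha.le
  have h3 : IntegrableOn (fun r => r * ‖g r‖ ^ 2 + a⁻¹) (Set.Ioo a 1) :=
    (IntegrableOn.mono_set h2 hsub).add (integrable_const _)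
  refine Integrable.mono' h3 (hm.mono_measure (Measure.restrict_mono hsub le_rfl)) ?_
  filter_upwards [ae_restrict_mem measurableSet_Ioo] with r hr
  have hr0 : 0 < r := ha.trans hr.1
  have h4 : r⁻¹ ≤ a⁻¹ := by gcongr; exact hr.1.le
  have h5 : ‖g r‖ * 2 ≤ r * ‖g r‖ ^ 2 + r⁻¹ := by
    have := mul_nonneg (inv_pos.2 hr0).le (sq_nonneg (r * ‖g r‖ - 1))
    have e : r⁻¹ * (r * ‖g r‖ - 1) ^ 2 = r * ‖g r‖ ^ 2 + r⁻¹ - ‖g r‖ * 2 := by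
      field_simp
      ring
    linarith
  have := norm_nonneg (g r)
  linarith

theorem integrable_profile {k : ℤ} {u : ℂ → ℂ} {F : ℝ → ℂ}
    (h : ∀ᵐ z ∂discMeasure, u z = mode k F z) (hu : Integrable u discMeasure) :
    Integrable (fun r => r • F r) unitMeasure := by
  rw [← integrable_disc_radial]
  have h1 : AEStronglyMeasurable (mode (-k) fun _ => 1) discMeasure :=
    aestronglyMeasurable_of_continuousOn (continuousOn_mode continuousOn_const)
  refine (hu.bdd_mul (c := 1) h1 ?_).congr ?_
  · filter_upwards [ae_mem_puncturedDisc] with z hz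
    rw [norm_mode hz.2]
    simp
  · filter_upwards [h, ae_mem_puncturedDisc] with z hz hp
    rw [hz, mode_neg_mul_mode hp.2, one_mul]

theorem locallyIntegrable_profile {F : ℝ → ℂ}
    (h : Integrable (fun r => r • F r) unitMeasure) : LocallyIntegrableOn F (Set.Ioo 0 1) := by
  have h1 : LocallyIntegrableOn (fun r => r • F r) (Set.Ioo 0 1) :=
    IntegrableOn.locallyIntegrableOn h
  have h2 := h1.continuousOn_smul isOpen_Ioo.isLocallyClosed (g := fun r : ℝ => r⁻¹)
    (ContinuousOn.inv₀ continuousOn_id fun r hr => hr.1.ne')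
  refine h2.congr ?_
  filter_upwards [ae_restrict_mem measurableSet_Ioo] with r hr
  rw [smul_smul, inv_mul_cancel₀ hr.1.ne', one_smul]

theorem norm_angularMomentum_le (Ψ : Triple) (z : ℂ) :
    ‖angularMomentum Ψ z‖ ≤ ‖z‖ * (‖Ψ.2.1 z‖ + ‖Ψ.2.2 z‖) := by
  rw [angularMomentum, norm_mul, norm_neg, Complex.norm_I, one_mul]
  refine (norm_sub_le _ _).trans ?_
  rw [norm_mul, norm_mul, Complex.norm_real, Complex.norm_real, Real.norm_eq_abs, Real.norm_eq_abs,
    add_comm, mul_add]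
  gcongr
  · exact Complex.abs_im_le_norm z
  · exact Complex.abs_re_le_norm z

theorem div_norm_memLp {Ψ : Triple} {u : ℂ → ℂ} (hm : AEStronglyMeasurable u discMeasure)
    (h : ∀ᵐ z ∂discMeasure, ‖u z‖ ≤ ‖z‖ * (‖Ψ.2.1 z‖ + ‖Ψ.2.2 z‖)) :
    MemLp (fun z => u z / ‖z‖) 2 discMeasure := by
  refine MemLp.of_le ((Lp.memLp Ψ.2.1).norm.add (Lp.memLp Ψ.2.2).norm) ?_ ?_
  · exact (hm.aemeasurable.div (by fun_prop)).aestronglyMeasurable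
  · filter_upwards [h, ae_mem_puncturedDisc] with z hz hp
    have hn : 0 < ‖z‖ := norm_pos_iff.2 hp.2
    rw [norm_div, Complex.norm_real, norm_norm, div_le_iff₀ hn, mul_comm]
    refine hz.trans (le_of_eq ?_)
    congr 1
    exact (Real.norm_of_nonneg (add_nonneg (norm_nonneg _) (norm_nonneg _))).symm

/-- A profile with square-integrable weak derivative and finite centrifugal energy is bounded. -/
theorem bounded_of_sq {F g : ℝ → ℂ} (hF : ContinuousOn F (Set.Ioc 0 1))
    (hFg : ∀ r ∈ Set.Ioc (0 : ℝ) 1, ∀ s ∈ Set.Ioc (0 : ℝ) 1, F r - F s = ∫ t in s..r, g t)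
    (g2 : Integrable (fun r => r * ‖g r‖ ^ 2) unitMeasure)
    (F2 : Integrable (fun r => r * (‖F r‖ / r) ^ 2) unitMeasure) :
    ∃ C, ∀ r ∈ Set.Ioc (0 : ℝ) 1, ‖F r‖ ≤ C := by
  set E := ∫ r in Set.Ioo (0 : ℝ) 1, r * ‖g r‖ ^ 2
  set M := ∫ r in Set.Ioo (0 : ℝ) 1, r * (‖F r‖ / r) ^ 2
  have part : ∀ {f : ℝ → ℝ}, Integrable f unitMeasure → (∀ r ∈ Set.Ioo (0 : ℝ) 1, 0 ≤ f r) →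
      ∀ a b : ℝ, 0 < a → a ≤ b → b ≤ 1 → IntervalIntegrable f volume a b ∧
      ∫ t in a..b, f t ≤ ∫ r in Set.Ioo (0 : ℝ) 1, f r := by
    intro f hf h0 a b ha hab hb
    have hsub : Set.Ioo a b ⊆ Set.Ioo 0 1 := Set.Ioo_subset_Ioo ha.le hb
    refine ⟨(intervalIntegrable_iff_integrableOn_Ioo_of_le hab).2 (IntegrableOn.mono_set hf hsub),
      ?_⟩
    rw [intervalIntegral.integral_of_le hab, integral_Ioc_eq_integral_Ioo]
    exact setIntegral_mono_set hf ((ae_restrict_mem measurableSet_Ioo).mono h0)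
      hsub.eventuallyLE
  have hE : ∀ a b : ℝ, 0 < a → a ≤ b → b ≤ 1 → _ := part g2 fun r hr => by
    have := hr.1; positivity
  have hM : ∀ a b : ℝ, 0 < a → a ≤ b → b ≤ 1 → _ := part F2 fun r hr => by
    have := hr.1; positivity
  refine ⟨M + 1 / 2 + (E + 1) / 2, fun r hr => ?_⟩
  have hr0 : 0 < r := hr.1
  -- On the dyadic interval `[r/2, r]` the oscillation is controlled by `2|g| ≤ t|g|² + 1/t`, and
  -- the integral of `1/t` over any part of that interval is at most one. Averaging this inequality
  -- over `s` then bounds `F(r)` by the mean of `|F|`, which the centrifugal energy controls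
  -- uniformly in `r`.
  have step : ∀ s ∈ Set.Icc (r / 2) r, ‖F r‖ ≤ ‖F s‖ + (E + 1) / 2 := by
    intro s hs
    have hs0 : 0 < s := by linarith [hs.1]
    have hs1 : s ≤ 1 := hs.2.trans hr.2
    have h1 := hFg r hr s ⟨hs0, hs1⟩
    have hE' := hE s r hs0 hs.2 hr.2
    have h2 : ‖∫ t in s..r, g t‖ ≤ ∫ t in s..r, (t * ‖g t‖ ^ 2 + 2 / r) / 2 := by
      refine intervalIntegral.norm_integral_le_of_norm_le hs.2 ?_
        ((hE'.1.add intervalIntegrable_const).div_const 2)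
      refine Filter.Eventually.of_forall fun t ht => ?_
      have ht0 : 0 < t := hs0.trans ht.1
      have h4 : t⁻¹ ≤ 2 / r := by
        rw [inv_le_comm₀ ht0 (by positivity), inv_div]
        linarith [ht.1, hs.1]
      have h5 : ‖g t‖ * 2 ≤ t * ‖g t‖ ^ 2 + t⁻¹ := by
        have := mul_nonneg (inv_pos.2 ht0).le (sq_nonneg (t * ‖g t‖ - 1))
        have e : t⁻¹ * (t * ‖g t‖ - 1) ^ 2 = t * ‖g t‖ ^ 2 + t⁻¹ - ‖g t‖ * 2 := by
          field_simp
          ring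
        linarith
      linarith
    rw [intervalIntegral.integral_div, intervalIntegral.integral_add hE'.1 intervalIntegrable_const,
      intervalIntegral.integral_const, smul_eq_mul] at h2
    have h6 : (r - s) * (2 / r) ≤ 1 := by
      rw [mul_div_assoc', div_le_one hr0]
      linarith [hs.1]
    have h7 : ‖F r‖ ≤ ‖F s‖ + ‖F r - F s‖ := by
      simpa using norm_add_le (F s) (F r - F s)
    rw [h1] at h7
    linarith [hE'.2]
  have hM' := hM (r / 2) r (by positivity) (by linarith) hr.2
  have hcF : IntervalIntegrable (fun s => ‖F s‖) volume (r / 2) r := by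
    refine ContinuousOn.intervalIntegrable ?_
    rw [Set.uIcc_of_le (by linarith)]
    exact (hF.mono fun s hs => ⟨by linarith [hs.1], hs.2.trans hr.2⟩).norm
  have i1 : ∫ s in (r / 2)..r, ‖F r‖ ≤ ∫ s in (r / 2)..r, (‖F s‖ + (E + 1) / 2) :=
    intervalIntegral.integral_mono_on (by linarith) intervalIntegrable_const
      (hcF.add intervalIntegrable_const) step
  have i2 : ∫ s in (r / 2)..r, ‖F s‖ ≤ ∫ s in (r / 2)..r, (r * (s * (‖F s‖ / s) ^ 2) + 1) / 2 := by
    refine intervalIntegral.integral_mono_on (by linarith) hcF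
      (((hM'.1.const_mul r).add intervalIntegrable_const).div_const 2) fun s hs => ?_
    have hs0 : 0 < s := by linarith [hs.1]
    have e : s * (‖F s‖ / s) ^ 2 = ‖F s‖ ^ 2 / s := by field_simp
    have h3 : ‖F s‖ ^ 2 ≤ r * (‖F s‖ ^ 2 / s) := by
      rw [mul_div_assoc', le_div_iff₀ hs0, mul_comm]
      exact mul_le_mul_of_nonneg_right hs.2 (sq_nonneg _)
    rw [e]
    nlinarith [sq_nonneg (‖F s‖ - 1)]
  rw [intervalIntegral.integral_div, intervalIntegral.integral_add (hM'.1.const_mul r)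
    intervalIntegrable_const, intervalIntegral.integral_const_mul, intervalIntegral.integral_const,
    smul_eq_mul] at i2
  rw [intervalIntegral.integral_add hcF intervalIntegrable_const, intervalIntegral.integral_const,
    intervalIntegral.integral_const, smul_eq_mul, smul_eq_mul] at i1
  have i3 : r * ∫ t in (r / 2)..r, t * (‖F t‖ / t) ^ 2 ≤ r * M :=
    mul_le_mul_of_nonneg_left hM'.2 hr0.le
  have i4 : r / 2 * ‖F r‖ ≤ r / 2 * (M + 1 / 2 + (E + 1) / 2) := by
    have e : r - r / 2 = r / 2 := by ring
    rw [e] at i1 i2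
    linarith
  exact le_of_mul_le_mul_left i4 (by positivity)

/-- A function of angular momentum `n ≥ 1` has a continuous bounded profile, which is a primitive
of the profile of its radial derivative. -/
theorem exists_profile {n : ℕ} (hn0 : 1 ≤ n) {Ψ : Triple} (hΨ : Ψ ∈ H1Disc)
    (hn : ∀ᵐ z ∂discMeasure, angularMomentum Ψ z = (n : ℂ) * Ψ.1 z) :
    ∃ F g : ℝ → ℂ, (∀ᵐ z ∂discMeasure, Ψ.1 z = mode n F z) ∧
      (∀ᵐ z ∂discMeasure, radialDeriv Ψ z = mode n g z) ∧ ContinuousOn F (Set.Ioc 0 1) ∧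
      (∃ C, ∀ r ∈ Set.Ioc (0 : ℝ) 1, ‖F r‖ ≤ C) ∧
      (∀ r, F r = F 1 - ∫ t in r..1, g t) ∧ AEStronglyMeasurable g unitMeasure ∧
      (Integrable (fun r => r * ‖g r‖ ^ 2) unitMeasure) := by
  obtain ⟨F₀, D, hF₀, hD⟩ := exists_mode_of_angularMomentum hΨ hn
  let g : ℝ → ℂ := fun r => D r / r
  have hg : ∀ᵐ z ∂discMeasure, radialDeriv Ψ z = mode n g z := by
    filter_upwards [hD] with z hz
    have : radialDeriv Ψ z = eulerDeriv Ψ z / ‖z‖ := rfl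
    rw [this, hz, mode, mode]
    ring
  have iF₀ := integrable_profile hF₀ (l2_integrable Ψ.1)
  have iD := integrable_profile hD (eulerDeriv_integrable Ψ)
  have lF₀ := locallyIntegrable_profile iF₀
  have lD := locallyIntegrable_profile iD
  have lg : LocallyIntegrableOn g (Set.Ioo 0 1) := by
    have h2 := lD.continuousOn_smul isOpen_Ioo.isLocallyClosed (g := fun r : ℝ => r⁻¹)
      (ContinuousOn.inv₀ continuousOn_id fun r hr => hr.1.ne')
    refine h2.congr (Filter.Eventually.of_forall fun r => ?_)
    simp [g, div_eq_inv_mul]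
  have mg : AEStronglyMeasurable g unitMeasure := lg.aestronglyMeasurable
  have g2 : Integrable (fun r => r * ‖g r‖ ^ 2) unitMeasure := by
    have := div_norm_memLp (Ψ := Ψ) (stronglyMeasurable_eulerDeriv Ψ).aestronglyMeasurable
      (Filter.Eventually.of_forall (norm_eulerDeriv_le Ψ))
    have h2 := this.integrable_norm_pow (p := 2) (by norm_num)
    refine (integrable_disc_radial (fun r => ‖g r‖ ^ 2)).1 (h2.congr ?_)
    filter_upwards [hg, ae_mem_puncturedDisc] with z hz hp
    have : radialDeriv Ψ z = eulerDeriv Ψ z / ‖z‖ := rfl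
    rw [← this, hz, norm_mode hp.2]
  have F₀2 : Integrable (fun r => r * (‖F₀ r‖ / r) ^ 2) unitMeasure := by
    -- This uses `n ≥ 1`: the function is dominated by its own angular derivative, so `|Ψ|/r` is
    -- square integrable.
    have hle : ∀ᵐ z ∂discMeasure, ‖Ψ.1 z‖ ≤ ‖z‖ * (‖Ψ.2.1 z‖ + ‖Ψ.2.2 z‖) := by
      filter_upwards [hn] with z hz
      have h1 := norm_angularMomentum_le Ψ z
      rw [hz, norm_mul, Complex.norm_natCast] at h1
      have h2 : (1 : ℝ) ≤ n := by exact_mod_cast hn0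
      nlinarith [norm_nonneg (Ψ.1 z)]
    have h2 := (div_norm_memLp (Ψ := Ψ) (Lp.aestronglyMeasurable Ψ.1) hle).integrable_norm_pow
      (p := 2) (by norm_num)
    refine (integrable_disc_radial (fun r => (‖F₀ r‖ / r) ^ 2)).1 (h2.congr ?_)
    filter_upwards [hF₀, ae_mem_puncturedDisc] with z hz hp
    rw [norm_div, hz, norm_mode hp.2]
    simp
  have hgi : ∀ a : ℝ, 0 < a → a < 1 → IntervalIntegrable g volume a 1 := fun a ha ha1 =>
    integrable_of_sq mg g2 ha ha1
  have hPc : ContinuousOn (fun r => ∫ t in r..1, g t) (Set.Ioc 0 1) := by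
    intro r hr
    have hr2 : r / 2 < 1 := by linarith [hr.2, hr.1]
    have hr2' : 0 < r / 2 := by linarith [hr.1]
    have h1 := hgi (r / 2) hr2' hr2
    have h2 := intervalIntegral.continuousOn_primitive_interval_left (μ := volume)
      ((intervalIntegrable_iff_integrableOn_Icc_of_le hr2.le).1 h1 |>.mono_set
        (by rw [Set.uIcc_of_le hr2.le]))
    rw [Set.uIcc_of_le hr2.le] at h2
    refine (h2 r ⟨by linarith [hr.1], hr.2⟩).mono_of_mem_nhdsWithin ?_
    filter_upwards [self_mem_nhdsWithin, mem_nhdsWithin_of_mem_nhds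
      (Ioi_mem_nhds (show r / 2 < r by linarith [hr.1]))] with s hs hs'
    exact ⟨le_of_lt hs', hs.2⟩
  have lP : LocallyIntegrableOn (fun r => ∫ t in r..1, g t) (Set.Ioo 0 1) :=
    (hPc.mono Set.Ioo_subset_Ioc_self).locallyIntegrableOn measurableSet_Ioo
  -- The sum of `F₀` and the tail integral of `g` has zero weak derivative, hence is constant; this
  -- selects the continuous representative `F`.
  obtain ⟨c, hc⟩ := ae_const_of_weak_deriv_zero (lF₀.add lP) (fun A hA => by
    have e1 := weak_deriv_profile hΨ hF₀ hD hA
    have e2 := integral_deriv_mul_primitive hgi hA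
    simp only [Pi.add_apply, mul_add]
    rw [integral_add (hA.deriv_isTest1.mul_integrable lF₀) (hA.deriv_isTest1.mul_integrable lP),
      e1, e2]
    simp [g])
  let F : ℝ → ℂ := fun r => c - ∫ t in r..1, g t
  have hFF₀ : ∀ᵐ r ∂unitMeasure, F₀ r = F r := by
    filter_upwards [hc] with r hr
    simp only [F, ← hr, Pi.add_apply]
    ring
  have hF1 : F 1 = c := by simp [F]
  have hFc : ContinuousOn F (Set.Ioc 0 1) := continuousOn_const.sub hPc
  have hint : ∀ r ∈ Set.Ioc (0 : ℝ) 1, IntervalIntegrable g volume r 1 := fun r hr => by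
    rcases hr.2.lt_or_eq with h | h
    · exact hgi r hr.1 h
    · rw [h]
  refine ⟨F, g, ?_, hg, hFc, ?_, fun r => by rw [hF1], mg, g2⟩
  · filter_upwards [hF₀, ae_norm_of_ae hFF₀] with z h1 h2
    rw [h1, mode, mode, h2]
  · refine bounded_of_sq hFc (fun r hr s hs => ?_) g2 (F₀2.congr ?_)
    · have := intervalIntegral.integral_add_adjacent_intervals
        ((hint s hs).trans (hint r hr).symm) (hint r hr)
      simp only [F]
      rw [← this]
      ring
    · filter_upwards [hFF₀] with r hr
      rw [hr]

/-! ### The radial Gross-Pitaevskii equation with Neumann condition -/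

theorem conj_mode_mul_mode {z : ℂ} (hz : z ≠ 0) (k : ℤ) (A F : ℝ → ℂ) :
    conj (mode k A z) * mode k F z = conj (A ‖z‖) * F ‖z‖ := by
  have h0 : conj ((z / (‖z‖ : ℂ)) ^ k) * (z / (‖z‖ : ℂ)) ^ k = 1 := by
    rw [← Complex.normSq_eq_conj_mul_self, Complex.normSq_eq_norm_sq, norm_direction_zpow hz]
    simp
  rw [mode, mode, map_mul]
  linear_combination conj (A ‖z‖) * F ‖z‖ * h0

/-- The radial Gross-Pitaevskii equation with Neumann boundary condition, for the profile `F` of a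
function of angular momentum `n`; here `K r = r F' r`. -/
structure IsVortexProfile (n : ℕ) (ε ν : ℝ) (F K : ℝ → ℂ) : Prop where
  contF : ContinuousOn F (Set.Ioc 0 1)
  contK : ContinuousOn K (Set.Ioc 0 1)
  neumann : K 1 = 0
  derivF : ∀ r ∈ Set.Ioo (0 : ℝ) 1, HasDerivAt F (K r / r) r
  derivK : ∀ r ∈ Set.Ioo (0 : ℝ) 1,
    HasDerivAt K ((((n : ℝ) ^ 2 / r + r * (2 * ‖F r‖ ^ 2 / ε ^ 2 - ν) : ℝ) : ℂ) * F r) r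
  bdd : ∃ C, ∀ r ∈ Set.Ioc (0 : ℝ) 1, ‖F r‖ ≤ C

theorem hasDerivAt_tail {k : ℝ → ℂ} (hk : ContinuousOn k (Set.Ioc 0 1)) {r : ℝ}
    (hr : r ∈ Set.Ioo (0 : ℝ) 1) : HasDerivAt (fun r => ∫ t in r..1, k t) (-k r) r := by
  have hnhds : Set.Ioc (0 : ℝ) 1 ∈ nhds r := Ioc_mem_nhds hr.1 hr.2
  refine intervalIntegral.integral_hasDerivAt_left ?_ ?_ (hk.continuousAt hnhds)
  · refine (hk.mono fun s hs => ?_).intervalIntegrable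
    rw [Set.uIcc_of_le hr.2.le] at hs
    exact ⟨hr.1.trans_le hs.1, hs.2⟩
  · exact ⟨Set.Ioc 0 1, hnhds, hk.aestronglyMeasurable measurableSet_Ioc⟩

theorem continuousOn_tail {k : ℝ → ℂ} (hk : ContinuousOn k (Set.Ioc 0 1)) :
    ContinuousOn (fun r => ∫ t in r..1, k t) (Set.Ioc 0 1) := by
  intro r hr
  have hr2 : r / 2 ≤ 1 := by linarith [hr.2, hr.1]
  have h1 : ContinuousOn k (Set.uIcc (r / 2) 1) := hk.mono fun s hs => by
    rw [Set.uIcc_of_le hr2] at hs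
    exact ⟨by linarith [hr.1, hs.1], hs.2⟩
  have h2 := intervalIntegral.continuousOn_primitive_interval_left (μ := volume)
    (h1.integrableOn_compact isCompact_uIcc)
  rw [Set.uIcc_of_le hr2] at h2
  refine (h2 r ⟨by linarith [hr.1], hr.2⟩).mono_of_mem_nhdsWithin ?_
  filter_upwards [self_mem_nhdsWithin, mem_nhdsWithin_of_mem_nhds
    (Ioi_mem_nhds (show r / 2 < r by linarith [hr.1]))] with s hs hs'
  exact ⟨le_of_lt hs', hs.2⟩

/-- The weak form of the radial equation. -/
theorem weak_radial_equation {ε Ω : ℝ} {n : ℕ} {Ψ : Triple}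
    (hΨ : Ψ ∈ normalizedWithAngularMomentum n)
    (hmin : IsMinOn (energy ε Ω) (normalizedWithAngularMomentum n) Ψ) {F g : ℝ → ℂ}
    (hF : ∀ᵐ z ∂discMeasure, Ψ.1 z = mode n F z)
    (hg : ∀ᵐ z ∂discMeasure, radialDeriv Ψ z = mode n g z)
    (hb : EssBounded Ψ.1) {B : ℝ → ℝ} (hB : IsTest1 B) (c : ℂ) :
    ∫ r in Set.Ioo (0 : ℝ) 1, r * ((conj (g r) * (B r * c)).re
      + ((n : ℝ) ^ 2 / r ^ 2 + (2 * ‖F r‖ ^ 2 / ε ^ 2 - (multiplier ε Ω Ψ + n * Ω)))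
        * (conj (F r) * ((∫ s in (0 : ℝ)..r, B s : ℝ) * c)).re) = 0 := by
  -- The primitive of `B` vanishes near the core but is only constant near `r = 1`. Since no value
  -- is imposed on the boundary circle, the natural boundary condition is contained in this weak
  -- equation.
  set η : ℝ → ℂ := fun r => ((∫ s in (0 : ℝ)..r, B s : ℝ) : ℂ) * c with hη
  set η' : ℝ → ℂ := fun r => B r * c with hη'
  obtain ⟨a, b, ha, hab, hb1, hB0⟩ := hB.exists_zero_near
  have hprim := hB.primitive
  have hder : ∀ r, HasDerivAt η (η' r) r := fun r => ((hprim.2 r).ofReal_comp).mul_const c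
  have hη'c : Continuous η' := (Complex.continuous_ofReal.comp hB.smooth.continuous).mul_const c
  have hηc : Continuous η := continuous_iff_continuousAt.2 fun r => (hder r).continuousAt
  obtain ⟨C₁, hC₁⟩ := isCompact_Icc.exists_bound_of_continuousOn (hηc.continuousOn (s := Set.Icc 0 1))
  obtain ⟨C₂, hC₂⟩ := isCompact_Icc.exists_bound_of_continuousOn (hη'c.continuousOn (s := Set.Icc 0 1))
  have hC₁0 : 0 ≤ C₁ := (norm_nonneg _).trans (hC₁ 0 (by simp))
  have hC₂0 : 0 ≤ C₂ := (norm_nonneg _).trans (hC₂ 0 (by simp))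
  have hηa : ∀ r ∈ Set.Ioo (0 : ℝ) 1, r < a → η r = 0 := by
    intro r hr hra
    have : ∫ s in (0 : ℝ)..r, B s = 0 := by
      rw [intervalIntegral.integral_congr (g := fun _ => 0), intervalIntegral.integral_zero]
      intro s hs
      rw [Set.uIcc_of_le hr.1.le] at hs
      exact hB0 s fun h => by linarith [h.1, hs.2]
    simp [hη, this]
  have hle : 0 ≤ n * C₁ / a := by positivity
  obtain ⟨W, hW, hWm, hWb⟩ := exists_isMode (n : ℤ) (η := η) (η' := η') (C := C₁ + C₂ + n * C₁ / a)
    (fun r _ => hder r) hη'c.continuousOn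
    (fun r hr => by linarith [hC₁ r ⟨hr.1.le, hr.2.le⟩])
    (fun r hr => by linarith [hC₂ r ⟨hr.1.le, hr.2.le⟩])
    (fun r hr => by
      by_cases hra : r < a
      · rw [hηa r hr hra, norm_zero, mul_zero]
        have := hr.1
        positivity
      · have h1 := hC₁ r ⟨hr.1.le, hr.2.le⟩
        have h2 : 1 ≤ r / a := (one_le_div ha).2 (not_lt.1 hra)
        have e : |(((n : ℕ) : ℤ) : ℝ)| = n := by simp
        rw [e]
        have h3 : (n : ℝ) * ‖η r‖ ≤ n * C₁ * 1 := by
          rw [mul_one]; gcongr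
        have h4 : (n : ℝ) * C₁ * 1 ≤ n * C₁ * (r / a) := by gcongr
        have h5 : (n : ℝ) * C₁ * (r / a) = n * C₁ / a * r := by ring
        have h6 : 0 ≤ (C₁ + C₂) * r := by have := hr.1; positivity
        linarith)
  have hEL := euler_lagrange hΨ hmin hb hW hWb (by
    filter_upwards [hWm.angularMomentum_eq, hWm.1] with z h1 h2
    rw [h1, h2]
    simp)
  have i1 := crossDensity_integrable Ω Ψ W
  have i2 := l2_mul_integrable (Lp.memLp Ψ.1) (Lp.memLp W.1)
  have i3 : Integrable (fun z => 4 * ‖Ψ.1 z‖ ^ 2 * (conj (Ψ.1 z) * W.1 z).re) discMeasure := by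
    obtain ⟨C, hC⟩ := hb
    refine i2.bdd_mul (c := 4 * C ^ 2) (((Lp.aestronglyMeasurable Ψ.1).norm.pow 2).const_mul 4) ?_
    filter_upwards [hC] with z hz
    rw [Real.norm_of_nonneg (by positivity)]
    gcongr
  have e1 : 2 * crossForm Ω Ψ W
      + (∫ z in disc, 4 * ‖Ψ.1 z‖ ^ 2 * (conj (Ψ.1 z) * W.1 z).re) / ε ^ 2
      - 2 * multiplier ε Ω Ψ * (∫ z in disc, (conj (Ψ.1 z) * W.1 z).re)
      = ∫ z in disc, (2 * crossDensity Ω Ψ W z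
        + 4 * ‖Ψ.1 z‖ ^ 2 * (conj (Ψ.1 z) * W.1 z).re / ε ^ 2
        - 2 * multiplier ε Ω Ψ * (conj (Ψ.1 z) * W.1 z).re) := by
    rw [integral_sub (by exact (i1.const_mul 2).add (i3.div_const _)) (i2.const_mul _),
      integral_add (i1.const_mul 2) (i3.div_const _), integral_const_mul, integral_div,
      integral_const_mul]
    rfl
  let f : ℝ → ℝ := fun r => 2 * ((conj (g r) * η' r).re
      + ((n : ℝ) ^ 2 / r ^ 2 + (2 * ‖F r‖ ^ 2 / ε ^ 2 - (multiplier ε Ω Ψ + n * Ω)))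
        * (conj (F r) * η r).re)
  have e2 : ∫ z in disc, (2 * crossDensity Ω Ψ W z
        + 4 * ‖Ψ.1 z‖ ^ 2 * (conj (Ψ.1 z) * W.1 z).re / ε ^ 2
        - 2 * multiplier ε Ω Ψ * (conj (Ψ.1 z) * W.1 z).re) = ∫ z in disc, f ‖z‖ := by
    apply integral_congr_ae
    filter_upwards [hF, hg, hΨ.2, hWm.1, hWm.radialDeriv_eq, hWm.angularMomentum_eq,
      ae_mem_puncturedDisc] with z h1 h2 h3 h4 h5 h6 hp
    have hp0 : z ≠ 0 := hp.2
    have q1 : (conj (radialDeriv Ψ z) * radialDeriv W z).re = (conj (g ‖z‖) * η' ‖z‖).re := by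
      rw [h2, h5, conj_mode_mul_mode hp0]
    have q2 : (conj (Ψ.1 z) * W.1 z).re = (conj (F ‖z‖) * η ‖z‖).re := by
      rw [h1, h4, conj_mode_mul_mode hp0]
    have q3 : (conj (angularMomentum Ψ z) * angularMomentum W z).re
        = n ^ 2 * (conj (F ‖z‖) * η ‖z‖).re := by
      rw [h3, h6, ← h4, ← q2, map_mul, Complex.conj_natCast]
      have : (n : ℂ) * conj (Ψ.1 z) * (((n : ℤ) : ℂ) * W.1 z)
          = (((n : ℝ) ^ 2 : ℝ) : ℂ) * (conj (Ψ.1 z) * W.1 z) := by push_cast; ring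
      rw [this, Complex.re_ofReal_mul]
    have q4 : (conj (Ψ.1 z) * angularMomentum W z + conj (W.1 z) * angularMomentum Ψ z).re
        = 2 * n * (conj (F ‖z‖) * η ‖z‖).re := by
      rw [h3, h6, ← h4, ← q2]
      simp only [Complex.add_re, Complex.mul_re, Complex.conj_re, Complex.conj_im, Complex.mul_im,
        Complex.natCast_re, Complex.natCast_im, Int.cast_natCast]
      ring
    have q5 : ‖Ψ.1 z‖ = ‖F ‖z‖‖ := by rw [h1, norm_mode hp0]
    rw [crossDensity_eq_polar Ω Ψ W hp0, q1, q2, q3, q4, q5]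
    simp only [f]
    ring
  rw [e1, e2, integral_disc_radial f] at hEL
  have h0 := (smul_eq_zero.1 hEL).resolve_left (by positivity)
  have h2 : ∫ r in Set.Ioo (0 : ℝ) 1, r • f r = 2 * ∫ r in Set.Ioo (0 : ℝ) 1,
      r * ((conj (g r) * η' r).re
      + ((n : ℝ) ^ 2 / r ^ 2 + (2 * ‖F r‖ ^ 2 / ε ^ 2 - (multiplier ε Ω Ψ + n * Ω)))
        * (conj (F r) * η r).re) := by
    rw [← integral_const_mul]
    congr 1
    ext r
    simp only [f, smul_eq_mul]
    ring
  rw [h2] at h0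
  linarith

/-- A minimizer of angular momentum `n` solves the radial equation. -/
theorem exists_isVortexProfile {ε Ω : ℝ} {n : ℕ} (hn0 : 1 ≤ n) {Ψ : Triple}
    (hΨ : Ψ ∈ normalizedWithAngularMomentum n)
    (hmin : IsMinOn (energy ε Ω) (normalizedWithAngularMomentum n) Ψ) :
    ∃ F K : ℝ → ℂ, IsVortexProfile n ε (multiplier ε Ω Ψ + n * Ω) F K ∧
      (∀ᵐ z ∂discMeasure, Ψ.1 z = mode n F z) ∧
      (∀ᵐ z ∂discMeasure, radialDeriv Ψ z = mode n (fun r => K r / r) z) := by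
  obtain ⟨F, g, hF, hg, hFc, ⟨C, hC⟩, hFg, mg, g2⟩ := exists_profile hn0 hΨ.1.1 hΨ.2
  set ν := multiplier ε Ω Ψ + n * Ω with hν
  have hb : EssBounded Ψ.1 := by
    refine ⟨C, ?_⟩
    filter_upwards [hF, ae_mem_puncturedDisc] with z hz hp
    rw [hz, norm_mode hp.2]
    exact hC _ ⟨norm_pos_iff.2 hp.2, by
      have : ‖z‖ < 1 := by simpa [disc] using hp.1
      exact this.le⟩
  let q : ℝ → ℝ := fun r => (n : ℝ) ^ 2 / r + r * (2 * ‖F r‖ ^ 2 / ε ^ 2 - ν)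
  let k : ℝ → ℂ := fun r => (q r : ℂ) * F r
  have hqc : ContinuousOn q (Set.Ioc 0 1) :=
    (continuousOn_const.div continuousOn_id fun r hr => hr.1.ne').add
      (continuousOn_id.mul (((continuousOn_const.mul (hFc.norm.pow 2)).div_const _).sub
        continuousOn_const))
  have hkc : ContinuousOn k (Set.Ioc 0 1) :=
    (Complex.continuous_ofReal.comp_continuousOn hqc).mul hFc
  -- The solution of `K' = k` with `K(1) = 0`; it remains to identify it with `r g`.
  let K : ℝ → ℂ := fun r => -∫ t in r..1, k t
  have hKc : ContinuousOn K (Set.Ioc 0 1) := (continuousOn_tail hkc).neg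
  have hKd : ∀ r ∈ Set.Ioo (0 : ℝ) 1, HasDerivAt K (k r) r := fun r hr =>
    (hasDerivAt_tail hkc hr).neg.congr_deriv (neg_neg _)
  have lg : LocallyIntegrableOn g (Set.Ioo 0 1) := by
    intro r hr
    have h1 := integrable_of_sq mg g2 (a := r / 2) (by linarith [hr.1]) (by linarith [hr.1, hr.2])
    rw [intervalIntegrable_iff_integrableOn_Ioo_of_le (by linarith [hr.1, hr.2])] at h1
    refine ⟨Set.Ioo (r / 2) 1, mem_nhdsWithin_of_mem_nhds (Ioo_mem_nhds (by linarith [hr.1]) hr.2),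
      h1⟩
  have lrg : LocallyIntegrableOn (fun r : ℝ => (r : ℂ) * g r) (Set.Ioo 0 1) := by
    have := lg.continuousOn_smul isOpen_Ioo.isLocallyClosed (g := fun r : ℝ => (r : ℂ))
      Complex.continuous_ofReal.continuousOn
    simpa using this
  have lK : LocallyIntegrableOn K (Set.Ioo 0 1) :=
    (hKc.mono Set.Ioo_subset_Ioc_self).locallyIntegrableOn measurableSet_Ioo
  -- With `A` the primitive of `B`, the weak equation says `∫ (B r g + A k) = 0`, while `A(0) = 0`
  -- and `K(1) = 0` give `∫ (B K + A k) = 0`. Subtracting, `r g - K` is orthogonal to every `B`. No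
  -- mean-zero condition on `B` is required, which is how the Neumann condition is obtained.
  have key := ae_eq_zero_of_isTest1 (lrg.sub lK) (fun B hB => by
    obtain ⟨a, b, ha, hab, hb1, hB0⟩ := hB.exists_zero_near
    let A : ℝ → ℝ := fun r => ∫ s in (0 : ℝ)..r, B s
    have hAd : ∀ r, HasDerivAt A (B r) r := hB.primitive.2
    have hAc : Continuous A := hB.primitive.1.continuous
    have hA0 : ∀ r, 0 < r → r ≤ a → A r = 0 := by
      intro r hr hra
      have hi : ∫ s in (0 : ℝ)..r, B s = ∫ s in (0 : ℝ)..r, (0 : ℝ) := by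
        apply intervalIntegral.integral_congr_ae
        have : ∀ᵐ s : ℝ, s ≠ a := by simp [ae_iff]
        filter_upwards [this] with s hsa hs
        rw [Set.uIoc_of_le hr.le] at hs
        exact hB0 s fun h => hsa (le_antisymm (hs.2.trans hra) h.1)
      simpa using hi
    have iB := hB.mul_integrable lrg
    have iBK := hB.mul_integrable lK
    have iAk : Integrable (fun r => ((A r : ℝ) : ℂ) * k r) unitMeasure := by
      have h1 : IntegrableOn (fun r => ((A r : ℝ) : ℂ) * k r) (Set.Icc a 1) :=
        ((Complex.continuous_ofReal.comp hAc).continuousOn.mul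
          (hkc.mono fun r hr => ⟨ha.trans_le hr.1, hr.2⟩)).integrableOn_compact isCompact_Icc
      have h2 : IntegrableOn (fun r => ((A r : ℝ) : ℂ) * k r) (Set.Ioc 0 a) :=
        integrableOn_zero.congr_fun (fun r hr => by simp [hA0 r hr.1 hr.2]) measurableSet_Ioc
      refine IntegrableOn.mono_set (h2.union h1) fun r hr => ?_
      rcases le_total r a with h | h
      · exact Or.inl ⟨hr.1, h⟩
      · exact Or.inr ⟨h, hr.2.le⟩
    have weak := weak_radial_equation hΨ hmin hF hg hb hB
    have hcomb : ∫ r in Set.Ioo (0 : ℝ) 1, (((B r : ℝ) : ℂ) * ((r : ℂ) * g r)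
        + ((A r : ℝ) : ℂ) * k r) = 0 := by
      have hI : Integrable (fun r => ((B r : ℝ) : ℂ) * ((r : ℂ) * g r) + ((A r : ℝ) : ℂ) * k r)
          unitMeasure := iB.add iAk
      -- The variational equation only sees real parts; the choices `c = 1` and `c = i` recover the
      -- complex identity.
      have hc : ∀ c : ℂ, (conj c * ∫ r in Set.Ioo (0 : ℝ) 1, (((B r : ℝ) : ℂ) * ((r : ℂ) * g r)
          + ((A r : ℝ) : ℂ) * k r)).re = 0 := by
        intro c
        rw [← integral_const_mul, ← RCLike.re_eq_complex_re, ← integral_re (hI.const_mul _),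
          ← weak c]
        refine setIntegral_congr_fun measurableSet_Ioo fun r hr => ?_
        have hr0 := hr.1.ne'
        have e1 : (conj (g r) * (B r * c)).re = B r * (conj c * g r).re := by
          simp only [Complex.mul_re, Complex.mul_im, Complex.conj_re, Complex.conj_im,
            Complex.ofReal_re, Complex.ofReal_im]
          ring
        have e2 : (conj (F r) * ((A r : ℝ) * c)).re = A r * (conj c * F r).re := by
          simp only [Complex.mul_re, Complex.mul_im, Complex.conj_re, Complex.conj_im,
            Complex.ofReal_re, Complex.ofReal_im]
          ring
        have e3 : conj c * (((B r : ℝ) : ℂ) * ((r : ℂ) * g r) + ((A r : ℝ) : ℂ) * k r)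
            = ((r * B r : ℝ) : ℂ) * (conj c * g r) + ((A r * q r : ℝ) : ℂ) * (conj c * F r) := by
          simp only [k]
          push_cast
          ring
        change (conj c * (((B r : ℝ) : ℂ) * ((r : ℂ) * g r) + ((A r : ℝ) : ℂ) * k r)).re
          = r * ((conj (g r) * (B r * c)).re + _ * (conj (F r) * ((A r : ℝ) * c)).re)
        rw [e1, e2, e3, Complex.add_re, Complex.re_ofReal_mul, Complex.re_ofReal_mul]
        simp only [q]
        rw [← hν]
        field_simp
      have h1 := hc 1
      have h2 := hc Complex.I
      refine Complex.ext (by simpa using h1) ?_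
      simpa using h2
    have ibp : ∫ r in Set.Ioo (0 : ℝ) 1, (((B r : ℝ) : ℂ) * K r + ((A r : ℝ) : ℂ) * k r) = 0 := by
      have hsub : ∫ r in Set.Ioo (0 : ℝ) 1, (((B r : ℝ) : ℂ) * K r + ((A r : ℝ) : ℂ) * k r)
          = ∫ r in a..1, (((B r : ℝ) : ℂ) * K r + ((A r : ℝ) : ℂ) * k r) := by
        rw [intervalIntegral.integral_of_le (by linarith), integral_Ioc_eq_integral_Ioo]
        refine (setIntegral_eq_of_subset_of_forall_sdiff_eq_zero measurableSet_Ioo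
          (Set.Ioo_subset_Ioo_left ha.le) fun r hr => ?_)
        have hra : r ≤ a := by
          by_contra hc
          exact hr.2 ⟨not_le.1 hc, hr.1.2⟩
        rw [hA0 r hr.1.1 hra]
        rcases hra.lt_or_eq with h | h
        · rw [hB0 r fun h' => by linarith [h'.1]]
          simp
        · have : B a = 0 := by
            have h1 : ∀ᶠ s in nhdsWithin a (Set.Iio a), B s = 0 := by
              filter_upwards [self_mem_nhdsWithin] with s hs
              exact hB0 s fun h' => absurd h'.1 (not_le.2 hs)
            have h2 : Filter.Tendsto B (nhdsWithin a (Set.Iio a)) (nhds (B a)) :=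
              hB.smooth.continuous.continuousAt.tendsto.mono_left nhdsWithin_le_nhds
            exact tendsto_nhds_unique h2 ((Filter.tendsto_congr' h1).2 tendsto_const_nhds)
          rw [h, this]
          simp
      rw [hsub, intervalIntegral.integral_eq_sub_of_hasDerivAt_of_le
        (f := fun r => ((A r : ℝ) : ℂ) * K r) (by linarith)]
      · simp [K, hA0 a ha le_rfl]
      · exact (Complex.continuous_ofReal.comp hAc).continuousOn.mul
          (hKc.mono fun r hr => ⟨ha.trans_le hr.1, hr.2⟩)
      · intro r hr
        exact ((hAd r).ofReal_comp).mul (hKd r ⟨ha.trans hr.1, hr.2⟩)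
      · refine ContinuousOn.intervalIntegrable ?_
        rw [Set.uIcc_of_le (by linarith)]
        exact ((Complex.continuous_ofReal.comp hB.smooth.continuous).continuousOn.mul
          (hKc.mono fun r hr => ⟨ha.trans_le hr.1, hr.2⟩)).add
          ((Complex.continuous_ofReal.comp hAc).continuousOn.mul
          (hkc.mono fun r hr => ⟨ha.trans_le hr.1, hr.2⟩))
    simp only [Pi.sub_apply, mul_sub]
    rw [integral_sub iB iBK]
    rw [integral_add iB iAk] at hcomb
    rw [integral_add iBK iAk] at ibp
    linear_combination hcomb - ibp)
  have hgK : ∀ᵐ r ∂unitMeasure, g r = K r / r := by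
    filter_upwards [key, ae_restrict_mem measurableSet_Ioo] with r hr hr1
    have hr0 : (r : ℂ) ≠ 0 := by exact_mod_cast hr1.1.ne'
    rw [eq_div_iff hr0, mul_comm]
    exact sub_eq_zero.1 hr
  have hKr : ContinuousOn (fun r : ℝ => K r / r) (Set.Ioc 0 1) :=
    hKc.div Complex.continuous_ofReal.continuousOn fun r hr => by exact_mod_cast hr.1.ne'
  refine ⟨F, K, ⟨hFc, hKc, by simp [K], fun r hr => ?_, hKd, C, hC⟩, hF, ?_⟩
  · have hFK : ∀ s ∈ Set.Ioo (0 : ℝ) 1, F s = F 1 - ∫ t in s..1, K t / t := by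
      intro s hs
      rw [hFg s, intervalIntegral.integral_of_le hs.2.le, intervalIntegral.integral_of_le hs.2.le,
        integral_Ioc_eq_integral_Ioo, integral_Ioc_eq_integral_Ioo]
      congr 1
      exact integral_congr_ae (ae_restrict_of_ae_restrict_of_subset
        (Set.Ioo_subset_Ioo_left hs.1.le) hgK)
    have h1 := (hasDerivAt_tail hKr hr).const_sub (F 1)
    rw [neg_neg] at h1
    refine h1.congr_of_eventuallyEq ?_
    filter_upwards [isOpen_Ioo.mem_nhds hr] with s hs
    exact hFK s hs
  · filter_upwards [hg, ae_norm_of_ae hgK] with z h1 h2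
    rw [h1, mode, mode, h2]

/-! ### Decay of the profile at the vortex core -/

theorem norm_sub_le_of_deriv_le {E : Type*} [NormedAddCommGroup E] [NormedSpace ℝ E]
    {f f' : ℝ → E} {B B' : ℝ → ℝ} {a b : ℝ} (hab : a ≤ b)
    (hf : ContinuousOn f (Set.Icc a b)) (hf' : ∀ x ∈ Set.Ico a b, HasDerivAt f (f' x) x)
    (hB : ContinuousOn B (Set.Icc a b)) (hB' : ∀ x ∈ Set.Ico a b, HasDerivAt B (B' x) x)
    (bound : ∀ x ∈ Set.Ico a b, ‖f' x‖ ≤ B' x) : ‖f b - f a‖ ≤ B b - B a := by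
  refine image_norm_le_of_norm_deriv_right_le_deriv_boundary' (f := fun x => f x - f a)
    (B := fun x => B x - B a) (hf.sub continuousOn_const)
    (fun x hx => ((hf' x hx).sub_const (f a)).hasDerivWithinAt) (by simp)
    (hB.sub continuousOn_const) (fun x hx => ((hB' x hx).sub_const (B a)).hasDerivWithinAt)
    (fun x hx => bound x hx) ⟨hab, le_rfl⟩

theorem norm_sub_le_of_deriv_le_const {E : Type*} [NormedAddCommGroup E] [NormedSpace ℝ E]
    {f f' : ℝ → E} {M a b : ℝ} (hab : a ≤ b)
    (hf : ContinuousOn f (Set.Icc a b)) (hf' : ∀ x ∈ Set.Ico a b, HasDerivAt f (f' x) x)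
    (bound : ∀ x ∈ Set.Ico a b, ‖f' x‖ ≤ M) : ‖f b - f a‖ ≤ M * (b - a) := by
  have := norm_sub_le_of_deriv_le (B := fun x => M * x) (B' := fun _ => M) hab hf hf'
    (by fun_prop) (fun x _ => by simpa using (hasDerivAt_id x).const_mul M) bound
  rwa [← mul_sub] at this

/-- Serves to let the lower limit of integration tend to the core, where the equation is singular.
-/
theorem le_of_forall_small {x y C r : ℝ} (hr : 0 < r)
    (h : ∀ δ, 0 < δ → δ < r → x ≤ y + C * δ) : x ≤ y := by
  have h1 : Filter.Tendsto (fun δ : ℝ => y + C * δ) (nhdsWithin 0 (Set.Ioi 0)) (nhds (y + C * 0)) :=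
    (Continuous.tendsto (by fun_prop) _).mono_left nhdsWithin_le_nhds
  rw [mul_zero, add_zero] at h1
  refine ge_of_tendsto h1 ?_
  filter_upwards [self_mem_nhdsWithin, mem_nhdsWithin_of_mem_nhds (Iio_mem_nhds hr)] with δ h0 h2
  exact h δ h0 h2

namespace IsVortexProfile

variable {n : ℕ} {ε ν : ℝ} {F K : ℝ → ℂ}

theorem exists_potential_bound (h : IsVortexProfile n ε ν F K) :
    ∃ P, 0 ≤ P ∧ ∀ r ∈ Set.Ioc (0 : ℝ) 1, |2 * ‖F r‖ ^ 2 / ε ^ 2 - ν| ≤ P := by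
  obtain ⟨C, hC⟩ := h.bdd
  refine ⟨2 * C ^ 2 / ε ^ 2 + |ν|, by positivity, fun r hr => ?_⟩
  refine (abs_sub _ _).trans ?_
  rw [abs_of_nonneg (by positivity : 0 ≤ 2 * ‖F r‖ ^ 2 / ε ^ 2)]
  have := hC r hr
  gcongr

/-- A crude bound from integrating `K'`, which is `O(1/r)` on `[r, 1]`, back from `K(1) = 0`. It
only has to exclude the singular solution `r^{-n}` at the core. -/
theorem K_bound (h : IsVortexProfile n ε ν F K) :
    ∃ C, ∀ r ∈ Set.Ioc (0 : ℝ) 1, ‖K r‖ ≤ C / r := by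
  obtain ⟨C, hC⟩ := h.bdd
  obtain ⟨P, hP0, hP⟩ := h.exists_potential_bound
  have hC0 : 0 ≤ C := (norm_nonneg _).trans (hC 1 (by simp))
  refine ⟨((n : ℝ) ^ 2 + P) * C, fun r hr => ?_⟩
  have hr0 : 0 < r := hr.1
  have := norm_sub_le_of_deriv_le_const (M := ((n : ℝ) ^ 2 + P) * C / r) hr.2
    (h.contK.mono fun s hs => ⟨hr0.trans_le hs.1, hs.2⟩)
    (fun s hs => h.derivK s ⟨hr0.trans_le hs.1, hs.2⟩) (fun s hs => by
      have hs0 : 0 < s := hr0.trans_le hs.1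
      have hs1 : s ∈ Set.Ioc (0 : ℝ) 1 := ⟨hs0, hs.2.le⟩
      rw [norm_mul, Complex.norm_real, Real.norm_eq_abs]
      have h1 : |(n : ℝ) ^ 2 / s + s * (2 * ‖F s‖ ^ 2 / ε ^ 2 - ν)| ≤ ((n : ℝ) ^ 2 + P) / r := by
        refine (abs_add_le _ _).trans ?_
        rw [abs_mul, abs_of_pos hs0, abs_of_nonneg (by positivity : 0 ≤ (n : ℝ) ^ 2 / s), add_div]
        have h2 : s * |2 * ‖F s‖ ^ 2 / ε ^ 2 - ν| ≤ 1 * P := by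
          gcongr
          · exact hs.2.le
          · exact hP s hs1
        have h3 : 1 * P ≤ P / r := by
          rw [one_mul, le_div_iff₀ hr0]
          exact mul_le_of_le_one_right hP0 hr.2
        have h4 : (n : ℝ) ^ 2 / s ≤ (n : ℝ) ^ 2 / r := by
          have := hs.1
          gcongr
        linarith
      have h5 := hC s hs1
      calc _ ≤ ((n : ℝ) ^ 2 + P) / r * C := by gcongr
        _ = _ := by ring)
  rw [h.neumann, zero_sub, norm_neg] at this
  refine this.trans ?_
  have h6 : 0 ≤ ((n : ℝ) ^ 2 + P) * C / r := by positivity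
  exact mul_le_of_le_one_right h6 (by linarith)

theorem hasDerivAt_U (h : IsVortexProfile n ε ν F K) {r : ℝ} (hr : r ∈ Set.Ioo (0 : ℝ) 1) :
    HasDerivAt (fun r => K r - n * F r) (-n / r * (K r - n * F r)
      + ((r * (2 * ‖F r‖ ^ 2 / ε ^ 2 - ν) : ℝ) : ℂ) * F r) r := by
  have hr0 : (r : ℂ) ≠ 0 := by exact_mod_cast hr.1.ne'
  refine ((h.derivK r hr).sub ((h.derivF r hr).const_mul (n : ℂ))).congr_deriv ?_
  push_cast
  field_simp
  ring

theorem hasDerivAt_V (h : IsVortexProfile n ε ν F K) {r : ℝ} (hr : r ∈ Set.Ioo (0 : ℝ) 1) :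
    HasDerivAt (fun r => K r + n * F r) (n / r * (K r + n * F r)
      + ((r * (2 * ‖F r‖ ^ 2 / ε ^ 2 - ν) : ℝ) : ℂ) * F r) r := by
  have hr0 : (r : ℂ) ≠ 0 := by exact_mod_cast hr.1.ne'
  refine ((h.derivK r hr).add ((h.derivF r hr).const_mul (n : ℂ))).congr_deriv ?_
  push_cast
  field_simp
  ring

/-- For `U = K - nF` the singular coefficient is removed by an integrating factor: `(rⁿ U)' =
r^{n+1} (2|F|²/ε² - ν) F`. Integrating from the core gains two powers of `r`. -/
theorem U_bound_of_F_bound (h : IsVortexProfile n ε ν F K) (hn : 2 ≤ n) {κ : ℕ}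
    (hF : ∃ C, ∀ r ∈ Set.Ioc (0 : ℝ) 1, ‖F r‖ ≤ C * r ^ κ) :
    ∃ C, ∀ r ∈ Set.Ioc (0 : ℝ) 1, ‖K r - n * F r‖ ≤ C * r ^ (κ + 2) := by
  obtain ⟨C, hC⟩ := hF
  obtain ⟨P, hP0, hP⟩ := h.exists_potential_bound
  obtain ⟨D, hD⟩ := h.K_bound
  obtain ⟨E, hE⟩ := h.bdd
  have hC0 : 0 ≤ C := by
    have := (norm_nonneg _).trans (hC 1 (by simp))
    simpa using this
  have hD0 : 0 ≤ D := by
    have := (norm_nonneg _).trans (hD 1 (by simp))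
    simpa using this
  have hE0 : 0 ≤ E := (norm_nonneg _).trans (hE 1 (by simp))
  refine ⟨P * C, fun r hr => ?_⟩
  have hr0 : 0 < r := hr.1
  let H : ℝ → ℂ := fun r => (r : ℂ) ^ n * (K r - n * F r)
  have hHd : ∀ s ∈ Set.Ioo (0 : ℝ) 1, HasDerivAt H
      (((s ^ (n + 1) * (2 * ‖F s‖ ^ 2 / ε ^ 2 - ν) : ℝ) : ℂ) * F s) s := by
    intro s hs
    have hs0 : (s : ℂ) ≠ 0 := by exact_mod_cast hs.1.ne'
    have h1 : HasDerivAt (fun r : ℝ => (r : ℂ) ^ n) (n * (s : ℂ) ^ (n - 1)) s := by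
      exact (((hasDerivAt_id s).ofReal_comp).pow n).congr_deriv (by simp)
    refine (h1.mul (h.hasDerivAt_U hs)).congr_deriv ?_
    obtain ⟨m, rfl⟩ : ∃ m, n = m + 1 := ⟨n - 1, by omega⟩
    simp only [Nat.add_sub_cancel]
    push_cast
    field_simp
    ring
  have hHc : ContinuousOn H (Set.Ioc 0 1) :=
    (by fun_prop : Continuous fun r : ℝ => (r : ℂ) ^ n).continuousOn.mul
      (h.contK.sub (continuousOn_const.mul h.contF))
  have key : ‖H r‖ ≤ P * C * r ^ (n + κ + 2) := by
    refine le_of_forall_small (C := D + n * E) hr0 fun δ hδ hδr => ?_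
    have hδ1 : δ ≤ 1 := hδr.le.trans hr.2
    have h1 := norm_sub_le_of_deriv_le_const (M := P * C * r ^ (n + κ + 1)) hδr.le
      (hHc.mono fun s hs => ⟨hδ.trans_le hs.1, hs.2.trans hr.2⟩)
      (fun s hs => hHd s ⟨hδ.trans_le hs.1, hs.2.trans_le hr.2⟩) (fun s hs => by
        have hs0 : 0 < s := hδ.trans_le hs.1
        have hs1 : s ∈ Set.Ioc (0 : ℝ) 1 := ⟨hs0, hs.2.le.trans hr.2⟩
        rw [norm_mul, Complex.norm_real, Real.norm_eq_abs, abs_mul, abs_of_pos (pow_pos hs0 _)]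
        have h2 := hP s hs1
        have h3 := hC s hs1
        have h4 : s ≤ r := hs.2.le
        calc s ^ (n + 1) * |2 * ‖F s‖ ^ 2 / ε ^ 2 - ν| * ‖F s‖
            ≤ r ^ (n + 1) * P * (C * s ^ κ) := by gcongr
          _ ≤ r ^ (n + 1) * P * (C * r ^ κ) := by gcongr
          _ = _ := by ring)
    -- No contribution from the core: `|U| ≤ D/δ + nE` there, and `δⁿ ≤ δ²` because `n ≥ 2`.
    have h5 : ‖H δ‖ ≤ (D + n * E) * δ := by
      simp only [H]
      rw [norm_mul, norm_pow, Complex.norm_real, Real.norm_of_nonneg hδ.le]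
      have h6 : ‖K δ - n * F δ‖ ≤ D / δ + n * E := by
        refine (norm_sub_le _ _).trans ?_
        rw [norm_mul, Complex.norm_natCast]
        have := hD δ ⟨hδ, hδ1⟩
        have := hE δ ⟨hδ, hδ1⟩
        gcongr
      have h7 : δ ^ n ≤ δ ^ 2 := pow_le_pow_of_le_one hδ.le hδ1 hn
      have h8 : δ ^ 2 * (D / δ + n * E) = D * δ + n * E * δ ^ 2 := by field_simp
      have h9 : n * E * δ ^ 2 ≤ n * E * δ := by
        gcongr
        nlinarith
      have h10 : δ ^ n * ‖K δ - n * F δ‖ ≤ δ ^ 2 * (D / δ + n * E) := by gcongr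
      linarith
    have h11 : P * C * r ^ (n + κ + 1) * (r - δ) ≤ P * C * r ^ (n + κ + 1) * r := by
      gcongr
      linarith
    have h12 : ‖H r‖ ≤ ‖H δ‖ + ‖H r - H δ‖ := by
      simpa using norm_add_le (H δ) (H r - H δ)
    have e : P * C * r ^ (n + κ + 2) = P * C * r ^ (n + κ + 1) * r := by ring
    linarith
  simp only [H] at key
  rw [norm_mul, norm_pow, Complex.norm_real, Real.norm_of_nonneg hr0.le] at key
  have e : P * C * r ^ (n + κ + 2) = r ^ n * (P * C * r ^ (κ + 2)) := by ring
  rw [e] at key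
  exact le_of_mul_le_mul_left key (pow_pos hr0 n)

theorem hasDerivAt_div_pow (h : IsVortexProfile n ε ν F K) {r : ℝ} (hr : r ∈ Set.Ioo (0 : ℝ) 1) :
    HasDerivAt (fun r : ℝ => F r / (r : ℂ) ^ n) ((K r - n * F r) / (r : ℂ) ^ (n + 1)) r := by
  have hr0 : (r : ℂ) ≠ 0 := by exact_mod_cast hr.1.ne'
  have h1 : HasDerivAt (fun r : ℝ => (r : ℂ) ^ n) (n * (r : ℂ) ^ (n - 1)) r := by
    exact (((hasDerivAt_id r).ofReal_comp).pow n).congr_deriv (by simp)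
  refine ((h.derivF r hr).div h1 (pow_ne_zero n hr0)).congr_deriv ?_
  rcases n with _ | m
  · simp
  · simp only [Nat.add_sub_cancel]
    field_simp
    push_cast
    ring

theorem continuousOn_div_pow (h : IsVortexProfile n ε ν F K) (k : ℕ) :
    ContinuousOn (fun r : ℝ => F r / (r : ℂ) ^ k) (Set.Ioc 0 1) :=
  h.contF.div (by fun_prop : Continuous fun r : ℝ => (r : ℂ) ^ k).continuousOn
    fun r hr => pow_ne_zero k (by exact_mod_cast hr.1.ne')

/-- Integrate `(F/rⁿ)' = U/r^{n+1}` from `r` to `1`. For `τ < n` the integral diverges like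
`r^{τ-n}` at the core, so `F` inherits the exponent of `U`. -/
theorem F_bound_of_U_bound (h : IsVortexProfile n ε ν F K) {τ : ℕ} (hτ : τ < n)
    (hU : ∃ C, ∀ r ∈ Set.Ioc (0 : ℝ) 1, ‖K r - n * F r‖ ≤ C * r ^ τ) :
    ∃ C, ∀ r ∈ Set.Ioc (0 : ℝ) 1, ‖F r‖ ≤ C * r ^ τ := by
  obtain ⟨C, hC⟩ := hU
  have hC0 : 0 ≤ C := by
    have := (norm_nonneg _).trans (hC 1 (by simp))
    simpa using this
  obtain ⟨k, hk, rfl⟩ : ∃ k, 1 ≤ k ∧ n = τ + k := ⟨n - τ, by omega, by omega⟩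
  refine ⟨‖F 1‖ + C, fun r hr => ?_⟩
  have hr0 : 0 < r := hr.1
  -- The comparison function has derivative `Ck/s^{k+1}`, which dominates `C/s^{k+1}` because `k = n
  -- - τ ≥ 1`.
  have h1 := norm_sub_le_of_deriv_le (B := fun s => -C / s ^ k)
    (B' := fun s => C * k / s ^ (k + 1)) hr.2
    ((h.continuousOn_div_pow (τ + k)).mono fun s hs => ⟨hr0.trans_le hs.1, hs.2⟩)
    (fun s hs => h.hasDerivAt_div_pow ⟨hr0.trans_le hs.1, hs.2⟩)
    (continuousOn_const.div (by fun_prop) fun s hs => pow_ne_zero k (hr0.trans_le hs.1).ne')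
    (fun s hs => by
      have hs0 : s ≠ 0 := (hr0.trans_le hs.1).ne'
      refine ((hasDerivAt_const s (-C)).div (hasDerivAt_pow k s) (pow_ne_zero k hs0)).congr_deriv ?_
      obtain ⟨m, rfl⟩ : ∃ m, k = m + 1 := ⟨k - 1, by omega⟩
      simp only [Nat.add_sub_cancel]
      field_simp
      ring)
    (fun s hs => by
      have hs0 : 0 < s := hr0.trans_le hs.1
      rw [norm_div, norm_pow, Complex.norm_real, Real.norm_of_nonneg hs0.le,
        div_le_div_iff₀ (by positivity) (by positivity)]
      have h2 := hC s ⟨hs0, hs.2.le⟩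
      have h3 : (1 : ℝ) ≤ k := by exact_mod_cast hk
      have h4 : C * 1 ≤ C * k := by gcongr
      calc _ ≤ C * s ^ τ * s ^ (k + 1) := by gcongr
        _ = C * 1 * s ^ (τ + k + 1) := by ring
        _ ≤ C * k * s ^ (τ + k + 1) := by gcongr)
  simp only [Complex.ofReal_one, one_pow, div_one] at h1
  have h5 : ‖F r / (r : ℂ) ^ (τ + k)‖ ≤ ‖F 1‖ + C / r ^ k := by
    have h6 : ‖F r / (r : ℂ) ^ (τ + k)‖ ≤ ‖F 1‖ + ‖F 1 - F r / (r : ℂ) ^ (τ + k)‖ := by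
      simpa using norm_sub_le (F 1) (F 1 - F r / (r : ℂ) ^ (τ + k))
    have h7 : -C / r ^ k = -(C / r ^ k) := neg_div _ _
    linarith
  rw [norm_div, norm_pow, Complex.norm_real, Real.norm_of_nonneg hr0.le,
    div_le_iff₀ (by positivity)] at h5
  refine h5.trans ?_
  have h8 : r ^ (τ + k) ≤ r ^ τ := pow_le_pow_of_le_one hr0.le hr.2 (by omega)
  have h9 : (‖F 1‖ + C / r ^ k) * r ^ (τ + k) = ‖F 1‖ * r ^ (τ + k) + C * r ^ τ := by
    field_simp
    ring
  rw [h9, add_mul]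
  gcongr

/-- The end of the bootstrap: now `(F/rⁿ)'` is bounded, so `F/rⁿ` is bounded and the exponent
saturates at `n`. -/
theorem F_bound_of_U_bound' (h : IsVortexProfile n ε ν F K)
    (hU : ∃ C, ∀ r ∈ Set.Ioc (0 : ℝ) 1, ‖K r - n * F r‖ ≤ C * r ^ (n + 1)) :
    ∃ C, ∀ r ∈ Set.Ioc (0 : ℝ) 1, ‖F r‖ ≤ C * r ^ n := by
  obtain ⟨C, hC⟩ := hU
  have hC0 : 0 ≤ C := by
    have := (norm_nonneg _).trans (hC 1 (by simp))
    simpa using this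
  refine ⟨‖F 1‖ + C, fun r hr => ?_⟩
  have hr0 : 0 < r := hr.1
  have h1 := norm_sub_le_of_deriv_le_const (M := C) hr.2
    ((h.continuousOn_div_pow n).mono fun s hs => ⟨hr0.trans_le hs.1, hs.2⟩)
    (fun s hs => h.hasDerivAt_div_pow ⟨hr0.trans_le hs.1, hs.2⟩)
    (fun s hs => by
      have hs0 : 0 < s := hr0.trans_le hs.1
      rw [norm_div, norm_pow, Complex.norm_real, Real.norm_of_nonneg hs0.le,
        div_le_iff₀ (by positivity)]
      exact hC s ⟨hs0, hs.2.le⟩)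
  simp only [Complex.ofReal_one, one_pow, div_one] at h1
  have h5 : ‖F r / (r : ℂ) ^ n‖ ≤ ‖F 1‖ + C := by
    have h6 : ‖F r / (r : ℂ) ^ n‖ ≤ ‖F 1‖ + ‖F 1 - F r / (r : ℂ) ^ n‖ := by
      simpa using norm_sub_le (F 1) (F 1 - F r / (r : ℂ) ^ n)
    have h7 : C * (1 - r) ≤ C := mul_le_of_le_one_right hC0 (by linarith)
    linarith
  rwa [norm_div, norm_pow, Complex.norm_real, Real.norm_of_nonneg hr0.le,
    div_le_iff₀ (by positivity)] at h5

theorem weaken_bound {u : ℝ → ℂ} {i j : ℕ} (hij : j ≤ i)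
    (h : ∃ C, ∀ r ∈ Set.Ioc (0 : ℝ) 1, ‖u r‖ ≤ C * r ^ i) :
    ∃ C, ∀ r ∈ Set.Ioc (0 : ℝ) 1, ‖u r‖ ≤ C * r ^ j := by
  obtain ⟨C, hC⟩ := h
  have hC0 : 0 ≤ C := by
    have := (norm_nonneg _).trans (hC 1 (by simp))
    simpa using this
  exact ⟨C, fun r hr => (hC r hr).trans
    (mul_le_mul_of_nonneg_left (pow_le_pow_of_le_one hr.1.le hr.2 hij) hC0)⟩

/-- The behaviour of the profile near the vortex core. -/
theorem F_bound (h : IsVortexProfile n ε ν F K) (hn : 2 ≤ n) :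
    ∃ C, ∀ r ∈ Set.Ioc (0 : ℝ) 1, ‖F r‖ ≤ C * r ^ (min n 3) := by
  have f0 : ∃ C, ∀ r ∈ Set.Ioc (0 : ℝ) 1, ‖F r‖ ≤ C * r ^ 0 := by simpa using h.bdd
  -- The exponent of `F` is raised one unit at a time, until it reaches `n` or the value `3` that
  -- the destabilizing direction requires.
  have f1 := h.F_bound_of_U_bound (τ := 1) (by omega)
    (weaken_bound (by omega) (h.U_bound_of_F_bound hn f0))
  have u1 := h.U_bound_of_F_bound hn f1
  rcases hn.lt_or_eq with h2 | h2
  · have f2 := h.F_bound_of_U_bound (τ := 2) (by omega) (weaken_bound (by omega) u1)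
    have u2 := h.U_bound_of_F_bound hn f2
    rcases (show 3 ≤ n by omega).lt_or_eq with h3 | h3
    · rw [min_eq_right h3.le]
      exact h.F_bound_of_U_bound (τ := 3) (by omega) (weaken_bound (by omega) u2)
    · rw [← h3]
      subst h3
      exact h.F_bound_of_U_bound' u2
  · subst h2
    exact h.F_bound_of_U_bound' u1

theorem U_bound (h : IsVortexProfile n ε ν F K) (hn : 2 ≤ n) :
    ∃ C, ∀ r ∈ Set.Ioc (0 : ℝ) 1, ‖K r - n * F r‖ ≤ C * r ^ 4 :=
  weaken_bound (by omega) (h.U_bound_of_F_bound hn (h.F_bound hn))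

/-! ### Radial current and the lower bound for the multiplier -/

theorem hasDerivAt_conj_mul (h : IsVortexProfile n ε ν F K) {r : ℝ} (hr : r ∈ Set.Ioo (0 : ℝ) 1) :
    HasDerivAt (fun r => conj (F r) * K r) ((‖K r‖ ^ 2 / r
      + ((n : ℝ) ^ 2 / r + r * (2 * ‖F r‖ ^ 2 / ε ^ 2 - ν)) * ‖F r‖ ^ 2 : ℝ) : ℂ) r := by
  have h1 : HasDerivAt (fun r => conj (F r)) (conj (K r / r)) r := (h.derivF r hr).star
  refine (h1.mul (h.derivK r hr)).congr_deriv ?_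
  have e : ∀ z : ℂ, ((‖z‖ ^ 2 : ℝ) : ℂ) = conj z * z := fun z => by
    rw [← Complex.normSq_eq_norm_sq, Complex.normSq_eq_conj_mul_self]
  rw [map_div₀, Complex.conj_ofReal]
  have e1 := e (K r)
  have e2 := e (F r)
  push_cast at e1 e2 ⊢
  rw [e1, e2]
  ring

theorem continuousOn_conj_mul (h : IsVortexProfile n ε ν F K) :
    ContinuousOn (fun r => conj (F r) * K r) (Set.Ioc 0 1) :=
  (Complex.continuous_conj.comp_continuousOn h.contF).mul h.contK

/-- There is no radial current. -/
theorem im_conj_mul (h : IsVortexProfile n ε ν F K) {r : ℝ} (hr : r ∈ Set.Ioc (0 : ℝ) 1) :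
    (conj (F r) * K r).im = 0 := by
  have h1 := norm_sub_le_of_deriv_le_const (E := ℝ) (M := 0)
    (f := fun r => (conj (F r) * K r).im) (f' := fun _ => 0) hr.2
    (Complex.continuous_im.comp_continuousOn (h.continuousOn_conj_mul.mono
      fun s hs => ⟨hr.1.trans_le hs.1, hs.2⟩))
    (fun s hs => by
      -- The derivative of `conj F · K` is real, so its imaginary part is constant, and it is zero
      -- at `r = 1` by the Neumann condition.
      have := (h.hasDerivAt_conj_mul (r := s) ⟨hr.1.trans_le hs.1, hs.2⟩)
      have h2 := Complex.imCLM.hasFDerivAt.comp_hasDerivAt s this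
      refine h2.congr_deriv ?_
      rw [Complex.imCLM_apply, Complex.ofReal_im])
    (fun s _ => by simp)
  rw [h.neumann, mul_zero, Complex.zero_im, zero_mul, zero_sub, norm_neg] at h1
  exact norm_le_zero_iff.1 h1

theorem hasDerivAt_norm_sq (h : IsVortexProfile n ε ν F K) {r : ℝ} (hr : r ∈ Set.Ioo (0 : ℝ) 1) :
    HasDerivAt (fun r => ‖F r‖ ^ 2) (2 * (conj (F r) * K r).re / r) r := by
  refine (h.derivF r hr).norm_sq.congr_deriv ?_
  have e : K r / r * conj (F r) = (conj (F r) * K r) / (r : ℝ) := by ring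
  rw [Complex.inner, e, Complex.div_ofReal_re]
  ring

theorem hasDerivAt_re_conj_mul (h : IsVortexProfile n ε ν F K) {r : ℝ}
    (hr : r ∈ Set.Ioo (0 : ℝ) 1) :
    HasDerivAt (fun r => (conj (F r) * K r).re) (‖K r‖ ^ 2 / r
      + ((n : ℝ) ^ 2 / r + r * (2 * ‖F r‖ ^ 2 / ε ^ 2 - ν)) * ‖F r‖ ^ 2) r := by
  have h2 := Complex.reCLM.hasFDerivAt.comp_hasDerivAt r (h.hasDerivAt_conj_mul hr)
  exact h2.congr_deriv (Complex.ofReal_re _)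

/-- The density attains its maximum, and there the radial equation bounds the multiplier. -/
theorem exists_max (h : IsVortexProfile n ε ν F K) (hn : 2 ≤ n)
    (hF : ∃ r ∈ Set.Ioc (0 : ℝ) 1, F r ≠ 0) :
    ∃ S, 0 < S ∧ (∀ r ∈ Set.Ioc (0 : ℝ) 1, ‖F r‖ ^ 2 ≤ S) ∧
      (∃ r ∈ Set.Ioc (0 : ℝ) 1, ‖F r‖ ^ 2 = S) ∧ (n : ℝ) ^ 2 + 2 * S / ε ^ 2 ≤ ν := by
  obtain ⟨r₁, hr₁, hF₁⟩ := hF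
  have hpos : 0 < ‖F r₁‖ := norm_pos_iff.2 hF₁
  obtain ⟨C, hC⟩ := weaken_bound (j := 1) (by omega) (h.F_bound hn)
  have hC0 : 0 ≤ C := by
    have := (norm_nonneg _).trans (hC 1 (by simp))
    simpa using this
  -- Below `δ` the bound `|F| ≤ C r` keeps the density under its value at `r₁`, so the maximum over
  -- the compact interval `[δ, 1]` is global.
  obtain ⟨δ, hδ0, hδr, hδ⟩ : ∃ δ, 0 < δ ∧ δ ≤ r₁ ∧ C * δ ≤ ‖F r₁‖ := by
    refine ⟨min r₁ (‖F r₁‖ / (C + 1)), lt_min hr₁.1 (by positivity), min_le_left _ _, ?_⟩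
    calc C * min r₁ (‖F r₁‖ / (C + 1)) ≤ (C + 1) * (‖F r₁‖ / (C + 1)) := by
          exact mul_le_mul (by linarith) (min_le_right _ _) (le_min hr₁.1.le (by positivity))
            (by linarith)
      _ = ‖F r₁‖ := by field_simp
  have hsub : Set.Icc δ 1 ⊆ Set.Ioc 0 1 := fun s hs => ⟨hδ0.trans_le hs.1, hs.2⟩
  obtain ⟨r₀, hr₀, hmax⟩ := isCompact_Icc.exists_isMaxOn
    ⟨r₁, hδr, hr₁.2⟩ ((h.contF.mono hsub).norm.pow 2)
  have hr₀' := hsub hr₀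
  have h01 : ‖F r₁‖ ^ 2 ≤ ‖F r₀‖ ^ 2 := hmax (show r₁ ∈ Set.Icc δ 1 from ⟨hδr, hr₁.2⟩)
  have hglob : ∀ r ∈ Set.Ioc (0 : ℝ) 1, ‖F r‖ ^ 2 ≤ ‖F r₀‖ ^ 2 := by
    intro r hr
    by_cases hrδ : δ ≤ r
    · exact hmax (show r ∈ Set.Icc δ 1 from ⟨hrδ, hr.2⟩)
    · refine le_trans ?_ h01
      have h1 := hC r hr
      rw [pow_one] at h1
      have h2 : C * r ≤ C * δ := by
        gcongr
        exact (not_le.1 hrδ).le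
      gcongr
      linarith
  have hS : 0 < ‖F r₀‖ ^ 2 := lt_of_lt_of_le (by positivity) h01
  refine ⟨‖F r₀‖ ^ 2, hS, hglob, ⟨r₀, hr₀', rfl⟩, ?_⟩
  -- An interior maximum is critical, and at the endpoint `r₀ = 1` the Neumann condition gives the
  -- same conclusion.
  have hy0 : (conj (F r₀) * K r₀).re = 0 := by
    rcases hr₀'.2.lt_or_eq with h1 | h1
    · have hr₀'' : r₀ ∈ Set.Ioo (0 : ℝ) 1 := ⟨hr₀'.1, h1⟩
      have hloc : IsLocalMax (fun r => ‖F r‖ ^ 2) r₀ := by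
        filter_upwards [isOpen_Ioo.mem_nhds hr₀''] with s hs
        exact hglob s ⟨hs.1, hs.2.le⟩
      have := hloc.hasDerivAt_eq_zero (h.hasDerivAt_norm_sq hr₀'')
      rw [div_eq_zero_iff] at this
      rcases this with h2 | h2
      · linarith
      · exact absurd h2 hr₀'.1.ne'
    · rw [h1, h.neumann]
      simp
  let Q : ℝ → ℝ := fun r => ((n : ℝ) ^ 2 / r + r * (2 * ‖F r‖ ^ 2 / ε ^ 2 - ν)) * ‖F r‖ ^ 2
  have hQc : ContinuousOn Q (Set.Ioc 0 1) :=
    ((continuousOn_const.div continuousOn_id fun r hr => hr.1.ne').add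
      (continuousOn_id.mul (((continuousOn_const.mul (h.contF.norm.pow 2)).div_const _).sub
        continuousOn_const))).mul (h.contF.norm.pow 2)
  -- A one-sided second-derivative test, valid also at `r₀ = 1`. If `Q(r₀) > 0` then `Re(conj F ·
  -- K)` increases to zero at `r₀`, so the density decreases strictly on the left of its maximum.
  have hQ : Q r₀ ≤ 0 := by
    by_contra hc
    have hc' : 0 < Q r₀ := not_le.1 hc
    have hev : ∀ᶠ s in nhdsWithin r₀ (Set.Ioc 0 1), 0 < Q s :=
      (hQc r₀ hr₀').eventually (lt_mem_nhds hc')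
    obtain ⟨U, hU, hUsub⟩ := mem_nhdsWithin_iff_exists_mem_nhds_inter.1 hev
    obtain ⟨η, hη, hball⟩ := Metric.mem_nhds_iff.1 hU
    set a := max (r₀ / 2) (r₀ - η / 2) with ha
    have ha0 : 0 < a := lt_of_lt_of_le (by linarith [hr₀'.1]) (le_max_left _ _)
    have har : a < r₀ := max_lt (by linarith [hr₀'.1]) (by linarith)
    have hQpos : ∀ s ∈ Set.Icc a r₀, 0 < Q s := by
      intro s hs
      refine hUsub ⟨hball ?_, ha0.trans_le hs.1, hs.2.trans hr₀'.2⟩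
      rw [Metric.mem_ball, Real.dist_eq, abs_lt]
      have := le_max_right (r₀ / 2) (r₀ - η / 2)
      constructor <;> linarith [hs.1, hs.2]
    have hsub2 : Set.Icc a r₀ ⊆ Set.Ioc 0 1 := fun s hs => ⟨ha0.trans_le hs.1, hs.2.trans hr₀'.2⟩
    have hin : ∀ s ∈ interior (Set.Icc a r₀), s ∈ Set.Ioo (0 : ℝ) 1 ∧ s ∈ Set.Ioo a r₀ := by
      intro s hs
      rw [interior_Icc] at hs
      exact ⟨⟨ha0.trans hs.1, hs.2.trans_le hr₀'.2⟩, hs⟩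
    have mono : StrictMonoOn (fun r => (conj (F r) * K r).re) (Set.Icc a r₀) := by
      refine strictMonoOn_of_deriv_pos (convex_Icc _ _)
        (Complex.continuous_re.comp_continuousOn (h.continuousOn_conj_mul.mono hsub2)) ?_
      intro s hs
      obtain ⟨h1, h2⟩ := hin s hs
      rw [(h.hasDerivAt_re_conj_mul h1).deriv]
      have h3 := hQpos s ⟨h2.1.le, h2.2.le⟩
      have h4 : 0 ≤ ‖K s‖ ^ 2 / s := div_nonneg (sq_nonneg _) h1.1.le
      simp only [Q] at h3
      linarith
    have anti : StrictAntiOn (fun r => ‖F r‖ ^ 2) (Set.Icc a r₀) := by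
      refine strictAntiOn_of_deriv_neg (convex_Icc _ _) ((h.contF.mono hsub2).norm.pow 2) ?_
      intro s hs
      obtain ⟨h1, h2⟩ := hin s hs
      rw [(h.hasDerivAt_norm_sq h1).deriv]
      have h3 := mono ⟨h2.1.le, h2.2.le⟩ ⟨har.le, le_rfl⟩ h2.2
      simp only [hy0] at h3
      exact div_neg_of_neg_of_pos (by linarith) h1.1
    have h5 := anti ⟨le_rfl, har.le⟩ ⟨har.le, le_rfl⟩ har
    exact absurd (hglob a ⟨ha0, har.le.trans hr₀'.2⟩) (not_le.2 h5)
  have h6 : (n : ℝ) ^ 2 / r₀ + r₀ * (2 * ‖F r₀‖ ^ 2 / ε ^ 2 - ν) ≤ 0 := by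
    by_contra hc
    exact absurd hQ (not_le.2 (mul_pos (not_le.1 hc) hS))
  have hr00 := hr₀'.1
  -- Here `r₀ ≤ 1` replaces the centrifugal term `n²/r₀²` by `n²`.
  have h7 : (n : ℝ) ^ 2 * r₀ ≤ (n : ℝ) ^ 2 / r₀ := by
    rw [le_div_iff₀ hr00]
    have : r₀ * r₀ ≤ 1 := by nlinarith [hr₀'.2]
    calc (n : ℝ) ^ 2 * r₀ * r₀ = (n : ℝ) ^ 2 * (r₀ * r₀) := by ring
      _ ≤ (n : ℝ) ^ 2 * 1 := by gcongr
      _ = _ := mul_one _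
  have h8 : r₀ * ((n : ℝ) ^ 2 + 2 * ‖F r₀‖ ^ 2 / ε ^ 2) ≤ r₀ * ν := by linarith
  exact le_of_mul_le_mul_left h8 hr00

end IsVortexProfile

/-! ### Fourier calculus for the modes `n ± 2` and the second variation -/

theorem mode_rotate {c : ℂ} (hc : ‖c‖ = 1) (k : ℤ) (η : ℝ → ℂ) (z : ℂ) :
    mode k η (c * z) = c ^ k * mode k η z := by
  simp only [mode, norm_mul, hc, one_mul, mul_div_assoc, mul_zpow]
  ring

/-- The rotation by `π/k` preserves the disc and changes the sign of the integrand. No integrability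
of `η` is needed. -/
theorem integral_re_mode_eq_zero {k : ℤ} (hk : k ≠ 0) (η : ℝ → ℂ) :
    ∫ z in disc, (mode k η z).re = 0 := by
  have hc : rot (Real.pi / k) ^ k = -1 := by
    have hk' : (k : ℂ) ≠ 0 := by exact_mod_cast hk
    rw [rot, ← Complex.exp_int_mul, ← Complex.exp_pi_mul_I]
    congr 1
    push_cast
    field_simp
  have h := integral_disc_rotate (fun z => (((mode k η z).re : ℝ) : ℂ)) (norm_rot (Real.pi / k))
  have e : ∀ z, (mode k η (rot (Real.pi / k) * z)).re = -(mode k η z).re := fun z => by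
    rw [mode_rotate (norm_rot _), hc, neg_one_mul, Complex.neg_re]
  simp only [e, integral_complex_ofReal, integral_neg] at h
  have h' := Complex.ofReal_injective h
  linarith

/-- The sum of the two modes adjacent to `e^{inθ}` at distance two. -/
def modePair (n : ℕ) (A B : ℝ → ℂ) (z : ℂ) : ℂ := mode (n + 2) A z + mode (n - 2) B z

theorem conj_direction_mul {z : ℂ} (hz : z ≠ 0) (k : ℤ) :
    conj ((z / (‖z‖ : ℂ)) ^ k) * (z / (‖z‖ : ℂ)) ^ k = 1 := by
  rw [← Complex.normSq_eq_conj_mul_self, Complex.normSq_eq_norm_sq, norm_direction_zpow hz]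
  simp

theorem modePair_eq {z : ℂ} (hz : z ≠ 0) (n : ℕ) (A B : ℝ → ℂ) :
    modePair n A B z = (z / (‖z‖ : ℂ)) ^ (n : ℤ) * (A ‖z‖ * (z / (‖z‖ : ℂ)) ^ (2 : ℤ)
      + B ‖z‖ * conj ((z / (‖z‖ : ℂ)) ^ (2 : ℤ))) := by
  have h0 : z / (‖z‖ : ℂ) ≠ 0 := div_ne_zero hz (by simpa using hz)
  have h2 := conj_direction_mul hz 2
  have h3 : conj ((z / (‖z‖ : ℂ)) ^ (2 : ℤ)) = (z / (‖z‖ : ℂ)) ^ (-2 : ℤ) := by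
    rw [zpow_neg]
    exact eq_inv_of_mul_eq_one_left h2
  rw [h3, modePair, mode, mode, zpow_add₀ h0, sub_eq_add_neg, zpow_add₀ h0]
  ring

/-- The product contains the phases `e^{2iθ}` and `e^{-2iθ}`; conjugating the second does not change
its real part and merges it with the first. -/
theorem re_conj_mode_mul_modePair {z : ℂ} (hz : z ≠ 0) (n : ℕ) (F A B : ℝ → ℂ) :
    (conj (mode n F z) * modePair n A B z).re
      = (mode 2 (fun r => conj (F r) * A r + F r * conj (B r)) z).re := by
  have h1 := conj_direction_mul hz n
  rw [modePair_eq hz, mode, mode, map_mul]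
  generalize (z / (‖z‖ : ℂ)) ^ (n : ℤ) = u at *
  generalize (z / (‖z‖ : ℂ)) ^ (2 : ℤ) = q at *
  have e : conj (F ‖z‖) * conj u * (u * (A ‖z‖ * q + B ‖z‖ * conj q))
      = conj (F ‖z‖) * A ‖z‖ * q + conj (F ‖z‖) * B ‖z‖ * conj q := by
    linear_combination (conj (F ‖z‖) * (A ‖z‖ * q + B ‖z‖ * conj q)) * h1
  rw [e, add_mul, Complex.add_re, Complex.add_re, ← Complex.conj_re (conj (F ‖z‖) * _ * conj q)]
  simp only [map_mul, Complex.conj_conj]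

theorem re_conj_modePair_mul_modePair {z : ℂ} (hz : z ≠ 0) (n : ℕ) (A B C D : ℝ → ℂ) :
    (conj (modePair n A B z) * modePair n C D z).re
      = (conj (A ‖z‖) * C ‖z‖).re + (conj (B ‖z‖) * D ‖z‖).re
        + (mode 4 (fun r => A r * conj (D r) + conj (B r) * C r) z).re := by
  have h0 : z / (‖z‖ : ℂ) ≠ 0 := div_ne_zero hz (by simpa using hz)
  have h1 := conj_direction_mul hz n
  have h2 := conj_direction_mul hz 2
  have h4 : (z / (‖z‖ : ℂ)) ^ (4 : ℤ) = (z / (‖z‖ : ℂ)) ^ (2 : ℤ) * (z / (‖z‖ : ℂ)) ^ (2 : ℤ) := by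
    rw [← zpow_add₀ h0]; rfl
  rw [modePair_eq hz, modePair_eq hz, mode, h4]
  generalize (z / (‖z‖ : ℂ)) ^ (n : ℤ) = u at *
  generalize (z / (‖z‖ : ℂ)) ^ (2 : ℤ) = q at *
  generalize A ‖z‖ = A
  generalize B ‖z‖ = B
  generalize C ‖z‖ = C
  generalize D ‖z‖ = D
  have e : conj (u * (A * q + B * conj q)) * (u * (C * q + D * conj q))
      = conj A * C + conj B * D + (conj (A * conj D * (q * q)) + conj B * C * (q * q)) := by
    simp only [map_mul, map_add, Complex.conj_conj]
    linear_combination (conj A * conj q + conj B * q) * (C * q + D * conj q) * h1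
      + (conj A * C + conj B * D) * h2
  rw [e, add_mul]
  simp only [Complex.add_re, Complex.conj_re]

/-- The double-angle formula for `cos² 2θ`, used to average the quartic part of the second
variation. -/
theorem re_mode_two_sq {z : ℂ} (hz : z ≠ 0) (g : ℝ → ℝ) :
    (mode 2 (fun r => (g r : ℂ)) z).re ^ 2
      = g ‖z‖ ^ 2 / 2 + (mode 4 (fun r => ((g r ^ 2 / 2 : ℝ) : ℂ)) z).re := by
  have h0 : z / (‖z‖ : ℂ) ≠ 0 := div_ne_zero hz (by simpa using hz)
  have h2 := conj_direction_mul hz 2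
  have h4 : (z / (‖z‖ : ℂ)) ^ (4 : ℤ) = (z / (‖z‖ : ℂ)) ^ (2 : ℤ) * (z / (‖z‖ : ℂ)) ^ (2 : ℤ) := by
    rw [← zpow_add₀ h0]; rfl
  rw [mode, mode, h4, Complex.re_ofReal_mul, Complex.re_ofReal_mul]
  generalize (z / (‖z‖ : ℂ)) ^ (2 : ℤ) = q at *
  have h5 := congrArg Complex.re h2
  simp only [Complex.mul_re, Complex.conj_re, Complex.conj_im, Complex.one_re] at h5 ⊢
  linear_combination (g ‖z‖ ^ 2 / 2) * h5

/-- `W` is the triple of `A(r) e^{i(n+2)θ} + B(r) e^{i(n-2)θ}`. -/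
structure IsModePair (n : ℕ) (A A' B B' : ℝ → ℂ) (W : Triple) : Prop where
  value : ∀ᵐ z ∂discMeasure, W.1 z = modePair n A B z
  radial : ∀ᵐ z ∂discMeasure, radialDeriv W z = modePair n A' B' z
  angular : ∀ᵐ z ∂discMeasure, angularMomentum W z
    = modePair n (fun r => ((n + 2 : ℝ) : ℂ) * A r) (fun r => ((n - 2 : ℝ) : ℂ) * B r) z

theorem radialDeriv_add_smul (t : ℝ) (Φ W : Triple) :
    ∀ᵐ z ∂discMeasure, radialDeriv (Φ + t • W) z = radialDeriv Φ z + t * radialDeriv W z := by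
  filter_upwards [coeFn_add_smul t Φ.2.1 W.2.1, coeFn_add_smul t Φ.2.2 W.2.2] with z h1 h2
  unfold radialDeriv
  have e1 : (Φ + t • W).2.1 z = Φ.2.1 z + t * W.2.1 z := h1
  have e2 : (Φ + t • W).2.2 z = Φ.2.2 z + t * W.2.2 z := h2
  rw [e1, e2]
  ring

theorem isModePair_add {n : ℕ} {A A' B B' : ℝ → ℂ} {W₁ W₂ : Triple}
    (h₁ : IsMode (n + 2) A A' W₁) (h₂ : IsMode (n - 2) B B' W₂) :
    IsModePair n A A' B B' (W₁ + (1 : ℝ) • W₂) := by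
  refine ⟨?_, ?_, ?_⟩
  · filter_upwards [h₁.1, h₂.1, coeFn_add_smul 1 W₁.1 W₂.1] with z e1 e2 e3
    have e3' : (W₁ + (1 : ℝ) • W₂).1 z = W₁.1 z + ((1 : ℝ) : ℂ) * W₂.1 z := e3
    rw [e3', e1, e2, modePair, Complex.ofReal_one, one_mul]
  · filter_upwards [h₁.radialDeriv_eq, h₂.radialDeriv_eq, radialDeriv_add_smul 1 W₁ W₂]
      with z e1 e2 e3
    rw [e3, e1, e2, modePair, Complex.ofReal_one, one_mul]
  · filter_upwards [h₁.angularMomentum_eq, h₂.angularMomentum_eq, angularMomentum_add_smul 1 W₁ W₂]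
      with z e1 e2 e3
    rw [e3, e1, e2, modePair, mode, mode, mode, mode]
    push_cast
    ring

section variation

variable {n : ℕ} {F D A A' B B' : ℝ → ℂ} {Ψ W : Triple} {Ω ε μ : ℝ}

theorem ae_re_conj_mul (hF : ∀ᵐ z ∂discMeasure, Ψ.1 z = mode n F z)
    (hW : IsModePair n A A' B B' W) :
    ∀ᵐ z ∂discMeasure, (conj (Ψ.1 z) * W.1 z).re
      = (mode 2 (fun r => conj (F r) * A r + F r * conj (B r)) z).re := by
  filter_upwards [hF, hW.value, ae_mem_puncturedDisc] with z h1 h2 hz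
  rw [h1, h2, re_conj_mode_mul_modePair hz.2]

theorem integral_re_conj_mul_eq_zero (hF : ∀ᵐ z ∂discMeasure, Ψ.1 z = mode n F z)
    (hW : IsModePair n A A' B B' W) : ∫ z in disc, (conj (Ψ.1 z) * W.1 z).re = 0 := by
  rw [integral_congr_ae (ae_re_conj_mul hF hW)]
  exact integral_re_mode_eq_zero (by norm_num) _

theorem integral_norm_sq_mul_re_eq_zero (hF : ∀ᵐ z ∂discMeasure, Ψ.1 z = mode n F z)
    (hW : IsModePair n A A' B B' W) :
    ∫ z in disc, 4 * ‖Ψ.1 z‖ ^ 2 * (conj (Ψ.1 z) * W.1 z).re = 0 := by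
  rw [← integral_re_mode_eq_zero (k := 2) (by norm_num)
    fun r => ((4 * ‖F r‖ ^ 2 : ℝ) : ℂ) * (conj (F r) * A r + F r * conj (B r))]
  apply integral_congr_ae
  filter_upwards [hF, ae_re_conj_mul hF hW, ae_mem_puncturedDisc] with z h1 h2 hz
  rw [h2, h1, norm_mode hz.2, mode, mode, ← Complex.re_ofReal_mul, mul_assoc (Complex.ofReal _)]

/-- In polar form each term pairs the mode `n` with the modes `n ± 2`, so the density is the real
part of a function of mode `2`. -/
theorem crossForm_modePair_eq_zero (hF : ∀ᵐ z ∂discMeasure, Ψ.1 z = mode n F z)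
    (hD : ∀ᵐ z ∂discMeasure, radialDeriv Ψ z = mode n D z)
    (hL : ∀ᵐ z ∂discMeasure, angularMomentum Ψ z = n * Ψ.1 z)
    (hW : IsModePair n A A' B B' W) : crossForm Ω Ψ W = 0 := by
  let G₁ : ℝ → ℂ := fun r => conj (D r) * A' r + D r * conj (B' r)
  let G : (ℝ → ℂ) → (ℝ → ℂ) → ℝ → ℂ := fun A B r => conj (F r) * A r + F r * conj (B r)
  let G₂ := G (fun r => ((n + 2 : ℝ) : ℂ) * A r) (fun r => ((n - 2 : ℝ) : ℂ) * B r)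
  rw [crossForm, ← integral_re_mode_eq_zero (k := 2) (by norm_num) fun r =>
    G₁ r + ((n / r ^ 2 : ℝ) : ℂ) * G₂ r - ((Ω / 2 : ℝ) : ℂ) * (G₂ r + ((n : ℝ) : ℂ) * G A B r)]
  apply integral_congr_ae
  filter_upwards [hF, hD, hL, hW.value, hW.radial, hW.angular, ae_mem_puncturedDisc]
    with z h1 h2 h3 h4 h5 h6 hz
  rw [crossDensity_eq_polar Ω Ψ W hz.2, h3, h2, h4, h5, h6, h1]
  have e1 := re_conj_mode_mul_modePair hz.2 n D A' B'
  have e2 := re_conj_mode_mul_modePair hz.2 n F (fun r => ((n + 2 : ℝ) : ℂ) * A r)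
    (fun r => ((n - 2 : ℝ) : ℂ) * B r)
  have e3 := re_conj_mode_mul_modePair hz.2 n F A B
  generalize modePair n (fun r => ((n + 2 : ℝ) : ℂ) * A r) (fun r => ((n - 2 : ℝ) : ℂ) * B r) z = x
    at *
  generalize modePair n A B z = y at *
  have e4 : (conj ((n : ℂ) * mode n F z) * x).re = n * (conj (mode n F z) * x).re := by
    rw [← Complex.re_ofReal_mul, map_mul, Complex.conj_natCast, mul_assoc, Complex.ofReal_natCast]
  have e5 : (conj y * ((n : ℂ) * mode n F z)).re = n * (conj (mode n F z) * y).re := by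
    rw [← Complex.re_ofReal_mul, ← Complex.conj_re]
    simp only [map_mul, Complex.conj_conj, Complex.conj_natCast, Complex.ofReal_natCast]
    ring_nf
  rw [Complex.add_re, e4, e5, e1, e2, e3]
  simp only [mode]
  generalize (z / (‖z‖ : ℂ)) ^ (2 : ℤ) = q at *
  change _ = ((G₁ ‖z‖ + _ * G₂ ‖z‖ - _ * (G₂ ‖z‖ + _ * G A B ‖z‖)) * q).re
  change (G₁ ‖z‖ * q).re + n * (G₂ ‖z‖ * q).re / ‖z‖ ^ 2
    - Ω / 2 * ((G₂ ‖z‖ * q).re + n * (G A B ‖z‖ * q).re) = _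
  generalize G₁ ‖z‖ = g₁
  generalize G₂ ‖z‖ = g₂
  generalize G A B ‖z‖ = g₃
  have e6 : (g₁ + ((n / ‖z‖ ^ 2 : ℝ) : ℂ) * g₂ - ((Ω / 2 : ℝ) : ℂ) * (g₂ + ((n : ℝ) : ℂ) * g₃)) * q
      = g₁ * q + ((n / ‖z‖ ^ 2 : ℝ) : ℂ) * (g₂ * q)
        - ((Ω / 2 : ℝ) : ℂ) * (g₂ * q + ((n : ℝ) : ℂ) * (g₃ * q)) := by ring
  rw [e6]
  simp only [Complex.sub_re, Complex.add_re, Complex.re_ofReal_mul]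
  ring

/-- The angular average of the density of the second variation. -/
def radialVariation (n : ℕ) (ε Ω μ : ℝ) (F A A' B B' : ℝ → ℂ) (g : ℝ → ℝ) (r : ℝ) : ℝ :=
  ‖A' r‖ ^ 2 + ‖B' r‖ ^ 2 + ((n + 2) ^ 2 * ‖A r‖ ^ 2 + (n - 2) ^ 2 * ‖B r‖ ^ 2) / r ^ 2
    - Ω * ((n + 2) * ‖A r‖ ^ 2 + (n - 2) * ‖B r‖ ^ 2)
    + (2 * ‖F r‖ ^ 2 * (‖A r‖ ^ 2 + ‖B r‖ ^ 2) + 2 * g r ^ 2) / ε ^ 2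
    - μ * (‖A r‖ ^ 2 + ‖B r‖ ^ 2)

/-- The density of the second variation differs from its angular average by the real part of a
function of mode `4`, coming from the interaction of `n + 2` with `n - 2`, and this integrates to
zero. That `conj F · A + F · conj B` is real makes the square of `Re(conj Ψ · W)` explicit. -/
theorem second_variation_eq (hb : EssBounded Ψ.1) (hbW : EssBounded W.1)
    (hF : ∀ᵐ z ∂discMeasure, Ψ.1 z = mode n F z) (hW : IsModePair n A A' B B' W)
    {g : ℝ → ℝ} (hg : ∀ r ∈ Set.Ioo (0 : ℝ) 1, conj (F r) * A r + F r * conj (B r) = g r)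
    (hi : Integrable (fun r => r • radialVariation n ε Ω μ F A A' B B' g r) unitMeasure) :
    crossForm Ω W W
      + (∫ z in disc, (2 * ‖Ψ.1 z‖ ^ 2 * ‖W.1 z‖ ^ 2 + 4 * (conj (Ψ.1 z) * W.1 z).re ^ 2)) / ε ^ 2
      - μ * ‖W.1‖ ^ 2
      = 2 * Real.pi * ∫ r in Set.Ioo (0 : ℝ) 1, r * radialVariation n ε Ω μ F A A' B B' g r := by
  obtain ⟨C, hC⟩ := hb
  obtain ⟨D, hD⟩ := hbW
  have mu := Lp.aestronglyMeasurable Ψ.1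
  have mw := Lp.aestronglyMeasurable W.1
  have mr : AEStronglyMeasurable (fun z => (conj (Ψ.1 z) * W.1 z).re) discMeasure :=
    (l2_mul_integrable (Lp.memLp Ψ.1) (Lp.memLp W.1)).aestronglyMeasurable
  have i2 : Integrable (fun z => 2 * ‖Ψ.1 z‖ ^ 2 * ‖W.1 z‖ ^ 2
      + 4 * (conj (Ψ.1 z) * W.1 z).re ^ 2) discMeasure := by
    refine bounded_integrable (C := 2 * C ^ 2 * D ^ 2 + 4 * (C * D) ^ 2)
      ((((mu.norm.pow 2).const_mul 2).mul (mw.norm.pow 2)).add ((mr.pow 2).const_mul 4)) ?_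
    filter_upwards [hC, hD] with z h1 h2
    have h3 : |(conj (Ψ.1 z) * W.1 z).re| ≤ C * D := by
      refine (Complex.abs_re_le_norm _).trans ?_
      rw [norm_mul, RCLike.norm_conj]
      exact mul_le_mul h1 h2 (norm_nonneg _) ((norm_nonneg _).trans h1)
    rw [abs_of_nonneg (by positivity), ← sq_abs (conj (Ψ.1 z) * W.1 z).re]
    gcongr
  have i3 : Integrable (fun z => ‖W.1 z‖ ^ 2) discMeasure :=
    (Lp.memLp W.1).integrable_norm_pow (by norm_num)
  have i1 := crossDensity_integrable Ω W W
  have iT : Integrable (fun z => radialVariation n ε Ω μ F A A' B B' g ‖z‖) discMeasure :=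
    (integrable_disc_radial _).2 hi
  have hT := integral_disc_radial (radialVariation n ε Ω μ F A A' B B' g)
  simp only [smul_eq_mul] at hT
  rw [← hT, crossForm, norm_sq_eq_integral, ← integral_div, ← integral_const_mul,
    ← integral_add i1 (i2.div_const _),
    ← integral_sub (by exact i1.add (i2.div_const _)) (i3.const_mul _), ← sub_eq_zero,
    ← integral_sub (by exact (i1.add (i2.div_const _)).sub (i3.const_mul _)) iT]
  let P : (ℝ → ℂ) → (ℝ → ℂ) → (ℝ → ℂ) → (ℝ → ℂ) → ℝ → ℂ := fun A B C D r =>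
    A r * conj (D r) + conj (B r) * C r
  let LA : ℝ → ℂ := fun r => ((n + 2 : ℝ) : ℂ) * A r
  let LB : ℝ → ℂ := fun r => ((n - 2 : ℝ) : ℂ) * B r
  rw [← integral_re_mode_eq_zero (k := 4) (by norm_num) fun r => P A' B' A' B' r
    + ((1 / r ^ 2 : ℝ) : ℂ) * P LA LB LA LB r - (Ω : ℂ) * P A B LA LB r
    + ((2 * ‖F r‖ ^ 2 / ε ^ 2 : ℝ) : ℂ) * P A B A B r
    + ((4 / ε ^ 2 : ℝ) : ℂ) * ((g r ^ 2 / 2 : ℝ) : ℂ) - (μ : ℂ) * P A B A B r]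
  apply integral_congr_ae
  filter_upwards [hF, ae_re_conj_mul hF hW, hW.value, hW.radial, hW.angular, ae_mem_puncturedDisc]
    with z h1 h2 h4 h5 h6 hz
  have hz1 : ‖z‖ ∈ Set.Ioo (0 : ℝ) 1 := ⟨norm_pos_iff.2 hz.2, by simpa [disc] using hz.1⟩
  have h7 : mode 2 (fun r => conj (F r) * A r + F r * conj (B r)) z
      = mode 2 (fun r => (g r : ℂ)) z := by
    simp only [mode, hg _ hz1]
  have q : ∀ x : ℂ, ‖x‖ ^ 2 = (conj x * x).re := fun x => by
    rw [← Complex.normSq_eq_conj_mul_self, Complex.ofReal_re, Complex.normSq_eq_norm_sq]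
  rw [h2, h7, re_mode_two_sq hz.2, crossDensity_eq_polar Ω W W hz.2, Complex.add_re, q (W.1 z), h4,
    h5, h6, re_conj_modePair_mul_modePair hz.2, re_conj_modePair_mul_modePair hz.2,
    re_conj_modePair_mul_modePair hz.2, re_conj_modePair_mul_modePair hz.2, h1, norm_mode hz.2]
  simp only [radialVariation, mode]
  generalize (z / (‖z‖ : ℂ)) ^ (4 : ℤ) = e at *
  change _ = ((P A' B' A' B' ‖z‖ + _ * P LA LB LA LB ‖z‖ - _ * P A B LA LB ‖z‖
    + _ * P A B A B ‖z‖ + _ * _ - _ * P A B A B ‖z‖) * e).re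
  have split : ∀ (a b c d x : ℂ) (s t u v w : ℝ), ((a + (s : ℂ) * b - (t : ℂ) * c + (u : ℂ) * d
      + (v : ℂ) * x - (w : ℂ) * d) * e).re = (a * e).re + s * (b * e).re - t * (c * e).re
      + u * (d * e).re + v * (x * e).re - w * (d * e).re := by
    intro a b c d x s t u v w
    simp only [Complex.mul_re, Complex.sub_re, Complex.add_re, Complex.sub_im, Complex.add_im,
      Complex.mul_im, Complex.ofReal_re, Complex.ofReal_im]
    ring
  have hA := q (A ‖z‖)
  have hB := q (B ‖z‖)
  have hA' := q (A' ‖z‖)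
  have hB' := q (B' ‖z‖)
  rw [split]
  have l1 : ∀ (t : ℝ) (x : ℂ), (conj ((t : ℂ) * x) * ((t : ℂ) * x)).re = t ^ 2 * ‖x‖ ^ 2 := by
    intro t x
    rw [← q, norm_mul, mul_pow, Complex.norm_real, Real.norm_eq_abs, sq_abs]
  have l2 : ∀ (t : ℝ) (x : ℂ), (conj x * ((t : ℂ) * x)).re = t * ‖x‖ ^ 2 := by
    intro t x
    rw [q, ← Complex.re_ofReal_mul]
    ring_nf
  rw [l1, l1, l2, l2, ← hA, ← hB, ← hA', ← hB']
  simp only [P, LA, LB] at *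
  ring

end variation

/-! ### Bounded continuous functions, for the integrability of the radial densities -/

/-- Bounded continuous real functions on the unit interval. -/
def BddCont (f : ℝ → ℝ) : Prop :=
  ContinuousOn f (Set.Ioo 0 1) ∧ ∃ C, ∀ r ∈ Set.Ioo (0 : ℝ) 1, |f r| ≤ C

namespace BddCont

variable {f g : ℝ → ℝ}

theorem const (c : ℝ) : BddCont fun _ => c := ⟨continuousOn_const, |c|, fun _ _ => le_rfl⟩

theorem id : BddCont fun r => r :=
  ⟨continuousOn_id, 1, fun r hr => by rw [abs_of_pos hr.1]; exact hr.2.le⟩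

theorem add (hf : BddCont f) (hg : BddCont g) : BddCont fun r => f r + g r := by
  obtain ⟨cf, C, hC⟩ := hf
  obtain ⟨cg, D, hD⟩ := hg
  exact ⟨cf.add cg, C + D, fun r hr => (abs_add_le _ _).trans (add_le_add (hC r hr) (hD r hr))⟩

theorem sub (hf : BddCont f) (hg : BddCont g) : BddCont fun r => f r - g r := by
  obtain ⟨cf, C, hC⟩ := hf
  obtain ⟨cg, D, hD⟩ := hg
  exact ⟨cf.sub cg, C + D, fun r hr => (abs_sub _ _).trans (add_le_add (hC r hr) (hD r hr))⟩

theorem mul (hf : BddCont f) (hg : BddCont g) : BddCont fun r => f r * g r := by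
  obtain ⟨cf, C, hC⟩ := hf
  obtain ⟨cg, D, hD⟩ := hg
  refine ⟨cf.mul cg, C * D, fun r hr => ?_⟩
  rw [abs_mul]
  exact mul_le_mul (hC r hr) (hD r hr) (abs_nonneg _) ((abs_nonneg _).trans (hC r hr))

theorem pow (hf : BddCont f) (k : ℕ) : BddCont fun r => f r ^ k := by
  obtain ⟨cf, C, hC⟩ := hf
  refine ⟨cf.pow k, C ^ k, fun r hr => ?_⟩
  rw [abs_pow]
  exact pow_le_pow_left₀ (abs_nonneg _) (hC r hr) k

theorem congr (hf : BddCont f) (h : ∀ r ∈ Set.Ioo (0 : ℝ) 1, g r = f r) : BddCont g := by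
  obtain ⟨cf, C, hC⟩ := hf
  exact ⟨cf.congr h, C, fun r hr => by rw [h r hr]; exact hC r hr⟩

theorem integrable (hf : BddCont f) : Integrable f unitMeasure := by
  obtain ⟨cf, C, hC⟩ := hf
  refine Integrable.of_bound (cf.aestronglyMeasurable measurableSet_Ioo) C ?_
  filter_upwards [ae_restrict_mem measurableSet_Ioo] with r hr
  exact hC r hr

theorem of_norm {u : ℝ → ℂ} {C : ℝ} (hu : ContinuousOn u (Set.Ioo 0 1))
    (h : ∀ r ∈ Set.Ioo (0 : ℝ) 1, ‖u r‖ ≤ C) : BddCont fun r => ‖u r‖ :=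
  ⟨hu.norm, C, fun r hr => by rw [abs_norm]; exact h r hr⟩

end BddCont

theorem bddCont_radialVariation {n : ℕ} {ε Ω μ C : ℝ} {F A A' B B' : ℝ → ℂ} {g : ℝ → ℝ}
    (cF : ContinuousOn F (Set.Ioo 0 1)) (cA : ContinuousOn A (Set.Ioo 0 1))
    (cA' : ContinuousOn A' (Set.Ioo 0 1)) (cB : ContinuousOn B (Set.Ioo 0 1))
    (cB' : ContinuousOn B' (Set.Ioo 0 1)) (cg : ContinuousOn g (Set.Ioo 0 1))
    (bF : ∀ r ∈ Set.Ioo (0 : ℝ) 1, ‖F r‖ ≤ C)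
    (bA : ∀ r ∈ Set.Ioo (0 : ℝ) 1, ‖A r‖ ≤ C) (bA' : ∀ r ∈ Set.Ioo (0 : ℝ) 1, ‖A' r‖ ≤ C)
    (bB : ∀ r ∈ Set.Ioo (0 : ℝ) 1, ‖B r‖ ≤ C) (bB' : ∀ r ∈ Set.Ioo (0 : ℝ) 1, ‖B' r‖ ≤ C)
    (kA : ∀ r ∈ Set.Ioo (0 : ℝ) 1, |(n + 2 : ℝ)| * ‖A r‖ ≤ C * r)
    (kB : ∀ r ∈ Set.Ioo (0 : ℝ) 1, |(n - 2 : ℝ)| * ‖B r‖ ≤ C * r)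
    (hg : ∀ r ∈ Set.Ioo (0 : ℝ) 1, conj (F r) * A r + F r * conj (B r) = g r) :
    BddCont (radialVariation n ε Ω μ F A A' B B' g) := by
  have quot : ∀ (m : ℝ) (u : ℝ → ℂ), ContinuousOn u (Set.Ioo 0 1) →
      (∀ r ∈ Set.Ioo (0 : ℝ) 1, |m| * ‖u r‖ ≤ C * r) → BddCont fun r => m * ‖u r‖ / r := by
    intro m u hu hb
    refine ⟨(continuousOn_const.mul hu.norm).div continuousOn_id fun r hr => hr.1.ne', C,
      fun r hr => ?_⟩
    rw [abs_div, abs_mul, abs_norm, abs_of_pos hr.1, div_le_iff₀ hr.1]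
    exact hb r hr
  have dF := BddCont.of_norm cF bF
  have dA := BddCont.of_norm cA bA
  have dB := BddCont.of_norm cB bB
  have dg : BddCont g := by
    refine ⟨cg, C * C + C * C, fun r hr => ?_⟩
    rw [← Real.norm_eq_abs, ← Complex.norm_real, ← hg r hr]
    refine (norm_add_le _ _).trans ?_
    rw [norm_mul, norm_mul, RCLike.norm_conj, RCLike.norm_conj]
    have hC : 0 ≤ C := (norm_nonneg _).trans (bF r hr)
    have := bF r hr
    have := bA r hr
    have := bB r hr
    gcongr
  have dAB := (dA.pow 2).add (dB.pow 2)
  refine ((((((((BddCont.of_norm cA' bA').pow 2).add ((BddCont.of_norm cB' bB').pow 2)).add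
    (((quot _ A cA kA).pow 2).add ((quot _ B cB kB).pow 2))).sub
    ((BddCont.const Ω).mul (((BddCont.const (n + 2 : ℝ)).mul (dA.pow 2)).add
      ((BddCont.const (n - 2 : ℝ)).mul (dB.pow 2))))).add
    (((((BddCont.const 2).mul (dF.pow 2)).mul dAB).add ((BddCont.const 2).mul (dg.pow 2))).mul
      (BddCont.const (ε ^ 2)⁻¹))).sub ((BddCont.const μ).mul dAB))).congr fun r _ => ?_
  rw [radialVariation]
  ring

theorem norm_ofReal_mul_add_sq (a b : ℝ) (x y : ℂ) : ‖(a : ℂ) * x + (b : ℂ) * y‖ ^ 2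
    = a ^ 2 * ‖x‖ ^ 2 + 2 * a * b * (conj x * y).re + b ^ 2 * ‖y‖ ^ 2 := by
  simp only [Complex.sq_norm, Complex.normSq_apply, Complex.add_re, Complex.mul_re,
    Complex.add_im, Complex.mul_im, Complex.conj_re, Complex.conj_im, Complex.ofReal_re,
    Complex.ofReal_im]
  ring

/-! ### The destabilizing direction -/

section profile

variable (n : ℕ) (ε ν : ℝ) (F K : ℝ → ℂ) (r : ℝ)

/-- The amplitude of the mode `e^{i(n+2)θ}` of the destabilizing direction. -/
def upper : ℂ := (K r - n * F r) / (r : ℂ) ^ 2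

/-- The amplitude of the mode `e^{i(n-2)θ}` of the destabilizing direction. -/
def lower : ℂ := (K r + n * F r) / (r : ℂ) ^ 2

/-- The derivative of `upper`. -/
def upperDeriv : ℂ := ((-(n + 2) / r ^ 3 : ℝ) : ℂ) * (K r - n * F r)
  + (((2 * ‖F r‖ ^ 2 / ε ^ 2 - ν) / r : ℝ) : ℂ) * F r

/-- The derivative of `lower`. -/
def lowerDeriv : ℂ := (((n - 2) / r ^ 3 : ℝ) : ℂ) * (K r + n * F r)
  + (((2 * ‖F r‖ ^ 2 / ε ^ 2 - ν) / r : ℝ) : ℂ) * F r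

end profile

namespace IsVortexProfile

variable {n : ℕ} {ε ν : ℝ} {F K : ℝ → ℂ}

theorem hasDerivAt_upper (h : IsVortexProfile n ε ν F K) {r : ℝ} (hr : r ∈ Set.Ioo (0 : ℝ) 1) :
    HasDerivAt (upper n F K) (upperDeriv n ε ν F K r) r := by
  have hr0 : (r : ℂ) ≠ 0 := by exact_mod_cast hr.1.ne'
  have h1 : HasDerivAt (fun r : ℝ => (r : ℂ) ^ 2) (2 * (r : ℂ)) r :=
    (((hasDerivAt_id r).ofReal_comp).pow 2).congr_deriv (by simp)
  refine ((h.hasDerivAt_U hr).div h1 (pow_ne_zero 2 hr0)).congr_deriv ?_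
  rw [upperDeriv]
  push_cast
  field_simp
  ring

theorem hasDerivAt_lower (h : IsVortexProfile n ε ν F K) {r : ℝ} (hr : r ∈ Set.Ioo (0 : ℝ) 1) :
    HasDerivAt (lower n F K) (lowerDeriv n ε ν F K r) r := by
  have hr0 : (r : ℂ) ≠ 0 := by exact_mod_cast hr.1.ne'
  have h1 : HasDerivAt (fun r : ℝ => (r : ℂ) ^ 2) (2 * (r : ℂ)) r :=
    (((hasDerivAt_id r).ofReal_comp).pow 2).congr_deriv (by simp)
  refine ((h.hasDerivAt_V hr).div h1 (pow_ne_zero 2 hr0)).congr_deriv ?_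
  rw [lowerDeriv]
  push_cast
  field_simp
  ring

theorem continuousOn_F (h : IsVortexProfile n ε ν F K) : ContinuousOn F (Set.Ioo 0 1) :=
  h.contF.mono Set.Ioo_subset_Ioc_self

theorem continuousOn_K (h : IsVortexProfile n ε ν F K) : ContinuousOn K (Set.Ioo 0 1) :=
  h.contK.mono Set.Ioo_subset_Ioc_self

theorem continuousOn_potential_div (h : IsVortexProfile n ε ν F K) :
    ContinuousOn (fun r => (((2 * ‖F r‖ ^ 2 / ε ^ 2 - ν) / r : ℝ) : ℂ) * F r) (Set.Ioo 0 1) :=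
  (Complex.continuous_ofReal.comp_continuousOn
    ((((continuousOn_const.mul (h.continuousOn_F.norm.pow 2)).div_const _).sub
      continuousOn_const).div continuousOn_id fun _r hr => hr.1.ne')).mul h.continuousOn_F

theorem continuousOn_upperDeriv (h : IsVortexProfile n ε ν F K) :
    ContinuousOn (upperDeriv n ε ν F K) (Set.Ioo 0 1) :=
  ((Complex.continuous_ofReal.comp_continuousOn (continuousOn_const.div (by fun_prop)
    fun r hr => pow_ne_zero 3 hr.1.ne')).mul
    (h.continuousOn_K.sub (continuousOn_const.mul h.continuousOn_F))).add
    h.continuousOn_potential_div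

theorem continuousOn_lowerDeriv (h : IsVortexProfile n ε ν F K) :
    ContinuousOn (lowerDeriv n ε ν F K) (Set.Ioo 0 1) :=
  ((Complex.continuous_ofReal.comp_continuousOn (continuousOn_const.div (by fun_prop)
    fun r hr => pow_ne_zero 3 hr.1.ne')).mul
    (h.continuousOn_K.add (continuousOn_const.mul h.continuousOn_F))).add
    h.continuousOn_potential_div

/-- The bounds near the vortex core on which everything rests. -/
theorem exists_core_bound (h : IsVortexProfile n ε ν F K) (hn : 2 ≤ n) :
    ∃ C, 0 ≤ C ∧ ∀ r ∈ Set.Ioo (0 : ℝ) 1, ‖F r‖ ≤ C * r ^ 2 ∧ (n - 2) * ‖F r‖ ≤ C * r ^ 3 ∧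
      ‖K r - n * F r‖ ≤ C * r ^ 4 ∧ |2 * ‖F r‖ ^ 2 / ε ^ 2 - ν| ≤ C := by
  have hn' : (0 : ℝ) ≤ n - 2 := by
    have : (2 : ℝ) ≤ n := by exact_mod_cast hn
    linarith
  obtain ⟨c, hc⟩ := weaken_bound (j := 2) (by omega) (h.F_bound hn)
  obtain ⟨d, hd⟩ := h.U_bound hn
  obtain ⟨P, hP0, hP⟩ := h.exists_potential_bound
  -- For `n = 2` the profile decays only like `r²`, but then the factor `n - 2` vanishes; for `n ≥
  -- 3` the decay is cubic.
  obtain ⟨e, he⟩ : ∃ e, ∀ r ∈ Set.Ioc (0 : ℝ) 1, (n - 2) * ‖F r‖ ≤ e * r ^ 3 := by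
    rcases hn.lt_or_eq with h2 | h2
    · obtain ⟨e, he⟩ := weaken_bound (j := 3) (by omega) (h.F_bound hn)
      exact ⟨(n - 2) * e, fun r hr => by
        rw [mul_assoc]
        exact mul_le_mul_of_nonneg_left (he r hr) hn'⟩
    · exact ⟨0, fun r _ => by rw [← h2]; simp⟩
  have hc0 := abs_nonneg c
  have hd0 := abs_nonneg d
  have he0 := abs_nonneg e
  have mono : ∀ {x c r : ℝ} {k : ℕ} (C : ℝ), 0 < r → |c| ≤ C → x ≤ c * r ^ k → x ≤ C * r ^ k :=
    fun C hr hC hx => hx.trans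
      (mul_le_mul_of_nonneg_right ((le_abs_self _).trans hC) (pow_pos hr _).le)
  refine ⟨|c| + |d| + |e| + P, by positivity, fun r hr => ?_⟩
  have hr' : r ∈ Set.Ioc (0 : ℝ) 1 := ⟨hr.1, hr.2.le⟩
  exact ⟨mono _ hr.1 (by linarith) (hc r hr'), mono _ hr.1 (by linarith) (he r hr'),
    mono _ hr.1 (by linarith) (hd r hr'), (hP r hr').trans (by linarith)⟩

/-- These are the hypotheses under which the direction belongs to `H¹`. The delicate amplitude is
the lower one, `2nF/r²` up to a term of order `r²`: its derivative and its centrifugal term both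
carry the factor `n - 2`. -/
theorem exists_direction_bound (h : IsVortexProfile n ε ν F K) (hn : 2 ≤ n) :
    ∃ C, ∀ r ∈ Set.Ioo (0 : ℝ) 1, ‖F r‖ ≤ C ∧ ‖upper n F K r‖ ≤ C ∧ ‖lower n F K r‖ ≤ C ∧
      ‖upperDeriv n ε ν F K r‖ ≤ C ∧ ‖lowerDeriv n ε ν F K r‖ ≤ C ∧
      |(n + 2 : ℝ)| * ‖upper n F K r‖ ≤ C * r ∧ |(n - 2 : ℝ)| * ‖lower n F K r‖ ≤ C * r := by
  have hn' : (0 : ℝ) ≤ n - 2 := by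
    have : (2 : ℝ) ≤ n := by exact_mod_cast hn
    linarith
  obtain ⟨C, hC, hb⟩ := h.exists_core_bound hn
  refine ⟨(3 * n + 2) * C + C * C, fun r hr => ?_⟩
  obtain ⟨h1, h2, h3, h4⟩ := hb r hr
  have hr0 := hr.1
  have hr1 := hr.2.le
  have hU : ‖upper n F K r‖ ≤ C * r ^ 2 := by
    rw [upper, norm_div, norm_pow, Complex.norm_real, Real.norm_of_nonneg hr0.le,
      div_le_iff₀ (by positivity)]
    exact h3.trans_eq (by ring)
  have hV0 : ‖K r + n * F r‖ ≤ ‖K r - n * F r‖ + 2 * n * ‖F r‖ := by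
    have e : K r + n * F r = (K r - n * F r) + 2 * n * F r := by ring
    rw [e]
    refine (norm_add_le _ _).trans_eq ?_
    simp
  have hV : ‖K r + n * F r‖ ≤ (2 * n + 1) * C * r ^ 2 := by
    have h5 : 2 * n * ‖F r‖ ≤ 2 * n * (C * r ^ 2) := by gcongr
    have h6 : C * r ^ 4 ≤ C * r ^ 2 := by
      gcongr C * ?_
      exact pow_le_pow_of_le_one hr0.le hr1 (by norm_num)
    linarith
  have hV' : (n - 2) * ‖K r + n * F r‖ ≤ (3 * n + 2) * C * r ^ 3 := by
    have h5 : (n - 2) * ‖K r + n * F r‖ ≤ (n - 2) * (‖K r - n * F r‖ + 2 * n * ‖F r‖) := by gcongr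
    have h6 : (n - 2 : ℝ) * ‖K r - n * F r‖ ≤ (n - 2) * (C * r ^ 3) := by
      refine mul_le_mul_of_nonneg_left (h3.trans ?_) hn'
      gcongr C * ?_
      exact pow_le_pow_of_le_one hr0.le hr1 (by norm_num)
    have h7 : 2 * n * ((n - 2) * ‖F r‖) ≤ 2 * n * (C * r ^ 3) := by gcongr
    have h8 : 0 ≤ C * r ^ 3 := by positivity
    linarith
  have hL : ‖lower n F K r‖ ≤ (2 * n + 1) * C := by
    rw [lower, norm_div, norm_pow, Complex.norm_real, Real.norm_of_nonneg hr0.le,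
      div_le_iff₀ (by positivity)]
    exact hV
  have hpF : ‖(((2 * ‖F r‖ ^ 2 / ε ^ 2 - ν) / r : ℝ) : ℂ) * F r‖ ≤ C * C := by
    rw [norm_mul, Complex.norm_real, Real.norm_eq_abs, abs_div, abs_of_pos hr0, div_mul_eq_mul_div,
      div_le_iff₀ hr0, mul_assoc]
    refine mul_le_mul h4 (h1.trans ?_) (norm_nonneg _) hC
    gcongr C * ?_
    nlinarith
  have hk : ∀ k : ℕ, C * r ^ k ≤ C := fun k =>
    mul_le_of_le_one_right hC (pow_le_one₀ hr0.le hr1)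
  have hnC : 0 ≤ n * C := by positivity
  have hCC : 0 ≤ C * C := by positivity
  refine ⟨?_, ?_, ?_, ?_, ?_, ?_, ?_⟩
  · linarith [hk 2]
  · linarith [hk 2]
  · linarith
  · rw [upperDeriv]
    refine (norm_add_le _ _).trans (add_le_add ?_ hpF)
    rw [norm_mul, Complex.norm_real, Real.norm_eq_abs, abs_div, abs_neg,
      abs_of_pos (by positivity : (0 : ℝ) < n + 2), abs_of_pos (pow_pos hr0 3), div_mul_eq_mul_div,
      div_le_iff₀ (by positivity)]
    calc ((n : ℝ) + 2) * ‖K r - n * F r‖ ≤ (n + 2) * (C * r ^ 4) := by gcongr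
      _ = (n + 2) * (C * r ^ 1) * r ^ 3 := by ring
      _ ≤ (n + 2) * C * r ^ 3 := by
        gcongr
        exact hk 1
      _ ≤ (3 * n + 2) * C * r ^ 3 := by
        gcongr
        linarith [(Nat.cast_nonneg n : (0 : ℝ) ≤ n)]
  · rw [lowerDeriv]
    refine (norm_add_le _ _).trans (add_le_add ?_ hpF)
    rw [norm_mul, Complex.norm_real, Real.norm_eq_abs, abs_div, abs_of_nonneg hn',
      abs_of_pos (pow_pos hr0 3), div_mul_eq_mul_div, div_le_iff₀ (by positivity)]
    exact hV'
  · rw [abs_of_pos (by positivity : (0 : ℝ) < n + 2)]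
    have h5 : C * r ^ 2 ≤ C * r := by
      gcongr C * ?_
      nlinarith
    have h6 : (n + 2) * ‖upper n F K r‖ ≤ (n + 2) * (C * r) := by
      gcongr
      exact hU.trans h5
    have h7 : 0 ≤ n * C * r := by positivity
    have h8 : 0 ≤ C * C * r := by positivity
    linarith
  · rw [abs_of_nonneg hn', lower, norm_div, norm_pow, Complex.norm_real,
      Real.norm_of_nonneg hr0.le, mul_div_assoc', div_le_iff₀ (by positivity)]
    have h8 : 0 ≤ C * C * r ^ 3 := by positivity
    linarith

theorem re_conj_mul_sq (h : IsVortexProfile n ε ν F K) {r : ℝ} (hr : r ∈ Set.Ioc (0 : ℝ) 1) :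
    (conj (F r) * K r).re ^ 2 = ‖F r‖ ^ 2 * ‖K r‖ ^ 2 := by
  have h1 := Complex.normSq_apply (conj (F r) * K r)
  rw [h.im_conj_mul hr, Complex.normSq_eq_norm_sq, norm_mul, RCLike.norm_conj] at h1
  linarith

/-- The terms `∓n|F|²` cancel, and what remains is real because there is no radial current. -/
theorem conj_mul_upper_add (h : IsVortexProfile n ε ν F K) {r : ℝ} (hr : r ∈ Set.Ioo (0 : ℝ) 1) :
    conj (F r) * upper n F K r + F r * conj (lower n F K r)
      = ((2 * (conj (F r) * K r).re / r ^ 2 : ℝ) : ℂ) := by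
  have h1 := h.im_conj_mul ⟨hr.1, hr.2.le⟩
  have h2 : conj (F r) * K r = (((conj (F r) * K r).re : ℝ) : ℂ) := 
    Complex.ext (Complex.ofReal_re _).symm (by rw [h1, Complex.ofReal_im])
  have h3 : F r * conj (K r) = (((conj (F r) * K r).re : ℝ) : ℂ) := by
    rw [← Complex.conj_ofReal, ← h2, map_mul, Complex.conj_conj]
  have hr0 : (r : ℂ) ≠ 0 := by exact_mod_cast hr.1.ne'
  rw [upper, lower]
  push_cast
  rw [map_div₀, map_pow, Complex.conj_ofReal, map_add, map_mul, Complex.conj_natCast]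
  field_simp
  linear_combination h2 + h3

theorem hasDerivAt_norm_K_sq (h : IsVortexProfile n ε ν F K) {r : ℝ}
    (hr : r ∈ Set.Ioo (0 : ℝ) 1) :
    HasDerivAt (fun r => ‖K r‖ ^ 2) (2 * (((n : ℝ) ^ 2 / r + r * (2 * ‖F r‖ ^ 2 / ε ^ 2 - ν))
      * (conj (F r) * K r).re)) r := by
  refine (h.derivK r hr).norm_sq.congr_deriv ?_
  rw [Complex.inner, mul_assoc, Complex.re_ofReal_mul]
  simp only [Complex.mul_re, Complex.conj_re, Complex.conj_im]
  ring

/-! ### Integration by parts in the second variation -/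

/-- The boundary term in the second variation. -/
def boundaryTerm (n : ℕ) (ε Ω ν : ℝ) (F K : ℝ → ℂ) (r : ℝ) : ℝ :=
  2 * (2 * ‖F r‖ ^ 2 / ε ^ 2 - ν) * (conj (F r) * K r).re / r ^ 2
    + 4 * (n ^ 2 * (conj (F r) * K r).re - ‖K r‖ ^ 2 - n ^ 2 * ‖F r‖ ^ 2) / r ^ 4
    + 2 * ‖F r‖ ^ 2 * (‖F r‖ ^ 2 / ε ^ 2 - ν + 2 * n * Ω) / r ^ 2

/-- The bulk term in the second variation. -/
def bulkTerm (n : ℕ) (ε Ω ν : ℝ) (F : ℝ → ℂ) (r : ℝ) : ℝ :=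
  4 * ‖F r‖ ^ 2 * (‖F r‖ ^ 2 / ε ^ 2 - ν + 2 * n * Ω) / r ^ 3

/-- Everything is expressed through `X = |F|²`, `Y = Re(conj F · K)` and `Z = |K|²`, whose
derivatives are given by the radial equation. The claim becomes a polynomial identity modulo `Y² =
XZ`, which holds because the current is purely angular. -/
theorem hasDerivAt_boundaryTerm (h : IsVortexProfile n ε ν F K) {Ω : ℝ} {r : ℝ}
    (hr : r ∈ Set.Ioo (0 : ℝ) 1) :
    HasDerivAt (boundaryTerm n ε Ω ν F K)
      (r * radialVariation n ε Ω (ν - n * Ω) F (upper n F K) (upperDeriv n ε ν F K) (lower n F K)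
        (lowerDeriv n ε ν F K) (fun r => 2 * (conj (F r) * K r).re / r ^ 2) r
        - bulkTerm n ε Ω ν F r) r := by
  have hr0 : r ≠ 0 := hr.1.ne'
  have hX := h.hasDerivAt_norm_sq hr
  have hY := h.hasDerivAt_re_conj_mul hr
  have hZ := h.hasDerivAt_norm_K_sq hr
  have hp := ((hX.const_mul 2).div_const (ε ^ 2)).sub_const ν
  have hq := ((hX.div_const (ε ^ 2)).sub_const ν).add_const (2 * n * Ω)
  have h1 := (((hp.const_mul 2).mul hY).div (hasDerivAt_pow 2 r) (pow_ne_zero 2 hr0)).add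
    (((((hY.const_mul ((n : ℝ) ^ 2)).sub hZ).sub (hX.const_mul ((n : ℝ) ^ 2))).const_mul 4).div
      (hasDerivAt_pow 4 r) (pow_ne_zero 4 hr0))
  have h2 := h1.add (((hX.const_mul 2).mul hq).div (hasDerivAt_pow 2 r) (pow_ne_zero 2 hr0))
  refine h2.congr_deriv ?_
  have eU : ‖upper n F K r‖ ^ 2
      = (‖K r‖ ^ 2 - 2 * n * (conj (F r) * K r).re + n ^ 2 * ‖F r‖ ^ 2) / r ^ 4 := by
    have e : upper n F K r = ((-n / r ^ 2 : ℝ) : ℂ) * F r + ((1 / r ^ 2 : ℝ) : ℂ) * K r := by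
      rw [upper]; push_cast; ring
    rw [e, norm_ofReal_mul_add_sq]
    field_simp
    ring
  have eL : ‖lower n F K r‖ ^ 2
      = (‖K r‖ ^ 2 + 2 * n * (conj (F r) * K r).re + n ^ 2 * ‖F r‖ ^ 2) / r ^ 4 := by
    have e : lower n F K r = ((n / r ^ 2 : ℝ) : ℂ) * F r + ((1 / r ^ 2 : ℝ) : ℂ) * K r := by
      rw [lower]; push_cast; ring
    rw [e, norm_ofReal_mul_add_sq]
    field_simp
    ring
  have eU' : upperDeriv n ε ν F K r = (((n + 2) * n / r ^ 3
      + (2 * ‖F r‖ ^ 2 / ε ^ 2 - ν) / r : ℝ) : ℂ) * F r + ((-(n + 2) / r ^ 3 : ℝ) : ℂ) * K r := by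
    rw [upperDeriv]; push_cast; ring
  have eL' : lowerDeriv n ε ν F K r = (((n - 2) * n / r ^ 3
      + (2 * ‖F r‖ ^ 2 / ε ^ 2 - ν) / r : ℝ) : ℂ) * F r + (((n - 2) / r ^ 3 : ℝ) : ℂ) * K r := by
    rw [lowerDeriv]; push_cast; ring
  have eg : (2 * (conj (F r) * K r).re / r ^ 2) ^ 2 = 4 * (‖F r‖ ^ 2 * ‖K r‖ ^ 2) / r ^ 4 := by
    rw [← h.re_conj_mul_sq ⟨hr.1, hr.2.le⟩]
    field_simp
    ring
  have ey := h.re_conj_mul_sq ⟨hr.1, hr.2.le⟩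
  simp only [radialVariation, bulkTerm]
  rw [eU, eL, eU', eL', norm_ofReal_mul_add_sq, norm_ofReal_mul_add_sq, eg]
  simp only [Pi.mul_apply, Pi.sub_apply]
  generalize ‖F r‖ ^ 2 = X at *
  generalize (conj (F r) * K r).re = Y at *
  generalize ‖K r‖ ^ 2 = Z at *
  simp only [div_eq_mul_inv]
  generalize (ε ^ 2)⁻¹ = e
  field_simp
  linear_combination (8 * r ^ 5 * e) * ey

end IsVortexProfile

namespace IsVortexProfile

variable {n : ℕ} {ε ν Ω : ℝ} {F K : ℝ → ℂ}

/-- The dangerous term is the one over `r⁴`. Rewritten in terms of `U = K - nF`, its part of lowest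
order carries the factor `n - 2`, so it is `O(r⁵)` for every `n ≥ 2`. -/
theorem exists_boundaryTerm_bound (h : IsVortexProfile n ε ν F K) (hn : 2 ≤ n) (Ω : ℝ) :
    ∃ M, ∀ r ∈ Set.Ioo (0 : ℝ) 1, |boundaryTerm n ε Ω ν F K r| ≤ M * r := by
  have hn' : (0 : ℝ) ≤ n - 2 := by
    have : (2 : ℝ) ≤ n := by exact_mod_cast hn
    linarith
  obtain ⟨C, hC, hb⟩ := h.exists_core_bound hn
  refine ⟨2 * C * (C * ((n + 1) * C)) + 4 * (n ^ 2 * (C * C) + n * (C * C) + C * C)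
    + 2 * (C * C) * (C + |ν| + |2 * n * Ω|), fun r hr => ?_⟩
  obtain ⟨h1, h2, h3, h4⟩ := hb r hr
  have hr0 := hr.1
  have hr1 := hr.2.le
  have pw : ∀ {i j : ℕ}, j ≤ i → r ^ i ≤ r ^ j := fun hij => pow_le_pow_of_le_one hr0.le hr1 hij
  have hK : ‖K r‖ ≤ (n + 1) * C * r ^ 2 := by
    have e : K r = (K r - n * F r) + n * F r := by ring
    rw [e]
    refine (norm_add_le _ _).trans ?_
    rw [norm_mul, Complex.norm_natCast]
    have h5 : n * ‖F r‖ ≤ n * (C * r ^ 2) := by gcongr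
    have h6 : C * r ^ 4 ≤ C * r ^ 2 := by gcongr C * ?_; exact pw (by norm_num)
    linarith
  have bre : ∀ x y : ℂ, |(conj x * y).re| ≤ ‖x‖ * ‖y‖ := fun x y => by
    refine (Complex.abs_re_le_norm _).trans ?_
    rw [norm_mul, RCLike.norm_conj]
  rw [boundaryTerm]
  refine (abs_add_le _ _).trans ((add_le_add_left (abs_add_le _ _) _).trans ?_)
  rw [add_mul, add_mul]
  refine add_le_add (add_le_add ?_ ?_) ?_
  · rw [abs_div, abs_of_pos (pow_pos hr0 2), div_le_iff₀ (pow_pos hr0 2), abs_mul, abs_mul, abs_two]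
    have h5 := bre (F r) (K r)
    calc 2 * |2 * ‖F r‖ ^ 2 / ε ^ 2 - ν| * |(conj (F r) * K r).re|
        ≤ 2 * C * ((C * r ^ 2) * ((n + 1) * C * r ^ 2)) := by
          gcongr
          refine h5.trans ?_
          gcongr
      _ = 2 * C * (C * ((n + 1) * C)) * r ^ 4 := by ring
      _ ≤ 2 * C * (C * ((n + 1) * C)) * r ^ 3 := by gcongr _ * ?_; exact pw (by norm_num)
      _ = _ := by ring
  · rw [abs_div, abs_of_pos (pow_pos hr0 4), div_le_iff₀ (pow_pos hr0 4), abs_mul,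
      abs_of_pos (by norm_num : (0 : ℝ) < 4)]
    -- Substituting `K = U + nF` exhibits the factor `n - 2`.
    have e : n ^ 2 * (conj (F r) * K r).re - ‖K r‖ ^ 2 - n ^ 2 * ‖F r‖ ^ 2
        = n ^ 2 * ((n - 2) * ‖F r‖) * ‖F r‖
          + n * ((n - 2) * (conj (F r) * (K r - n * F r)).re) - ‖K r - n * F r‖ ^ 2 := by
      have e2 := norm_ofReal_mul_add_sq (-n) 1 (F r) (K r)
      have e3 : ((-n : ℝ) : ℂ) * F r + ((1 : ℝ) : ℂ) * K r = K r - n * F r := by push_cast; ring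
      have e4 : (conj (F r) * (K r - n * F r)).re = (conj (F r) * K r).re - n * ‖F r‖ ^ 2 := by
        rw [mul_sub, Complex.sub_re, mul_left_comm, ← Complex.normSq_eq_conj_mul_self,
          Complex.normSq_eq_norm_sq, ← Complex.ofReal_natCast, Complex.re_ofReal_mul,
          Complex.ofReal_re]
      rw [e3] at e2
      rw [e2, e4]
      ring
    have h5 : |n ^ 2 * (conj (F r) * K r).re - ‖K r‖ ^ 2 - n ^ 2 * ‖F r‖ ^ 2|
        ≤ (n ^ 2 * (C * C) + n * (C * C) + C * C) * r ^ 5 := by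
      rw [e]
      refine (abs_sub _ _).trans ((add_le_add_left (abs_add_le _ _) _).trans ?_)
      rw [add_mul, add_mul]
      refine add_le_add (add_le_add ?_ ?_) ?_
      · rw [abs_of_nonneg (by positivity)]
        calc _ ≤ n ^ 2 * (C * r ^ 3) * (C * r ^ 2) := by gcongr
          _ = _ := by ring
      · rw [abs_mul, abs_mul, abs_of_nonneg hn', Nat.abs_cast]
        calc _ ≤ n * ((n - 2) * (‖F r‖ * ‖K r - n * F r‖)) := by
              gcongr
              exact bre _ _
          _ = n * ((n - 2) * ‖F r‖ * ‖K r - n * F r‖) := by ring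
          _ ≤ n * ((C * r ^ 3) * (C * r ^ 4)) := by gcongr
          _ = n * (C * C) * r ^ 7 := by ring
          _ ≤ n * (C * C) * r ^ 5 := by gcongr _ * ?_; exact pw (by norm_num)
      · rw [abs_of_nonneg (by positivity)]
        calc _ ≤ (C * r ^ 4) ^ 2 := by gcongr
          _ = C * C * r ^ 8 := by ring
          _ ≤ C * C * r ^ 5 := by gcongr _ * ?_; exact pw (by norm_num)
    calc _ ≤ 4 * ((n ^ 2 * (C * C) + n * (C * C) + C * C) * r ^ 5) := by gcongr
      _ = _ := by ring
  · rw [abs_div, abs_of_pos (pow_pos hr0 2), div_le_iff₀ (pow_pos hr0 2), abs_mul,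
      abs_of_nonneg (by positivity : (0 : ℝ) ≤ 2 * ‖F r‖ ^ 2)]
    have h5 : |‖F r‖ ^ 2 / ε ^ 2 - ν + 2 * n * Ω| ≤ C + |ν| + |2 * n * Ω| := by
      have h6 : 2 * ‖F r‖ ^ 2 / ε ^ 2 = 2 * (‖F r‖ ^ 2 / ε ^ 2) := mul_div_assoc _ _ _
      rw [h6] at h4
      obtain ⟨h7, h8⟩ := abs_le.1 h4
      rw [abs_le]
      constructor <;> linarith [le_abs_self ν, neg_abs_le ν, le_abs_self (2 * n * Ω),
        neg_abs_le (2 * n * Ω)]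
    calc _ ≤ 2 * (C * r ^ 2) ^ 2 * (C + |ν| + |2 * n * Ω|) := by gcongr
      _ = 2 * (C * C) * (C + |ν| + |2 * n * Ω|) * r ^ 4 := by ring
      _ ≤ 2 * (C * C) * (C + |ν| + |2 * n * Ω|) * r ^ 3 := by gcongr _ * ?_; exact pw (by norm_num)
      _ = _ := by ring

theorem tendsto_boundaryTerm_zero (h : IsVortexProfile n ε ν F K) (hn : 2 ≤ n) :
    Filter.Tendsto (boundaryTerm n ε Ω ν F K) (nhdsWithin 0 (Set.Ioi 0)) (nhds 0) := by
  obtain ⟨M, hM⟩ := h.exists_boundaryTerm_bound hn Ω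
  have h1 : Filter.Tendsto (fun r : ℝ => M * r) (nhdsWithin 0 (Set.Ioi 0)) (nhds (M * 0)) :=
    (Continuous.tendsto (by fun_prop) _).mono_left nhdsWithin_le_nhds
  rw [mul_zero] at h1
  refine squeeze_zero_norm' ?_ h1
  filter_upwards [Ioo_mem_nhdsGT one_pos] with r hr
  exact hM r hr

theorem continuousOn_boundaryTerm (h : IsVortexProfile n ε ν F K) :
    ContinuousOn (boundaryTerm n ε Ω ν F K) (Set.Ioc 0 1) := by
  have cX := h.contF.norm.pow 2
  have cZ := h.contK.norm.pow 2
  have cY := Complex.continuous_re.comp_continuousOn h.continuousOn_conj_mul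
  have cp : ∀ k : ℕ, ContinuousOn (fun r : ℝ => r ^ k) (Set.Ioc 0 1) := fun k => by fun_prop
  have ne : ∀ k : ℕ, ∀ r ∈ Set.Ioc (0 : ℝ) 1, r ^ k ≠ 0 := fun k r hr => pow_ne_zero k hr.1.ne'
  exact (((((continuousOn_const.mul (((continuousOn_const.mul cX).div_const _).sub
    continuousOn_const)).mul cY).div (cp 2) (ne 2)).add
    ((continuousOn_const.mul (((continuousOn_const.mul cY).sub cZ).sub
      (continuousOn_const.mul cX))).div (cp 4) (ne 4)))).add
    (((continuousOn_const.mul cX).mul (((cX.div_const _).sub continuousOn_const).add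
      continuousOn_const)).div (cp 2) (ne 2))

theorem bddCont_bulkTerm (h : IsVortexProfile n ε ν F K) (hn : 2 ≤ n) :
    BddCont (bulkTerm n ε Ω ν F) := by
  obtain ⟨C, hC, hb⟩ := h.exists_core_bound hn
  have d1 : BddCont fun r => ‖F r‖ ^ 2 / r ^ 3 := by
    refine ⟨(h.continuousOn_F.norm.pow 2).div (by fun_prop) fun r hr => pow_ne_zero 3 hr.1.ne',
      C ^ 2, fun r hr => ?_⟩
    have hr0 := hr.1
    rw [abs_of_nonneg (by positivity), div_le_iff₀ (by positivity)]
    calc ‖F r‖ ^ 2 ≤ (C * r ^ 2) ^ 2 := by gcongr; exact (hb r hr).1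
      _ = C ^ 2 * r ^ 4 := by ring
      _ ≤ C ^ 2 * r ^ 3 := by
        gcongr _ * ?_
        exact pow_le_pow_of_le_one hr0.le hr.2.le (by norm_num)
  have d2 := BddCont.of_norm (C := C) h.continuousOn_F fun r hr =>
    (hb r hr).1.trans (mul_le_of_le_one_right hC (pow_le_one₀ hr.1.le hr.2.le))
  refine (((BddCont.const 4).mul d1).mul ((((d2.pow 2).mul (BddCont.const (ε ^ 2)⁻¹)).sub
    (BddCont.const ν)).add (BddCont.const (2 * n * Ω)))).congr fun r _ => ?_
  rw [bulkTerm]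
  ring

theorem bddCont_variation (h : IsVortexProfile n ε ν F K) (hn : 2 ≤ n) (μ : ℝ) :
    BddCont (radialVariation n ε Ω μ F (upper n F K) (upperDeriv n ε ν F K) (lower n F K)
        (lowerDeriv n ε ν F K) (fun r => 2 * (conj (F r) * K r).re / r ^ 2)) := by
  obtain ⟨C, hC⟩ := h.exists_direction_bound hn
  have cY := Complex.continuous_re.comp_continuousOn
    (h.continuousOn_conj_mul.mono Set.Ioo_subset_Ioc_self)
  exact bddCont_radialVariation (C := C) h.continuousOn_F
    (fun r hr => (h.hasDerivAt_upper hr).continuousAt.continuousWithinAt) h.continuousOn_upperDeriv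
    (fun r hr => (h.hasDerivAt_lower hr).continuousAt.continuousWithinAt) h.continuousOn_lowerDeriv
    ((continuousOn_const.mul cY).div (by fun_prop) fun r hr => pow_ne_zero 2 hr.1.ne')
    (fun r hr => (hC r hr).1) (fun r hr => (hC r hr).2.1) (fun r hr => (hC r hr).2.2.2.1)
    (fun r hr => (hC r hr).2.2.1) (fun r hr => (hC r hr).2.2.2.2.1)
    (fun r hr => (hC r hr).2.2.2.2.2.1) (fun r hr => (hC r hr).2.2.2.2.2.2)
    (fun r hr => h.conj_mul_upper_add hr)

/-- The second variation in the destabilizing direction, integrated by parts. -/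
theorem integral_variation (h : IsVortexProfile n ε ν F K) (hn : 2 ≤ n) :
    ∫ r in Set.Ioo (0 : ℝ) 1, r * radialVariation n ε Ω (ν - n * Ω) F (upper n F K)
        (upperDeriv n ε ν F K) (lower n F K) (lowerDeriv n ε ν F K)
        (fun r => 2 * (conj (F r) * K r).re / r ^ 2) r
      = boundaryTerm n ε Ω ν F K 1 + ∫ r in Set.Ioo (0 : ℝ) 1, bulkTerm n ε Ω ν F r := by
  have dT := BddCont.id.mul (h.bddCont_variation (Ω := Ω) hn (ν - n * Ω))
  have dg := h.bddCont_bulkTerm (Ω := Ω) hn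
  have key := intervalIntegral.integral_eq_sub_of_hasDerivAt_of_tendsto zero_lt_one
    (fun r hr => h.hasDerivAt_boundaryTerm (Ω := Ω) hr)
    ((intervalIntegrable_iff_integrableOn_Ioo_of_le zero_le_one).2 (dT.sub dg).integrable)
    (h.tendsto_boundaryTerm_zero hn)
    ((h.continuousOn_boundaryTerm (Ω := Ω) 1 (by simp)).mono_left
      (nhdsWithin_le_of_mem (Ioc_mem_nhdsLT zero_lt_one)))
  rw [intervalIntegral.integral_of_le zero_le_one, integral_Ioc_eq_integral_Ioo,
    integral_sub dT.integrable dg.integrable, sub_zero] at key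
  linarith

/-! ### Sign of the second variation -/

theorem bulk_factor_le {S : ℝ} (hε : 0 < ε) (hΩ : Ω ≤ 1 / (Real.sqrt Real.pi * ε))
    (hS : 1 / Real.pi ≤ S) (hν : (n : ℝ) ^ 2 + 2 * S / ε ^ 2 ≤ ν) (x : ℝ) :
    x / ε ^ 2 - ν + 2 * n * Ω ≤ (x - S) / ε ^ 2 := by
  -- The only place where the bound on `Ω` enters. For `Ω ≥ 0` it follows from `(n - Ω)² ≥ 0` and
  -- `Ω² ≤ 1/(πε²) ≤ S/ε²`.
  have h1 : 2 * n * Ω ≤ (n : ℝ) ^ 2 + S / ε ^ 2 := by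
    rcases le_total Ω 0 with h0 | h0
    · have h2 : n * Ω ≤ 0 := mul_nonpos_of_nonneg_of_nonpos (Nat.cast_nonneg n) h0
      have h3 : 0 ≤ S / ε ^ 2 := div_nonneg (le_trans (by positivity) hS) (by positivity)
      nlinarith [sq_nonneg (n : ℝ)]
    · have h2 : Ω ^ 2 ≤ (1 / (Real.sqrt Real.pi * ε)) ^ 2 := by gcongr
      have h3 : (1 / (Real.sqrt Real.pi * ε)) ^ 2 = 1 / Real.pi / ε ^ 2 := by
        rw [div_pow, mul_pow, Real.sq_sqrt Real.pi_pos.le, one_pow, div_div]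
      have h4 : 1 / Real.pi / ε ^ 2 ≤ S / ε ^ 2 := by gcongr
      nlinarith [sq_nonneg ((n : ℝ) - Ω)]
  have h2 : 2 * S / ε ^ 2 = S / ε ^ 2 + S / ε ^ 2 := by ring
  rw [sub_div]
  linarith

theorem boundaryTerm_one_le {S : ℝ} (h : IsVortexProfile n ε ν F K)
    (hS : ∀ r ∈ Set.Ioc (0 : ℝ) 1, ‖F r‖ ^ 2 ≤ S)
    (hx : ∀ x, x / ε ^ 2 - ν + 2 * n * Ω ≤ (x - S) / ε ^ 2) : boundaryTerm n ε Ω ν F K 1 ≤ 0 := by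
  have h1 : ‖F 1‖ ^ 2 / ε ^ 2 - ν + 2 * n * Ω ≤ 0 :=
    (hx _).trans (div_nonpos_of_nonpos_of_nonneg (sub_nonpos.2 (hS 1 (by simp))) (by positivity))
  have h2 : 2 * ‖F 1‖ ^ 2 * (‖F 1‖ ^ 2 / ε ^ 2 - ν + 2 * n * Ω) ≤ 0 :=
    mul_nonpos_of_nonneg_of_nonpos (by positivity) h1
  have h3 : 0 ≤ (n : ℝ) ^ 2 * ‖F 1‖ ^ 2 := by positivity
  rw [boundaryTerm, h.neumann]
  simp only [mul_zero, Complex.zero_re, norm_zero, one_pow, div_one]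
  linarith

/-- The integrand is continuous and nonpositive, so one point of strict negativity suffices; any
interior radius at which the density lies strictly between `0` and `S` is such a point. -/
theorem integral_bulkTerm_neg {S : ℝ} (h : IsVortexProfile n ε ν F K) (hn : 2 ≤ n) (hε : 0 < ε)
    (hS0 : 0 < S) (hS : ∀ r ∈ Set.Ioc (0 : ℝ) 1, ‖F r‖ ^ 2 ≤ S)
    (hSmax : ∃ r ∈ Set.Ioc (0 : ℝ) 1, ‖F r‖ ^ 2 = S)
    (hx : ∀ x, x / ε ^ 2 - ν + 2 * n * Ω ≤ (x - S) / ε ^ 2) :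
    ∫ r in Set.Ioo (0 : ℝ) 1, bulkTerm n ε Ω ν F r < 0 := by
  have dg := h.bddCont_bulkTerm (Ω := Ω) hn
  have hle : ∀ r ∈ Set.Ioo (0 : ℝ) 1, bulkTerm n ε Ω ν F r ≤ 0 := fun r hr =>
    div_nonpos_of_nonpos_of_nonneg (mul_nonpos_of_nonneg_of_nonpos (by positivity) ((hx _).trans
      (div_nonpos_of_nonpos_of_nonneg (sub_nonpos.2 (hS r ⟨hr.1, hr.2.le⟩)) (by positivity))))
      (pow_nonneg hr.1.le 3)
  obtain ⟨r₀, hr₀, hr₀S⟩ := hSmax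
  obtain ⟨C, hC, hb⟩ := h.exists_core_bound hn
  obtain ⟨δ, hδ0, hδr, hδ⟩ : ∃ δ, 0 < δ ∧ δ < r₀ ∧ C ^ 2 * δ ≤ S / 2 := by
    refine ⟨min (r₀ / 2) (S / 2 / (C ^ 2 + 1)), lt_min (by linarith [hr₀.1]) (by positivity),
      (min_le_left _ _).trans_lt (by linarith [hr₀.1]), ?_⟩
    calc C ^ 2 * min (r₀ / 2) (S / 2 / (C ^ 2 + 1)) ≤ (C ^ 2 + 1) * (S / 2 / (C ^ 2 + 1)) :=
          mul_le_mul (by linarith) (min_le_right _ _)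
            (le_min (by linarith [hr₀.1]) (by positivity)) (by positivity)
      _ = S / 2 := by field_simp
  have hδ1 : δ < 1 := hδr.trans_le hr₀.2
  have hFδ : ‖F δ‖ ^ 2 ≤ S / 2 := by
    calc ‖F δ‖ ^ 2 ≤ (C * δ ^ 2) ^ 2 := by gcongr; exact (hb δ ⟨hδ0, hδ1⟩).1
      _ = C ^ 2 * δ ^ 4 := by ring
      _ ≤ C ^ 2 * δ ^ 1 := by
        gcongr _ * ?_
        exact pow_le_pow_of_le_one hδ0.le hδ1.le (by norm_num)
      _ ≤ S / 2 := by rwa [pow_one]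
  -- The density is at most `S/2` near the core and equals `S` at `r₀`, so it takes the value `S/2`
  -- in between.
  obtain ⟨s, hs, hsS⟩ := intermediate_value_Icc hδr.le
    ((h.contF.mono fun t ht => ⟨hδ0.trans_le ht.1, ht.2.trans hr₀.2⟩).norm.pow 2)
    (show S / 2 ∈ Set.Icc (‖F δ‖ ^ 2) (‖F r₀‖ ^ 2) from ⟨hFδ, by linarith⟩)
  replace hsS : ‖F s‖ ^ 2 = S / 2 := hsS
  have hs1 : s < 1 := by
    refine (hs.2.trans hr₀.2).lt_of_ne fun h1 => ?_
    have : r₀ = s := le_antisymm (h1 ▸ hr₀.2) hs.2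
    rw [← this, hr₀S] at hsS
    linarith
  have hs0 : s ∈ Set.Ioo (0 : ℝ) 1 := ⟨hδ0.trans_le hs.1, hs1⟩
  have hneg : bulkTerm n ε Ω ν F s < 0 := by
    have h1 := hx (‖F s‖ ^ 2)
    have h2 : (‖F s‖ ^ 2 - S) / ε ^ 2 < 0 :=
      div_neg_of_neg_of_pos (by linarith) (by positivity)
    exact div_neg_of_neg_of_pos (mul_neg_of_pos_of_neg (by rw [hsS]; linarith) (by linarith))
      (pow_pos hs0.1 3)
  by_contra hc
  have hz : ∫ r in Set.Ioo (0 : ℝ) 1, (-bulkTerm n ε Ω ν F) r = 0 := by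
    rw [integral_neg']
    have := setIntegral_nonpos measurableSet_Ioo hle (μ := volume)
    linarith
  rw [integral_eq_zero_iff_of_nonneg_ae _ dg.integrable.neg] at hz
  · have := Measure.eqOn_open_of_ae_eq hz isOpen_Ioo dg.1.neg continuousOn_const hs0
    rw [Pi.neg_apply, Pi.zero_apply] at this
    linarith
  · filter_upwards [ae_restrict_mem measurableSet_Ioo] with r hr
    exact neg_nonneg.2 (hle r hr)

end IsVortexProfile

/-- A density bounded by `S` on a disc of area `π` has mass at most `πS`, and the mass is one;
taking `S = 0` excludes the zero profile. -/
theorem exists_ne_zero_and_bound {n : ℕ} {F : ℝ → ℂ} {Ψ : Triple} (h1 : ‖Ψ.1‖ = 1)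
    (hF : ∀ᵐ z ∂discMeasure, Ψ.1 z = mode n F z) :
    (∃ r ∈ Set.Ioc (0 : ℝ) 1, F r ≠ 0) ∧
      ∀ S, (∀ r ∈ Set.Ioc (0 : ℝ) 1, ‖F r‖ ^ 2 ≤ S) → 1 / Real.pi ≤ S := by
  have h2 := norm_sq_eq_integral Ψ.1
  rw [h1, one_pow] at h2
  have key : ∀ S, (∀ r ∈ Set.Ioc (0 : ℝ) 1, ‖F r‖ ^ 2 ≤ S) → 1 / Real.pi ≤ S := by
    intro S hS
    have h3 : ∫ z in disc, ‖Ψ.1 z‖ ^ 2 ≤ ∫ z in disc, S := by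
      refine integral_mono_ae ((Lp.memLp Ψ.1).integrable_norm_pow (by norm_num))
        (integrable_const _) ?_
      filter_upwards [hF, ae_mem_puncturedDisc] with z hz hp
      rw [hz, norm_mode hp.2]
      exact hS _ ⟨norm_pos_iff.2 hp.2, by simpa [disc] using (Metric.mem_ball.1 hp.1).le⟩
    rw [← h2, integral_const, smul_eq_mul] at h3
    have h4 : discMeasure.real Set.univ = Real.pi := by
      simp [Measure.real, Complex.volume_ball]
    rw [h4] at h3
    rwa [div_le_iff₀ Real.pi_pos, mul_comm]
  refine ⟨?_, key⟩
  by_contra! hc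
  have := key 0 fun r hr => by rw [hc r hr]; simp
  have h3 : 0 < 1 / Real.pi := by positivity
  linarith

theorem IsVortexProfile.exists_direction {n : ℕ} {ε ν : ℝ} {F K : ℝ → ℂ}
    (h : IsVortexProfile n ε ν F K) (hn : 2 ≤ n) :
    ∃ W ∈ H1Disc, EssBounded W.1 ∧ IsModePair n (upper n F K) (upperDeriv n ε ν F K)
      (lower n F K) (lowerDeriv n ε ν F K) W := by
  obtain ⟨C, hC⟩ := h.exists_direction_bound hn
  obtain ⟨W₁, hW₁, hm₁, hb₁⟩ := exists_isMode (n + 2) (fun r hr => h.hasDerivAt_upper hr)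
    h.continuousOn_upperDeriv (fun r hr => (hC r hr).2.1) (fun r hr => (hC r hr).2.2.2.1)
    (fun r hr => by exact_mod_cast (hC r hr).2.2.2.2.2.1)
  obtain ⟨W₂, hW₂, hm₂, hb₂⟩ := exists_isMode (n - 2) (fun r hr => h.hasDerivAt_lower hr)
    h.continuousOn_lowerDeriv (fun r hr => (hC r hr).2.2.1) (fun r hr => (hC r hr).2.2.2.2.1)
    (fun r hr => by simpa using (hC r hr).2.2.2.2.2.2)
  exact ⟨W₁ + (1 : ℝ) • W₂, H1Disc.add hW₁ (H1Disc.smul hW₂ 1), hb₁.add (hb₂.smul 1), isModePair_add hm₁ hm₂⟩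

end GrossPitaevskii

end

theorem mainTheorem8 (ε Ω : ℝ) (hε : 0 < ε) (hΩ : Ω ≤ 1 / (Real.sqrt Real.pi * ε))
    (n : ℕ) (hn : 2 ≤ n) (Ψ : GrossPitaevskii.Triple)
    (hΨ : Ψ ∈ GrossPitaevskii.normalizedWithAngularMomentum n)
    (hmin : IsMinOn (GrossPitaevskii.energy ε Ω)
      (GrossPitaevskii.normalizedWithAngularMomentum n) Ψ) :
    ¬ IsLocalMinOn (GrossPitaevskii.energy ε Ω) GrossPitaevskii.normalized Ψ := by
  open GrossPitaevskii in
  obtain ⟨F, K, h, hF, hD⟩ := exists_isVortexProfile (by omega) hΨ hmin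
  obtain ⟨hne, hmass⟩ := exists_ne_zero_and_bound hΨ.1.2 hF
  obtain ⟨S, hS0, hS, hSmax, hν⟩ := h.exists_max hn hne
  have hx := IsVortexProfile.bulk_factor_le hε hΩ (hmass S hS) hν
  obtain ⟨W, hW, hbW, hm⟩ := h.exists_direction hn
  have hb : EssBounded Ψ.1 := by
    obtain ⟨C, hC⟩ := h.bdd
    refine ⟨C, ?_⟩
    filter_upwards [hF, ae_mem_puncturedDisc] with z hz hp
    rw [hz, norm_mode hp.2]
    exact hC _ ⟨norm_pos_iff.2 hp.2, by simpa [disc] using (Metric.mem_ball.1 hp.1).le⟩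
  have hi := (BddCont.id.mul (h.bddCont_variation (Ω := Ω) hn (multiplier ε Ω Ψ))).integrable
  refine not_isLocalMinOn_of_second_variation_neg hΨ.1 hb hW hbW
    (crossForm_modePair_eq_zero hF hD hΨ.2 hm) (integral_norm_sq_mul_re_eq_zero hF hm)
    (integral_re_conj_mul_eq_zero hF hm) ?_
  rw [second_variation_eq hb hbW hF hm (fun r hr => h.conj_mul_upper_add hr) hi]
  have hv := h.integral_variation (Ω := Ω) hn
  -- With `ν = μ + nΩ`, the coefficient `ν - nΩ` of the radial computation is the Lagrange
  -- multiplier `μ` itself.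
  rw [add_sub_cancel_right] at hv
  rw [hv]
  have h1 := h.boundaryTerm_one_le hS hx
  have h2 := h.integral_bulkTerm_neg hn hε hS0 hS hSmax hx
  exact mul_neg_of_pos_of_neg (by positivity) (by linarith)
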